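/- **Setting.** Let $n\ge 2$, let $\Omega\subset\mathbb R^n$ be a bounded domain (non-empty, open, connected; no regularity of the boundary is needed), and let $a,b,\lambda>0$, $0<q<n-1$, $2n-1<p+1$, $1<\beta<\frac{n}{n-1}$ be real numbers. Let $h\in L^{\gamma}(\Omega)$ with $\gamma=\frac{n}{n-q-1}$ be real-valued (possibly sign-changing) with $h^+\not\equiv 0$, i.e. $h>0$ on a set of positive measure. Let $W^{1,n}_0(\Omega)$ be the closure of $C_c^\infty(\Omega)$ in $W^{1,n}(\Omega)$, with the norm $\|u\|=\left(\int_\Omega|\nabla u|^n\right)^{1/n}$. Put $m(s)=as+b$, $M(t)=\int_0^t m(s)\,ds$, $g(s)=s|s|^pe^{|s|^\beta}$, $G(t)=\int_0^t g(s)\,ds$, $H(u)=\int_\Omega h|u|^{q+1}dx$, and $$J_{\lambda,M}(u)=\frac1n M(\|u\|^n)-\frac{\lambda}{q+1}H(u)-\int_\Omega G(u)\,dx,\qquad u\in W^{1,n}_0(\Omega).$$ For $u\in W^{1,n}_0(\Omega)$ let $\phi_u(t)=J_{\lambda,M}(tu)$, and let $$\mathcal N_{\lambda,M}=\{u:\phi_u'(1)=0\},\qquad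 \mathcal N^+_{\lambda,M}=\{u\in\mathcal N_{\lambda,M}:\phi_u''(1)>0\},$$ $$H^+=\{u:H(u)>0\},\qquad H^+_0=\{u:H(u)\ge0\},$$ $$\Lambda=\left\{u:\ \|u\|^{3n/2}\le\frac{\int_\Omega g'(u)u^2\,dx}{2\sqrt{ab(2n-1-q)(n-1-q)}}\right\}.$$ **Theorem 3.12.** Assume that $\lambda$ is such that $$\inf_{u\in(\Lambda\setminus\{0\})\cap H_0^+}\left\{\int_\Omega\left(p+2-2n+\beta|u|^\beta\right)|u|^{p+2}e^{|u|^\beta}dx-(2n-1-q)\,\lambda\int_\Omega h|u|^{q+1}dx\right\}>0 .$$ 1. Every $u_\lambda\in\mathcal N^+_{\lambda,M}\cap H^+$ with $J_{\lambda,M}(u_\lambda)=\min_{\mathcal N_{\lambda,M}\setminus\{0\}}J_{\lambda,M}$ is a local minimum of $J_{\lambda,M}$ in the whole space: there is $\delta>0$ such that $J_{\lambda,M}(u_\lambda)\le J_{\lambda,M}(v)$ for all $v\in W^{1,n}_0(\Omega)$ with $\|v-u_\lambda\|<\delta$. 2. There is such a minimizer $u_\lambda\in\mathcal N^+_{\lambda,M}\cap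 H^+$ with $u_\lambda\ge0$ a.e. in $\Omega$ (and it is then a local minimum of $J_{\lambda,M}$ in $W^{1,n}_0(\Omega)$, too). -/

import Mathlib

open MeasureTheory
open scoped ENNReal ContDiff

noncomputable section

namespace Kirchhoff

/-- Euclidean space `ℝⁿ`. -/
abbrev Eucl (n : ℕ) : Type := EuclideanSpace ℝ (Fin n)

instance factOneLe (n : ℕ) [hn : Fact (2 ≤ n)] : Fact ((1 : ℝ≥0∞) ≤ (n : ℝ≥0∞)) :=
  ⟨by exact_mod_cast le_trans (by norm_num) hn.out⟩

section Sobolev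

variable {n : ℕ} [Fact (2 ≤ n)]

/-- The pairs `(φ, ∇φ)` in `Lⁿ(Ω) × Lⁿ(Ω; ℝⁿ)` with `φ ∈ C_c^∞(Ω)`. -/
def testPairs (Ω : Set (Eucl n)) :
    Set (Lp ℝ (n : ℝ≥0∞) (volume.restrict Ω) × Lp (Eucl n) (n : ℝ≥0∞) (volume.restrict Ω)) :=
  {w | ∃ φ : Eucl n → ℝ, ContDiff ℝ ∞ φ ∧ HasCompactSupport φ ∧ tsupport φ ⊆ Ω ∧
    w.1 =ᵐ[volume.restrict Ω] φ ∧ w.2 =ᵐ[volume.restrict Ω] gradient φ}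

/-- The Sobolev space `W₀^{1,n}(Ω)`: the closure of `C_c^∞(Ω)` in the `W^{1,n}(Ω)` norm.
A function `u` is stored together with its gradient, as the pair `(u, ∇u)` of an element of
`Lⁿ(Ω)` and an element of `Lⁿ(Ω; ℝⁿ)`.  The second component of a limit of pairs `(φ, ∇φ)` is
the weak gradient of the first one, so it is determined by the first one.
(The set `testPairs Ω` is already a linear subspace; the span only records this.) -/
def W0 (Ω : Set (Eucl n)) : Submodule ℝ
    (Lp ℝ (n : ℝ≥0∞) (volume.restrict Ω) × Lp (Eucl n) (n : ℝ≥0∞) (volume.restrict Ω)) :=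
  (Submodule.span ℝ (testPairs Ω)).topologicalClosure

variable {Ω : Set (Eucl n)}

/-- The function underlying an element of `W₀^{1,n}(Ω)`. -/
def fn (u : W0 Ω) : Eucl n → ℝ := u.1.1

/-- The norm `‖u‖ = (∫_Ω |∇u|ⁿ)^{1/n}` of `W₀^{1,n}(Ω)`, i.e. the `Lⁿ` norm of the gradient. -/
def gradNorm (u : W0 Ω) : ℝ := ‖u.1.2‖

end Sobolev

/-- The Kirchhoff function `m(s) = a s + b`. -/
def m (a b s : ℝ) : ℝ := a * s + b

/-- The primitive `M(t) = ∫₀ᵗ m(s) ds`. -/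
def M (a b t : ℝ) : ℝ := ∫ s in (0 : ℝ)..t, m a b s

/-- The nonlinearity `g(s) = s |s|^p e^{|s|^β}`. -/
def g (p β s : ℝ) : ℝ := s * |s| ^ p * Real.exp (|s| ^ β)

/-- The primitive `G(t) = ∫₀ᵗ g(s) ds`. -/
def G (p β t : ℝ) : ℝ := ∫ s in (0 : ℝ)..t, g p β s

section Functional

variable {n : ℕ} [Fact (2 ≤ n)] {Ω : Set (Eucl n)}

/-- `H(u) = ∫_Ω h |u|^{q+1}`. -/
def H (h : Eucl n → ℝ) (q : ℝ) (u : W0 Ω) : ℝ :=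
  ∫ x in Ω, h x * |fn u x| ^ (q + 1)

/-- The energy
`J(u) = (1/n) M(‖u‖ⁿ) - (λ/(q+1)) ∫_Ω h |u|^{q+1} - ∫_Ω G(u)`. -/
def J (h : Eucl n → ℝ) (a b p q β lam : ℝ) (u : W0 Ω) : ℝ :=
  1 / (n : ℝ) * M a b (gradNorm u ^ n) - lam / (q + 1) * H h q u - ∫ x in Ω, G p β (fn u x)

/-- The fibering map `φ_u(t) = J(t u)`. -/
def fiber (h : Eucl n → ℝ) (a b p q β lam : ℝ) (u : W0 Ω) (t : ℝ) : ℝ :=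
  J h a b p q β lam (t • u)

/-- The Nehari manifold `{u : φ_u'(1) = 0}`, that is, `⟨J'(u), u⟩ = 0`. -/
def nehari (Ω : Set (Eucl n)) (h : Eucl n → ℝ) (a b p q β lam : ℝ) : Set (W0 Ω) :=
  {u | deriv (fiber h a b p q β lam u) 1 = 0}

/-- The part of the Nehari manifold on which `φ_u''(1) > 0`. -/
def nehariPlus (Ω : Set (Eucl n)) (h : Eucl n → ℝ) (a b p q β lam : ℝ) : Set (W0 Ω) :=
  {u | u ∈ nehari Ω h a b p q β lam ∧ 0 < deriv (deriv (fiber h a b p q β lam u)) 1}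

/-- `H⁺ = {u : H(u) > 0}`. -/
def Hplus (Ω : Set (Eucl n)) (h : Eucl n → ℝ) (q : ℝ) : Set (W0 Ω) := {u | 0 < H h q u}

/-- `H₀⁺ = {u : H(u) ≥ 0}`. -/
def HplusZero (Ω : Set (Eucl n)) (h : Eucl n → ℝ) (q : ℝ) : Set (W0 Ω) := {u | 0 ≤ H h q u}

/-- The set `Λ` of all `u` with
`‖u‖^{3n/2} ≤ (∫_Ω g'(u) u²) / (2 √(a b (2n-1-q) (n-1-q)))`. -/
def LambdaSet (Ω : Set (Eucl n)) (a b p q β : ℝ) : Set (W0 Ω) :=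
  {u | gradNorm u ^ (3 * (n : ℝ) / 2) ≤
    (∫ x in Ω, deriv (g p β) (fn u x) * fn u x ^ 2) /
      (2 * Real.sqrt (a * b * (2 * n - 1 - q) * (n - 1 - q)))}

/-- The infimum, over all nonzero `u ∈ Λ ∩ H₀⁺`, of
`∫_Ω (p + 2 - 2n + β |u|^β) |u|^{p+2} e^{|u|^β} - (2n-1-q) λ ∫_Ω h |u|^{q+1}`,
taken in the extended reals. -/
def LambdaInf (Ω : Set (Eucl n)) (h : Eucl n → ℝ) (a b p q β lam : ℝ) : EReal :=
  ⨅ u ∈ (LambdaSet Ω a b p q β \ {0}) ∩ HplusZero Ω h q,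
    (((∫ x in Ω, (p + 2 - 2 * n + β * |fn u x| ^ β) * |fn u x| ^ (p + 2) *
        Real.exp (|fn u x| ^ β)) - (2 * n - 1 - q) * lam * H h q u : ℝ) : EReal)

/-- `u` belongs to `𝒩⁺ ∩ H⁺` and minimizes `J` over `𝒩 ∖ {0}`. -/
def IsNehariMinimizer (h : Eucl n → ℝ) (a b p q β lam : ℝ) (u : W0 Ω) : Prop :=
  u ∈ nehariPlus Ω h a b p q β lam ∩ Hplus Ω h q ∧
    IsMinOn (J h a b p q β lam) (nehari Ω h a b p q β lam \ {0}) u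

/-- `u` is a local minimum of `J` in the whole space `W₀^{1,n}(Ω)` with its norm `‖·‖`. -/
def IsLocalMinimum (h : Eucl n → ℝ) (a b p q β lam : ℝ) (u : W0 Ω) : Prop :=
  ∃ δ > 0, ∀ v : W0 Ω, gradNorm (v - u) < δ → J h a b p q β lam u ≤ J h a b p q β lam v

end Functional

end Kirchhoff

end

/-!
Write `φ_u(t) = J(tu)`, let `H⁺` be the set where `H(u) > 0`, and divide `φ_u'(t)` by `t ^ q`: the
contribution of `H` becomes constant. At a critical point of `φ_u'(t) / t ^ q` the two Kirchhoff
terms add up to `∫ (g'(v) v² - q g(v) v)` with `v = tu`, and the inequality between arithmetic and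
geometric means puts `v` into `Λ`. If moreover `H(u) ≥ 0`, the assumption on `λ` then says that
`φ_u'(t) > 0` there (`dFiber_pos_of_ddFiber_eq`). Hence `φ_u'(t) / t ^ q` has no nonpositive
critical value. For `H(u) > 0`, where `φ_u'` is negative near zero, this has two consequences:

* `φ_u` has a first critical point `t₁`, and `φ_u''(t₁) > 0`, so that `t₁ u ∈ 𝒩⁺`
  (`exists_first_critical`);
* between `t₁` and any later critical point `φ_u` does not decrease (`fiber_le_of_critical`).

A point of `𝒩` with negative energy lies in `H⁺`, since on `𝒩` the functional `J` is bounded below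
by a multiple of `-λ H`; so minimizing `J` over `𝒩 ∖ {0}` amounts to minimizing it over the first
critical points (`exists_firstCritical_le`), where it is negative. A minimizing sequence of these is
bounded, because `q + 1 < n`, and has a weak limit, which may be replaced by its absolute value `w`
(`exists_limit`). Its energy may be lower because the norm may drop, but the norm enters `φ_u(t)`
through increasing powers of `t`. Therefore `φ_w` is a limit of functions decreasing on `[0, 1]`
minus a nondecreasing one, so that its first critical point is not before `1`, and moving there only
lowers the energy (`exists_smul_mem_nehariPlus`).

Any minimizer `u ∈ 𝒩⁺` is a local minimum of `J` because `1` is a strict local minimum of `φ_u`: by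
continuity of `J`, for `v` near `u` with `J(v) < J(u)` the function `φ_v` would have an interior
minimum near `1`, that is, a multiple of `v` in `𝒩` with energy below `J(u)` (`isLocalMinimum`).

The analytic facts needed are proved for `W₀^{1,n}(Ω)` without any regularity of `Ω`. Subcritical
exponential integrability (`exists_lintegral_exp_le`) comes from Maz'ya's truncation method applied
to the Gagliardo–Nirenberg–Sobolev inequality for `W^{1,1}`. Weak compactness
(`exists_subseq_weakLimit`) comes from the Rellich–Kondrachov theorem in `L¹`, proved by averaging
over grids, and from Clarkson's inequality, which also shows that `|u|` has at most the norm of `u`.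
Together they make the lower order terms of `J` continuous along bounded sequences converging almost
everywhere.
-/

namespace Kirchhoff

/-! ### Exponential integrability of compactly supported functions -/

/-- A bound for the derivative of the smooth step `Real.smoothTransition`, which moreover vanishes
outside the unit interval. -/
theorem exists_deriv_smoothTransition_bound :
    ∃ L : ℝ, 0 < L ∧ ∀ s : ℝ, |deriv Real.smoothTransition s| ≤ L ∧
      (s ∉ Set.Ioo (0 : ℝ) 1 → deriv Real.smoothTransition s = 0) := by
  have hz : ∀ s : ℝ, s ∉ Set.Ioo (0 : ℝ) 1 → deriv Real.smoothTransition s = 0 := by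
    intro s hs
    rw [Set.mem_Ioo, not_and_or, not_lt, not_lt] at hs
    rcases hs with hs | hs
    · have : IsLocalMin Real.smoothTransition s := by
        refine Filter.Eventually.of_forall fun y => ?_
        rw [Real.smoothTransition.zero_of_nonpos hs]
        exact Real.smoothTransition.nonneg y
      exact this.deriv_eq_zero
    · have : IsLocalMax Real.smoothTransition s := by
        refine Filter.Eventually.of_forall fun y => ?_
        rw [Real.smoothTransition.one_of_one_le hs]
        exact Real.smoothTransition.le_one y
      exact this.deriv_eq_zero
  have hc : Continuous (deriv Real.smoothTransition) :=
    (Real.smoothTransition.contDiff (n := 1)).continuous_deriv le_rfl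
  obtain ⟨L, hL⟩ := (isCompact_Icc (a := (0 : ℝ)) (b := 1)).exists_bound_of_continuousOn
    hc.continuousOn
  refine ⟨max L 1, by positivity, fun s => ⟨?_, hz s⟩⟩
  by_cases hs : s ∈ Set.Ioo (0 : ℝ) 1
  · exact (hL s ⟨hs.1.le, hs.2.le⟩).trans (le_max_left _ _)
  · rw [hz s hs, abs_zero]; positivity

theorem holderConjugate_dim {n : ℕ} (hn : 2 ≤ n) :
    Real.HolderConjugate (n : ℝ) ((n : ℝ) / (n - 1)) :=
  Real.HolderConjugate.conjExponent (by exact_mod_cast hn)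

/-- Maz'ya's truncation: the Gagliardo–Nirenberg–Sobolev inequality for `W^{1,1}`, applied to a
smooth truncation of `φ` between the levels `t` and `t + τ`. -/
theorem exists_truncation_const (n : ℕ) (hn : 2 ≤ n) :
    ∃ A : ℝ, 0 < A ∧ ∀ φ : Eucl n → ℝ, ContDiff ℝ 1 φ → HasCompactSupport φ →
      ∀ t τ : ℝ, 0 ≤ t → 0 < τ →
      ENNReal.ofReal (τ ^ ((n : ℝ) / (n - 1))) * volume {x | t + τ < φ x} ≤
        ENNReal.ofReal A *
          (∫⁻ x in {x | t < φ x ∧ φ x ≤ t + τ}, ‖fderiv ℝ φ x‖ₑ ^ (n : ℝ)) ^ (1 / ((n : ℝ) - 1)) *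
          volume {x | t < φ x ∧ φ x ≤ t + τ} := by
  obtain ⟨L, hL0, hL⟩ := exists_deriv_smoothTransition_bound
  set r : ℝ := (n : ℝ) / (n - 1) with hr
  have hnr : Real.HolderConjugate (n : ℝ) r := holderConjugate_dim hn
  have hr0 : 0 < r := hnr.symm.pos
  have hn1 : (0 : ℝ) < n - 1 := by
    have : (2 : ℝ) ≤ n := by exact_mod_cast hn
    linarith
  set C := lintegralPowLePowLIntegralFDerivConst (volume : Measure (Eucl n)) r with hC
  refine ⟨(C + 1) * L ^ r, by positivity, ?_⟩
  intro φ hφ hφc t τ ht hτ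
  set S := {x : Eucl n | t < φ x ∧ φ x ≤ t + τ} with hS
  have hφm : Measurable φ := hφ.continuous.measurable
  have hSm : MeasurableSet S :=
    (measurableSet_lt measurable_const hφm).inter (measurableSet_le hφm measurable_const)
  set w : Eucl n → ℝ := fun x => Real.smoothTransition ((φ x - t) / τ) with hw
  have hwd : ContDiff ℝ 1 w :=
    Real.smoothTransition.contDiff.comp ((hφ.sub contDiff_const).div_const τ)
  have hwc : HasCompactSupport w := by
    refine hφc.mono fun x hx => ?_
    simp only [Function.mem_support, hw, ne_eq, Real.smoothTransition.zero_iff_nonpos] at hx ⊢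
    intro h0
    rw [h0] at hx
    exact hx (div_nonpos_of_nonpos_of_nonneg (by linarith) hτ.le)
  have hfd : ∀ x, ‖fderiv ℝ w x‖ₑ ≤
      S.indicator (fun x => ENNReal.ofReal (L / τ) * ‖fderiv ℝ φ x‖ₑ) x := by
    intro x
    have hd : HasFDerivAt φ (fderiv ℝ φ x) x :=
      (hφ.differentiable one_ne_zero x).hasFDerivAt
    have h1 : HasFDerivAt (fun x => (φ x - t) / τ) (τ⁻¹ • fderiv ℝ φ x) x := by
      simpa [div_eq_inv_mul] using (hd.sub_const t).const_mul τ⁻¹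
    have h2 : HasDerivAt Real.smoothTransition (deriv Real.smoothTransition ((φ x - t) / τ))
        ((φ x - t) / τ) :=
      ((Real.smoothTransition.contDiff (n := 1)).differentiable one_ne_zero _).hasDerivAt
    have h3 := (h2.comp_hasFDerivAt x h1).fderiv
    have h4 : fderiv ℝ w x =
      deriv Real.smoothTransition ((φ x - t) / τ) • τ⁻¹ • fderiv ℝ φ x := h3
    by_cases hx : x ∈ S
    · rw [Set.indicator_of_mem hx, h4, smul_smul, enorm_smul]
      gcongr
      rw [← ofReal_norm, norm_mul, Real.norm_eq_abs, norm_inv, Real.norm_of_nonneg hτ.le,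
        ← div_eq_mul_inv]
      gcongr
      exact (hL _).1
    · have : (φ x - t) / τ ∉ Set.Ioo (0 : ℝ) 1 := by
        intro h
        apply hx
        have h1 := h.1
        have h2 := h.2
        rw [div_lt_one hτ] at h2
        rw [lt_div_iff₀ hτ] at h1
        exact ⟨by linarith, by linarith⟩
      rw [h4, (hL _).2 this, zero_smul]
      exact (enorm_zero (E := Eucl n →L[ℝ] ℝ)).le.trans zero_le
  have hGNS := lintegral_pow_le_pow_lintegral_fderiv (volume : Measure (Eucl n)) hwd hwc
    (p := r) (by simpa using hnr)
  rw [← hC] at hGNS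
  have hlow : volume {x | t + τ < φ x} ≤ ∫⁻ x, ‖w x‖ₑ ^ r := by
    have hm : MeasurableSet {x | t + τ < φ x} := measurableSet_lt measurable_const hφm
    rw [← lintegral_indicator_one hm]
    refine lintegral_mono fun x => ?_
    by_cases hx : x ∈ {x | t + τ < φ x}
    · have : w x = 1 := by
        apply Real.smoothTransition.one_of_one_le
        rw [one_le_div hτ]
        have : t + τ < φ x := hx
        linarith
      rw [Set.indicator_of_mem hx, this]
      simp
    · simp [Set.indicator_of_notMem hx]
  have hmeas : Measurable fun x => ‖fderiv ℝ φ x‖ₑ :=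
    (hφ.continuous_fderiv one_ne_zero).enorm.measurable
  have hHol : ∫⁻ x in S, ‖fderiv ℝ φ x‖ₑ ≤
      (∫⁻ x in S, ‖fderiv ℝ φ x‖ₑ ^ (n : ℝ)) ^ (1 / (n : ℝ)) * volume S ^ (1 / r) := by
    have := ENNReal.lintegral_mul_le_Lp_mul_Lq (volume.restrict S) hnr
      (f := fun x => ‖fderiv ℝ φ x‖ₑ) (g := fun _ => 1) hmeas.aemeasurable aemeasurable_const
    simpa using this
  have hup : ∫⁻ x, ‖fderiv ℝ w x‖ₑ ≤ ENNReal.ofReal (L / τ) *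
      ((∫⁻ x in S, ‖fderiv ℝ φ x‖ₑ ^ (n : ℝ)) ^ (1 / (n : ℝ)) * volume S ^ (1 / r)) := by
    calc _ ≤ ∫⁻ x, S.indicator (fun x => ENNReal.ofReal (L / τ) * ‖fderiv ℝ φ x‖ₑ) x :=
          lintegral_mono hfd
      _ = ENNReal.ofReal (L / τ) * ∫⁻ x in S, ‖fderiv ℝ φ x‖ₑ := by
          rw [lintegral_indicator hSm, lintegral_const_mul _ hmeas]
      _ ≤ _ := by gcongr
  have hexp : 1 / (n : ℝ) * r = 1 / ((n : ℝ) - 1) := by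
    have : (n : ℝ) ≠ 0 := by positivity
    rw [hr]; field_simp
  calc ENNReal.ofReal (τ ^ r) * volume {x | t + τ < φ x}
      ≤ ENNReal.ofReal (τ ^ r) * (C * (ENNReal.ofReal (L / τ) *
        ((∫⁻ x in S, ‖fderiv ℝ φ x‖ₑ ^ (n : ℝ)) ^ (1 / (n : ℝ)) * volume S ^ (1 / r))) ^ r) := by
        gcongr
        exact hlow.trans (hGNS.trans (by gcongr))
    _ = (ENNReal.ofReal (τ ^ r) * (C * ENNReal.ofReal ((L / τ) ^ r))) *
        (∫⁻ x in S, ‖fderiv ℝ φ x‖ₑ ^ (n : ℝ)) ^ (1 / ((n : ℝ) - 1)) * volume S := by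
        rw [ENNReal.mul_rpow_of_nonneg _ _ hr0.le, ENNReal.mul_rpow_of_nonneg _ _ hr0.le,
          ← ENNReal.rpow_mul, ← ENNReal.rpow_mul, hexp, one_div_mul_cancel hr0.ne',
          ENNReal.rpow_one, ENNReal.ofReal_rpow_of_pos (by positivity)]
        ring
    _ ≤ _ := by
        gcongr
        rw [← ENNReal.ofReal_coe_nnreal, ← ENNReal.ofReal_mul (by positivity),
          ← ENNReal.ofReal_mul (by positivity)]
        apply ENNReal.ofReal_le_ofReal
        rw [Real.div_rpow hL0.le hτ.le]
        have : 0 < τ ^ r := by positivity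
        have hLr : 0 < L ^ r := by positivity
        rw [show τ ^ r * (↑C * (L ^ r / τ ^ r)) = C * L ^ r by field_simp]
        nlinarith

/-- Iterating the truncation estimate: the super-level sets of `φ` decay geometrically along a
sequence of levels which grows like `N ^ ((n - 1) / n)`. -/
theorem exists_superlevel_decay (n : ℕ) (hn : 2 ≤ n) :
    ∃ B : ℝ, 0 < B ∧ ∀ φ : Eucl n → ℝ, ContDiff ℝ 1 φ → HasCompactSupport φ →
      ∀ K : ℝ, 0 < K → ∫⁻ x, ‖fderiv ℝ φ x‖ₑ ^ (n : ℝ) ≤ ENNReal.ofReal (K ^ (n : ℝ)) →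
      ∀ N : ℕ, volume.real {x | B * K * (N : ℝ) ^ (((n : ℝ) - 1) / n) < φ x} ≤
        (2 : ℝ) ^ (-(N : ℝ) / 2) * volume.real {x | 0 < φ x} := by
  obtain ⟨A, hA0, hA⟩ := exists_truncation_const n hn
  have hn2 : (2 : ℝ) ≤ n := by exact_mod_cast hn
  have hn1 : (0 : ℝ) < n - 1 := by linarith
  have hn0 : (0 : ℝ) < n := by linarith
  set r : ℝ := (n : ℝ) / (n - 1) with hr
  have hr0 : 0 < r := by positivity
  refine ⟨A ^ (1 / r) * 2 ^ (1 / (n : ℝ)), by positivity, ?_⟩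
  intro φ hφ hφc K hK hφK N
  rcases Nat.eq_zero_or_pos N with rfl | hN
  · have : (n - 1 : ℝ) / n ≠ 0 := by positivity
    simp [Real.zero_rpow this]
  have hN0 : (0 : ℝ) < N := by exact_mod_cast hN
  -- With this step, `τ ^ r` equals the factor `A d ^ (1 / (n - 1))` of the truncation estimate for
  -- energy `d = 2 K ^ n / N`, twice the average over `N` levels.
  set τ : ℝ := A ^ (1 / r) * (2 * K ^ (n : ℝ) / N) ^ (1 / (n : ℝ)) with hτ
  have hτ0 : 0 < τ := by positivity
  have hτr : τ ^ r = A * (2 * K ^ (n : ℝ) / N) ^ (1 / ((n : ℝ) - 1)) := by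
    rw [hτ, Real.mul_rpow (by positivity) (by positivity), ← Real.rpow_mul hA0.le,
      one_div_mul_cancel hr0.ne', Real.rpow_one, ← Real.rpow_mul (by positivity)]
    congr 2
    rw [hr]; field_simp
  have hlev : A ^ (1 / r) * 2 ^ (1 / (n : ℝ)) * K * (N : ℝ) ^ (((n : ℝ) - 1) / n) = N * τ := by
    rw [hτ, Real.div_rpow (by positivity) hN0.le, Real.mul_rpow (by norm_num) (by positivity),
      ← Real.rpow_mul hK.le, mul_one_div_cancel hn0.ne', Real.rpow_one]
    have : (N : ℝ) ^ (((n : ℝ) - 1) / n) = N / N ^ (1 / (n : ℝ)) := by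
      rw [show ((n : ℝ) - 1) / n = 1 - 1 / n by field_simp, Real.rpow_sub hN0, Real.rpow_one]
    rw [this]; ring
  rw [hlev]
  have hφm : Measurable φ := hφ.continuous.measurable
  have hfin : ∀ t : ℝ, 0 ≤ t → volume {x | t < φ x} ≠ ⊤ := by
    intro t ht
    refine ne_top_of_le_ne_top hφc.isCompact.measure_lt_top.ne (measure_mono fun x hx => ?_)
    apply subset_tsupport
    have : t < φ x := hx
    simp only [Function.mem_support]
    linarith
  set S : ℕ → Set (Eucl n) := fun j => {x | j * τ < φ x ∧ φ x ≤ j * τ + τ} with hS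
  have hSm : ∀ j, MeasurableSet (S j) := fun j =>
    (measurableSet_lt measurable_const hφm).inter (measurableSet_le hφm measurable_const)
  set D : ℕ → ℝ≥0∞ := fun j => ∫⁻ x in S j, ‖fderiv ℝ φ x‖ₑ ^ (n : ℝ) with hD
  have hdisj : Pairwise (Function.onFun Disjoint S) := by
    have key : ∀ i j : ℕ, i < j → Disjoint (S i) (S j) := by
      intro i j hij
      rw [Set.disjoint_left]
      intro x hxi hxj
      have h1 : φ x ≤ i * τ + τ := hxi.2
      have h2 : j * τ < φ x := hxj.1
      have h3 : (i : ℝ) + 1 ≤ j := by exact_mod_cast hij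
      nlinarith
    intro i j hij
    rcases lt_or_gt_of_ne hij with h | h
    · exact key i j h
    · exact (key j i h).symm
  have hDsum : ∀ k, ∑ j ∈ Finset.range k, D j ≤ ENNReal.ofReal (K ^ (n : ℝ)) := by
    intro k
    rw [hD, ← lintegral_biUnion_finset (fun i _ j _ hij => hdisj hij) (fun j _ => hSm j)]
    exact (setLIntegral_le_lintegral _ _).trans hφK
  have hDtop : ∀ j, D j ≠ ⊤ := by
    intro j
    refine ne_top_of_le_ne_top ENNReal.ofReal_ne_top (le_trans ?_ (hDsum (j + 1)))
    exact Finset.single_le_sum (f := D) (fun _ _ => zero_le) (by simp)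
  set d : ℕ → ℝ := fun j => (D j).toReal with hd
  have hdsum : ∀ k, ∑ j ∈ Finset.range k, d j ≤ K ^ (n : ℝ) := by
    intro k
    rw [hd, ← ENNReal.toReal_sum (fun j _ => hDtop j)]
    exact ENNReal.toReal_le_of_le_ofReal (by positivity) (hDsum k)
  set μ : ℕ → ℝ := fun j => volume.real {x | j * τ < φ x} with hμ
  have hμ0 : ∀ j, 0 ≤ μ j := fun j => measureReal_nonneg
  have hstep : ∀ j, τ ^ r * μ (j + 1) ≤ A * d j ^ (1 / ((n : ℝ) - 1)) * (μ j - μ (j + 1)) := by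
    intro j
    have hjt : 0 ≤ (j : ℝ) * τ := by positivity
    have h1 := hA φ hφ hφc (j * τ) τ hjt hτ0
    have hset : {x | (j : ℝ) * τ < φ x} = S j ∪ {x | ((j + 1 : ℕ) : ℝ) * τ < φ x} := by
      ext x
      simp only [hS, Set.mem_ofPred_eq, Set.mem_union, Nat.cast_add, Nat.cast_one, add_mul, one_mul]
      constructor
      · intro h
        by_cases h' : φ x ≤ j * τ + τ
        · exact Or.inl ⟨h, h'⟩
        · exact Or.inr (not_le.1 h')
      · rintro (h | h)
        · exact h.1
        · linarith
    have hdis : Disjoint (S j) {x | ((j + 1 : ℕ) : ℝ) * τ < φ x} := by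
      rw [Set.disjoint_left]
      intro x hx hx'
      have h1 : φ x ≤ j * τ + τ := hx.2
      have h2 : ((j + 1 : ℕ) : ℝ) * τ < φ x := hx'
      push_cast at h2
      linarith
    have hSfin : volume (S j) ≠ ⊤ :=
      ne_top_of_le_ne_top (hfin _ hjt) (measure_mono fun x hx => hx.1)
    have hm : volume.real (S j) = μ j - μ (j + 1) := by
      have hj1 : 0 ≤ ((j + 1 : ℕ) : ℝ) * τ := by positivity
      have : μ j = volume.real (S j) + μ (j + 1) := by
        simp only [hμ]
        rw [hset, measureReal_union hdis (measurableSet_lt measurable_const hφm) hSfin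
          (hfin _ hj1)]
      linarith
    have h2 := ENNReal.toReal_mono (by
      refine ENNReal.mul_ne_top (ENNReal.mul_ne_top ENNReal.ofReal_ne_top ?_) hSfin
      exact ENNReal.rpow_ne_top_of_nonneg (by positivity) (hDtop j)) h1
    rw [ENNReal.toReal_mul, ENNReal.toReal_mul, ENNReal.toReal_mul, ← ENNReal.toReal_rpow,
      ENNReal.toReal_ofReal (by positivity), ENNReal.toReal_ofReal hA0.le] at h2
    have h3 : μ (j + 1) = (volume {x | (j : ℝ) * τ + τ < φ x}).toReal := by
      simp only [hμ, Nat.cast_add, Nat.cast_one, add_mul, one_mul]; rfl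
    rw [h3, ← h3, ← hm, h3]
    exact h2
  -- Either the energy `d j` between two levels exceeds twice the average `K ^ n / N`, or passing
  -- to the next level halves the measure; both cases give the same bound.
  have hhalf : ∀ j, μ (j + 1) ≤ μ j * (2 : ℝ) ^ (-1 + N * d j / (2 * K ^ (n : ℝ))) := by
    intro j
    have hKn : 0 < K ^ (n : ℝ) := by positivity
    have hd0 : 0 ≤ d j := ENNReal.toReal_nonneg
    have hτr0 : 0 < τ ^ r := by positivity
    have hs := hstep j
    have hmono : μ (j + 1) ≤ μ j := by
      refine measureReal_mono (fun x hx => ?_) (hfin _ (by positivity))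
      have h2 : ((j + 1 : ℕ) : ℝ) * τ < φ x := hx
      push_cast at h2
      show (j : ℝ) * τ < φ x
      linarith
    by_cases hcase : d j ≤ 2 * K ^ (n : ℝ) / N
    · have h1 : A * d j ^ (1 / ((n : ℝ) - 1)) ≤ τ ^ r := by
        rw [hτr]; gcongr
      have h2 : τ ^ r * μ (j + 1) ≤ τ ^ r * (μ j - μ (j + 1)) :=
        hs.trans (mul_le_mul_of_nonneg_right h1 (by linarith))
      have h3 : μ (j + 1) ≤ μ j - μ (j + 1) := le_of_mul_le_mul_left h2 hτr0
      have h4 : (2 : ℝ) ^ (-1 : ℝ) ≤ (2 : ℝ) ^ (-1 + N * d j / (2 * K ^ (n : ℝ))) := by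
        apply Real.rpow_le_rpow_of_exponent_le (by norm_num)
        have : 0 ≤ N * d j / (2 * K ^ (n : ℝ)) := by positivity
        linarith
      rw [Real.rpow_neg_one] at h4
      nlinarith [hμ0 j]
    · push Not at hcase
      have h5 : 1 ≤ N * d j / (2 * K ^ (n : ℝ)) := by
        rw [one_le_div (by positivity)]
        rw [div_lt_iff₀ hN0] at hcase
        linarith
      have h4 : (1 : ℝ) ≤ (2 : ℝ) ^ (-1 + N * d j / (2 * K ^ (n : ℝ))) :=
        Real.one_le_rpow (by norm_num) (by linarith)
      nlinarith [hμ0 j]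
  have hind : ∀ k, μ k ≤ μ 0 *
      (2 : ℝ) ^ (-(k : ℝ) + N / (2 * K ^ (n : ℝ)) * ∑ j ∈ Finset.range k, d j) := by
    intro k
    induction k with
    | zero => simp
    | succ k ih =>
      refine (hhalf k).trans ((mul_le_mul_of_nonneg_right ih (by positivity)).trans ?_)
      rw [mul_assoc, ← Real.rpow_add (by norm_num)]
      apply le_of_eq
      congr 2
      rw [Finset.sum_range_succ]
      push_cast
      ring
  have hfinal := hind N
  have h0 : μ 0 = volume.real {x | 0 < φ x} := by simp [hμ]
  rw [h0] at hfinal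
  refine hfinal.trans ?_
  rw [mul_comm]
  gcongr
  · norm_num
  · have hKn : 0 < K ^ (n : ℝ) := by positivity
    have : N / (2 * K ^ (n : ℝ)) * ∑ j ∈ Finset.range N, d j ≤
        N / (2 * K ^ (n : ℝ)) * K ^ (n : ℝ) := by
      gcongr
      exact hdsum N
    have h6 : N / (2 * K ^ (n : ℝ)) * K ^ (n : ℝ) = N / 2 := by field_simp
    linarith

theorem rpow_le_mul_rpow_add_const {β r c α : ℝ} (hβ0 : 0 < β) (hβ : β < r) (hc : 0 ≤ c)
    (hα : 0 < α) : ∃ C : ℝ, ∀ s : ℝ, 0 ≤ s → c * s ^ β ≤ α * s ^ r + C := by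
  set s₀ : ℝ := (c / α) ^ (1 / (r - β)) with hs₀
  have hrβ : 0 < r - β := by linarith
  have hs₀0 : 0 ≤ s₀ := by positivity
  refine ⟨c * s₀ ^ β, fun s hs => ?_⟩
  rcases le_total s s₀ with h | h
  · have h1 : c * s ^ β ≤ c * s₀ ^ β := by gcongr
    have h2 : 0 ≤ α * s ^ r := by positivity
    linarith
  · have h1 : c / α ≤ s ^ (r - β) := by
      calc c / α = s₀ ^ (r - β) := by
            rw [hs₀, ← Real.rpow_mul (by positivity), one_div_mul_cancel hrβ.ne', Real.rpow_one]
        _ ≤ s ^ (r - β) := by gcongr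
    have h2 : s ^ r = s ^ (r - β) * s ^ β := by
      rw [← Real.rpow_add' hs (by linarith)]; congr 1; ring
    have h3 : 0 ≤ c * s₀ ^ β := by positivity
    have h4 : c ≤ α * s ^ (r - β) := by
      rw [div_le_iff₀ hα] at h1; linarith
    have h5 : 0 ≤ s ^ β := by positivity
    rw [h2]
    nlinarith [mul_le_mul_of_nonneg_right h4 h5]

/-- A subcritical Trudinger inequality for the positive part of a compactly supported function. -/
theorem exists_lintegral_exp_posPart_le {n : ℕ} (hn : 2 ≤ n) {Ω : Set (Eucl n)}
    (hΩ : Bornology.IsBounded Ω) {β c K : ℝ} (hβ0 : 0 < β) (hβ : β < (n : ℝ) / (n - 1))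
    (hc : 0 ≤ c) (hK : 0 < K) :
    ∃ C : ℝ, ∀ φ : Eucl n → ℝ, ContDiff ℝ 1 φ → HasCompactSupport φ → tsupport φ ⊆ Ω →
      ∫⁻ x, ‖fderiv ℝ φ x‖ₑ ^ (n : ℝ) ≤ ENNReal.ofReal (K ^ (n : ℝ)) →
      ∫⁻ x in Ω, ENNReal.ofReal (Real.exp (c * (max (φ x) 0) ^ β)) ≤ ENNReal.ofReal C := by
  obtain ⟨B, hB0, hB⟩ := exists_superlevel_decay n hn
  have hn2 : (2 : ℝ) ≤ n := by exact_mod_cast hn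
  have hn1 : (0 : ℝ) < n - 1 := by linarith
  have hn0 : (0 : ℝ) < n := by linarith
  set r : ℝ := (n : ℝ) / (n - 1) with hr
  have hr0 : 0 < r := by positivity
  -- Half of the rate `log 2 / 2` at which the measures of the super-level sets decay.
  set α : ℝ := Real.log 2 / 4 with hα
  have hα0 : 0 < α := by have := Real.log_pos one_lt_two; positivity
  obtain ⟨C', hC'⟩ := rpow_le_mul_rpow_add_const (c := c) (α := α / (B * K) ^ r) hβ0 hβ hc
    (by positivity)
  set V : ℝ := volume.real Ω with hV
  have hΩtop : volume Ω ≠ ⊤ := hΩ.measure_lt_top.ne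
  have hsum : Summable fun N : ℕ => Real.exp α * V * Real.exp (-α) ^ N :=
    (summable_geometric_of_lt_one (Real.exp_pos _).le
      (by rw [Real.exp_lt_one_iff]; linarith)).mul_left _
  set T : ℝ := ∑' N : ℕ, Real.exp α * V * Real.exp (-α) ^ N with hT
  refine ⟨Real.exp C' * (V + T), ?_⟩
  intro φ hφ hφc hφΩ hφK
  have hφm : Measurable φ := hφ.continuous.measurable
  set ψ : Eucl n → ℝ := fun x => (max (φ x) 0 / (B * K)) ^ r with hψ
  have hψm : Measurable ψ := ((hφm.max measurable_const).div_const _).pow_const _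
  have hψ0 : ∀ x, 0 ≤ ψ x := fun x => by positivity
  have hpt : ∀ x, Real.exp (c * (max (φ x) 0) ^ β) ≤ Real.exp C' * Real.exp (α * ψ x) := by
    intro x
    rw [← Real.exp_add, Real.exp_le_exp]
    refine (hC' _ (le_max_right _ _)).trans (le_of_eq ?_)
    rw [hψ]
    simp only
    rw [Real.div_rpow (le_max_right _ _) (by positivity)]
    ring
  have hlevel : ∀ N : ℕ, ∀ x, (N : ℝ) < ψ x →
      B * K * (N : ℝ) ^ (((n : ℝ) - 1) / n) < φ x := by
    intro N x hx
    have h1 : (N : ℝ) ^ (((n : ℝ) - 1) / n) < (ψ x) ^ (((n : ℝ) - 1) / n) := by gcongr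
    have h2 : (ψ x) ^ (((n : ℝ) - 1) / n) = max (φ x) 0 / (B * K) := by
      rw [hψ]
      simp only
      rw [← Real.rpow_mul (by positivity), hr]
      have : (n : ℝ) / (n - 1) * ((n - 1) / n) = 1 := by field_simp
      rw [this, Real.rpow_one]
    rw [h2, lt_div_iff₀ (by positivity)] at h1
    have h3 : 0 < max (φ x) 0 := lt_of_le_of_lt (by positivity) h1
    have h4 : max (φ x) 0 = φ x := by
      rcases le_total (φ x) 0 with h | h
      · rw [max_eq_right h] at h3; exact absurd h3 (lt_irrefl _)
      · exact max_eq_left h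
    rw [h4] at h1
    linarith
  set s : ℕ → Set (Eucl n) := fun N => {x | (N : ℝ) < ψ x} with hs
  have hsm : ∀ N, MeasurableSet (s N) := fun N => measurableSet_lt measurable_const hψm
  have hpos : {x | 0 < φ x} ⊆ Ω := by
    intro x hx
    apply hφΩ
    apply subset_tsupport
    have : 0 < φ x := hx
    simp only [Function.mem_support]
    linarith
  have hsμ : ∀ N, volume (s N) ≤ ENNReal.ofReal (Real.exp (-2 * α * N) * V) := by
    intro N
    have h0 : volume.real {x | 0 < φ x} ≤ V := measureReal_mono hpos hΩtop
    have h1 : volume.real {x | B * K * (N : ℝ) ^ (((n : ℝ) - 1) / n) < φ x} ≤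
        Real.exp (-2 * α * N) * V := by
      refine (hB φ hφ hφc K hK hφK N).trans ?_
      have : (2 : ℝ) ^ (-(N : ℝ) / 2) = Real.exp (-2 * α * N) := by
        rw [Real.rpow_def_of_pos (by norm_num), hα]; ring_nf
      rw [this]
      gcongr
    have hfin : volume {x | B * K * (N : ℝ) ^ (((n : ℝ) - 1) / n) < φ x} ≠ ⊤ := by
      refine ne_top_of_le_ne_top hΩtop (measure_mono fun x hx => hpos ?_)
      exact lt_of_le_of_lt (show (0 : ℝ) ≤ B * K * (N : ℝ) ^ (((n : ℝ) - 1) / n) by positivity) hx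
    refine (measure_mono (show s N ⊆ {x | B * K * (N : ℝ) ^ (((n : ℝ) - 1) / n) < φ x} from
      fun x hx => hlevel N x hx)).trans ?_
    rw [← ENNReal.ofReal_toReal hfin]
    exact ENNReal.ofReal_le_ofReal h1
  have hexp : ∀ x, ENNReal.ofReal (Real.exp (α * ψ x)) ≤
      1 + ∑' N : ℕ, (s N).indicator (fun _ => ENNReal.ofReal (Real.exp (α * (N + 1)))) x := by
    intro x
    rcases (hψ0 x).eq_or_lt with h | h
    · rw [← h]; simp
    · obtain ⟨N, hN⟩ : ∃ N : ℕ, ⌈ψ x⌉₊ = N + 1 :=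
        Nat.exists_eq_succ_of_ne_zero (Nat.ceil_pos.2 h).ne'
      have h1 : ψ x ≤ N + 1 := by
        have := Nat.le_ceil (ψ x); rw [hN] at this; exact_mod_cast this
      have h2 : x ∈ s N := by
        show (N : ℝ) < ψ x
        exact Nat.lt_ceil.1 (by omega)
      refine le_trans ?_ le_add_self
      refine le_trans ?_ (ENNReal.le_tsum N)
      rw [Set.indicator_of_mem h2]
      apply ENNReal.ofReal_le_ofReal
      rw [Real.exp_le_exp]
      gcongr
  calc ∫⁻ x in Ω, ENNReal.ofReal (Real.exp (c * (max (φ x) 0) ^ β))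
      ≤ ∫⁻ x in Ω, ENNReal.ofReal (Real.exp C') * (1 + ∑' N : ℕ, (s N).indicator
          (fun _ => ENNReal.ofReal (Real.exp (α * (N + 1)))) x) := by
        refine lintegral_mono fun x => ?_
        refine (ENNReal.ofReal_le_ofReal (hpt x)).trans ?_
        rw [ENNReal.ofReal_mul (Real.exp_pos _).le]
        gcongr
        exact hexp x
    _ = ENNReal.ofReal (Real.exp C') * (volume Ω + ∑' N : ℕ,
          ENNReal.ofReal (Real.exp (α * (N + 1))) * volume.restrict Ω (s N)) := by
        rw [lintegral_const_mul' _ _ ENNReal.ofReal_ne_top, lintegral_add_left measurable_const,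
          lintegral_tsum fun N => (measurable_const.indicator (hsm N)).aemeasurable]
        simp only [lintegral_indicator_const (hsm _)]
        simp
    _ ≤ ENNReal.ofReal (Real.exp C') * (ENNReal.ofReal V + ∑' N : ℕ,
          ENNReal.ofReal (Real.exp α * V * Real.exp (-α) ^ N)) := by
        gcongr with N
        · rw [hV, ofReal_measureReal hΩtop]
        · refine (mul_le_mul_right ((Measure.restrict_apply_le _ _).trans (hsμ N)) _).trans ?_
          rw [← ENNReal.ofReal_mul (Real.exp_pos _).le]
          apply ENNReal.ofReal_le_ofReal
          rw [← mul_assoc, ← Real.exp_add, mul_right_comm (Real.exp α),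
            ← Real.exp_nat_mul, ← Real.exp_add]
          apply le_of_eq
          congr 2
          ring
    _ = ENNReal.ofReal (Real.exp C' * (V + T)) := by
        have hV0 : 0 ≤ V := measureReal_nonneg
        have hterm : ∀ N : ℕ, 0 ≤ Real.exp α * V * Real.exp (-α) ^ N := fun N => by positivity
        rw [← ENNReal.ofReal_tsum_of_nonneg hterm hsum, ← ENNReal.ofReal_add hV0
          (tsum_nonneg hterm), ← ENNReal.ofReal_mul (Real.exp_pos _).le]

/-- A subcritical **Trudinger inequality**: `exp (c |φ| ^ β)` is integrable, uniformly for
`‖∇φ‖_n ≤ K`, for every `β < n / (n - 1)`. -/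
theorem exists_lintegral_exp_le {n : ℕ} (hn : 2 ≤ n) {Ω : Set (Eucl n)}
    (hΩ : Bornology.IsBounded Ω) {β : ℝ} (hβ0 : 0 < β) (hβ : β < (n : ℝ) / (n - 1)) {c K : ℝ}
    (hc : 0 ≤ c) (hK : 0 < K) :
    ∃ C : ℝ, ∀ φ : Eucl n → ℝ, ContDiff ℝ 1 φ → HasCompactSupport φ → tsupport φ ⊆ Ω →
      ∫⁻ x, ‖fderiv ℝ φ x‖ₑ ^ (n : ℝ) ≤ ENNReal.ofReal (K ^ (n : ℝ)) →
      ∫⁻ x in Ω, ENNReal.ofReal (Real.exp (c * |φ x| ^ β)) ≤ ENNReal.ofReal C := by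
  obtain ⟨C, hC⟩ := exists_lintegral_exp_posPart_le hn hΩ hβ0 hβ hc hK
  refine ⟨max C 0 + max C 0, fun φ hφ hφc hφΩ hφK => ?_⟩
  have h1 := hC φ hφ hφc hφΩ hφK
  have h2 := hC (-φ) hφ.neg hφc.neg (by rwa [tsupport_neg]) (by simpa [fderiv_neg] using hφK)
  rw [ENNReal.ofReal_add (le_max_right _ _) (le_max_right _ _)]
  have hm : Measurable fun x => ENNReal.ofReal (Real.exp (c * (max (φ x) 0) ^ β)) := by
    have : Measurable φ := hφ.continuous.measurable
    fun_prop
  calc _ ≤ ∫⁻ x in Ω, (ENNReal.ofReal (Real.exp (c * (max (φ x) 0) ^ β)) +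
        ENNReal.ofReal (Real.exp (c * (max ((-φ) x) 0) ^ β))) := by
        refine lintegral_mono fun x => ?_
        rcases le_total 0 (φ x) with h | h
        · refine le_trans (le_of_eq ?_) le_self_add
          rw [max_eq_left h, abs_of_nonneg h]
        · refine le_trans (le_of_eq ?_) le_add_self
          rw [Pi.neg_apply, max_eq_left (by linarith), abs_of_nonpos h]
    _ ≤ _ := by
        rw [lintegral_add_left hm]
        gcongr
        · exact h1.trans (ENNReal.ofReal_le_ofReal (le_max_left _ _))
        · exact h2.trans (ENNReal.ofReal_le_ofReal (le_max_left _ _))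

/-! ### The space `W₀^{1,n}(Ω)` -/

/-- The functions of class `C_c^∞(Ω)`. -/
structure IsTest {n : ℕ} (Ω : Set (Eucl n)) (φ : Eucl n → ℝ) : Prop where
  contDiff : ContDiff ℝ ∞ φ
  hasCompactSupport : HasCompactSupport φ
  tsupport_subset : tsupport φ ⊆ Ω

theorem norm_gradient {n : ℕ} (φ : Eucl n → ℝ) (x : Eucl n) :
    ‖gradient φ x‖ = ‖fderiv ℝ φ x‖ := by
  simp [gradient]

theorem gradient_add' {n : ℕ} {φ ψ : Eucl n → ℝ} {x : Eucl n} (hφ : DifferentiableAt ℝ φ x)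
    (hψ : DifferentiableAt ℝ ψ x) :
    gradient (φ + ψ) x = gradient φ x + gradient ψ x := by
  simp [gradient, fderiv_add hφ hψ]

theorem gradient_smul' {n : ℕ} {φ : Eucl n → ℝ} {x : Eucl n} (c : ℝ)
    (hφ : DifferentiableAt ℝ φ x) : gradient (c • φ) x = c • gradient φ x := by
  simp [gradient, fderiv_const_smul hφ c]

namespace IsTest

variable {n : ℕ} {Ω : Set (Eucl n)} {φ ψ : Eucl n → ℝ}

theorem differentiable (hφ : IsTest Ω φ) : Differentiable ℝ φ :=
  hφ.contDiff.differentiable (by simp)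

theorem contDiff_one (hφ : IsTest Ω φ) : ContDiff ℝ 1 φ := hφ.contDiff.of_le (by simp)

theorem add (hφ : IsTest Ω φ) (hψ : IsTest Ω ψ) : IsTest Ω (φ + ψ) :=
  ⟨hφ.contDiff.add hψ.contDiff, hφ.hasCompactSupport.add hψ.hasCompactSupport,
    (tsupport_add _ _).trans (Set.union_subset hφ.tsupport_subset hψ.tsupport_subset)⟩

theorem smul (c : ℝ) (hφ : IsTest Ω φ) : IsTest Ω (c • φ) :=
  ⟨hφ.contDiff.const_smul c, hφ.hasCompactSupport.smul_left (f := fun _ => c),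
    (tsupport_smul_subset_right (fun _ => c) φ).trans hφ.tsupport_subset⟩

theorem continuous_gradient (hφ : IsTest Ω φ) : Continuous (gradient φ) :=
  (LinearIsometryEquiv.continuous _).comp (hφ.contDiff_one.continuous_fderiv one_ne_zero)

theorem hasCompactSupport_gradient (hφ : IsTest Ω φ) : HasCompactSupport (gradient φ) := by
  refine (hφ.hasCompactSupport.fderiv ℝ).mono fun x hx => ?_
  simp only [Function.mem_support, ne_eq] at hx ⊢
  intro h
  exact hx (by simp [gradient, h])

theorem memLp (hφ : IsTest Ω φ) (p : ℝ≥0∞) : MemLp φ p (volume.restrict Ω) :=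
  (hφ.contDiff.continuous.memLp_of_hasCompactSupport hφ.hasCompactSupport).restrict Ω

theorem memLp_gradient (hφ : IsTest Ω φ) (p : ℝ≥0∞) :
    MemLp (gradient φ) p (volume.restrict Ω) :=
  (hφ.continuous_gradient.memLp_of_hasCompactSupport hφ.hasCompactSupport_gradient).restrict Ω

end IsTest

theorem mem_testPairs_of_mem_span {n : ℕ} {Ω : Set (Eucl n)}
    {w : Lp ℝ (n : ℝ≥0∞) (volume.restrict Ω) × Lp (Eucl n) (n : ℝ≥0∞) (volume.restrict Ω)}
    (hw : w ∈ Submodule.span ℝ (testPairs Ω)) : w ∈ testPairs Ω := by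
  induction hw using Submodule.span_induction with
  | mem x h => exact h
  | zero =>
    refine ⟨0, contDiff_const, HasCompactSupport.zero, by simp [tsupport], Lp.coeFn_zero _ _ _, ?_⟩
    refine (Lp.coeFn_zero _ _ _).trans (Filter.Eventually.of_forall fun x => ?_)
    simp [gradient]
  | add x y _ _ hx hy =>
    obtain ⟨φ, h1, h2, h3, h4, h5⟩ := hx
    obtain ⟨ψ, k1, k2, k3, k4, k5⟩ := hy
    have hφ : IsTest Ω φ := ⟨h1, h2, h3⟩
    have hψ : IsTest Ω ψ := ⟨k1, k2, k3⟩
    have hs := hφ.add hψ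
    refine ⟨φ + ψ, hs.1, hs.2, hs.3, (Lp.coeFn_add _ _).trans (h4.add k4),
      (Lp.coeFn_add _ _).trans ?_⟩
    filter_upwards [h5, k5] with z hz1 hz2
    rw [gradient_add' (hφ.differentiable z) (hψ.differentiable z), Pi.add_apply, hz1, hz2]
  | smul c x _ hx =>
    obtain ⟨φ, h1, h2, h3, h4, h5⟩ := hx
    have hφ : IsTest Ω φ := ⟨h1, h2, h3⟩
    have hs := hφ.smul c
    refine ⟨c • φ, hs.1, hs.2, hs.3, (Lp.coeFn_smul _ _).trans (h4.const_smul c),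
      (Lp.coeFn_smul _ _).trans ?_⟩
    filter_upwards [h5] with z hz1
    rw [gradient_smul' c (hφ.differentiable z), Pi.smul_apply, hz1]

section Space

variable {n : ℕ} [hn : Fact (2 ≤ n)] {Ω : Set (Eucl n)}

theorem dim_cast_ne_zero : (n : ℝ≥0∞) ≠ 0 := by
  have := hn.out
  simp only [ne_eq, Nat.cast_eq_zero]
  omega

/-- The element of `W₀^{1,n}(Ω)` given by a test function. -/
noncomputable def ofTest {φ : Eucl n → ℝ} (hφ : IsTest Ω φ) : W0 Ω :=
  ⟨((hφ.memLp n).toLp φ, (hφ.memLp_gradient n).toLp (gradient φ)),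
    Submodule.le_topologicalClosure _ <| Submodule.subset_span
      ⟨φ, hφ.contDiff, hφ.hasCompactSupport, hφ.tsupport_subset,
        MemLp.coeFn_toLp (hφ.memLp n), MemLp.coeFn_toLp (hφ.memLp_gradient n)⟩⟩

theorem fn_ofTest {φ : Eucl n → ℝ} (hφ : IsTest Ω φ) :
    fn (ofTest hφ) =ᵐ[volume.restrict Ω] φ := MemLp.coeFn_toLp (hφ.memLp n)

/-- Test functions are dense in `W₀^{1,n}(Ω)`. -/
theorem exists_test_near (u : W0 Ω) {ε : ℝ} (hε : 0 < ε) :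
    ∃ (φ : Eucl n → ℝ) (hφ : IsTest Ω φ), ‖u.1.1 - (ofTest hφ).1.1‖ < ε ∧
      gradNorm (u - ofTest hφ) < ε := by
  have hu : (u : Lp ℝ (n : ℝ≥0∞) (volume.restrict Ω) ×
    Lp (Eucl n) (n : ℝ≥0∞) (volume.restrict Ω)) ∈ closure
      (Submodule.span ℝ (testPairs Ω) : Set _) := u.2
  obtain ⟨w, hw, hwu⟩ := Metric.mem_closure_iff.1 hu ε hε
  obtain ⟨φ, h1, h2, h3, h4, h5⟩ := mem_testPairs_of_mem_span hw
  have hφ : IsTest Ω φ := ⟨h1, h2, h3⟩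
  have e1 : (ofTest hφ).1.1 = w.1 :=
    Lp.ext ((MemLp.coeFn_toLp (hφ.memLp n)).trans h4.symm)
  have e2 : (ofTest hφ).1.2 = w.2 :=
    Lp.ext ((MemLp.coeFn_toLp (hφ.memLp_gradient n)).trans h5.symm)
  rw [Prod.dist_eq, max_lt_iff] at hwu
  refine ⟨φ, hφ, ?_, ?_⟩
  · rw [e1, ← dist_eq_norm]; exact hwu.1
  · show ‖u.1.2 - (ofTest hφ).1.2‖ < ε
    rw [e2, ← dist_eq_norm]; exact hwu.2

theorem gradNorm_nonneg (u : W0 Ω) : 0 ≤ gradNorm u := norm_nonneg _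

theorem gradNorm_smul (t : ℝ) (u : W0 Ω) : gradNorm (t • u) = |t| * gradNorm u := by
  simp [gradNorm, norm_smul]

theorem gradNorm_zero : gradNorm (0 : W0 Ω) = 0 := by simp [gradNorm]

theorem abs_gradNorm_sub_le (u v : W0 Ω) : |gradNorm u - gradNorm v| ≤ gradNorm (u - v) :=
  abs_norm_sub_norm_le u.1.2 v.1.2

theorem fn_smul (t : ℝ) (u : W0 Ω) :
    fn (t • u) =ᵐ[volume.restrict Ω] fun x => t * fn u x :=
  Lp.coeFn_smul t u.1.1

theorem fn_aestronglyMeasurable (u : W0 Ω) : AEStronglyMeasurable (fn u) (volume.restrict Ω) :=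
  Lp.aestronglyMeasurable _

theorem enorm_rpow_eq_lintegral {E : Type*} [NormedAddCommGroup E] {α : Type*}
    [MeasurableSpace α] {μ : Measure α} (f : Lp E (n : ℝ≥0∞) μ) :
    ‖f‖ₑ ^ (n : ℝ) = ∫⁻ x, ‖f x‖ₑ ^ (n : ℝ) ∂μ := by
  have h0 : (n : NNReal) ≠ 0 := by
    have := hn.out
    simp only [ne_eq, Nat.cast_eq_zero]
    omega
  have := eLpNorm_nnreal_pow_eq_lintegral (μ := μ) (f := f) h0
  simp only [NNReal.coe_natCast, ENNReal.coe_natCast] at this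
  rw [Lp.enorm_def]
  exact this

/-- The gradient of a test function vanishes outside `Ω`, so that its energy over the whole space
is controlled by the norm in `W₀^{1,n}(Ω)`. -/
theorem lintegral_fderiv_le {φ : Eucl n → ℝ} (hφ : IsTest Ω φ) {K : ℝ}
    (hK : gradNorm (ofTest hφ) ≤ K) :
    ∫⁻ x, ‖fderiv ℝ φ x‖ₑ ^ (n : ℝ) ≤ ENNReal.ofReal (K ^ (n : ℝ)) := by
  have hn0 : (0 : ℝ) < n := by
    have := hn.out
    positivity
  have h1 : ∫⁻ x, ‖fderiv ℝ φ x‖ₑ ^ (n : ℝ) = ∫⁻ x in Ω, ‖fderiv ℝ φ x‖ₑ ^ (n : ℝ) := by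
    refine (setLIntegral_eq_of_support_subset ?_).symm
    intro x hx
    apply hφ.tsupport_subset
    apply tsupport_fderiv_subset ℝ
    apply subset_tsupport
    rw [Function.mem_support] at hx ⊢
    intro h
    apply hx
    rw [h]
    exact (congrArg (· ^ (n : ℝ)) (enorm_zero (E := Eucl n →L[ℝ] ℝ))).trans
      (ENNReal.zero_rpow_of_pos hn0)
  have h2 := enorm_rpow_eq_lintegral (ofTest hφ).1.2
  have h3 : ∫⁻ x in Ω, ‖(ofTest hφ).1.2 x‖ₑ ^ (n : ℝ) =
      ∫⁻ x in Ω, ‖fderiv ℝ φ x‖ₑ ^ (n : ℝ) := by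
    refine lintegral_congr_ae ?_
    have : (ofTest hφ).1.2 =ᵐ[volume.restrict Ω] gradient φ :=
      MemLp.coeFn_toLp (hφ.memLp_gradient n)
    filter_upwards [this] with x hx
    rw [hx, ← ofReal_norm, norm_gradient, ofReal_norm]
  rw [h1, ← h3, ← h2, ← ofReal_norm, ENNReal.ofReal_rpow_of_nonneg (norm_nonneg _) hn0.le]
  apply ENNReal.ofReal_le_ofReal
  have : ‖(ofTest hφ).1.2‖ ≤ K := hK
  gcongr

theorem exists_subseq_tendsto_ae {α : Type*} [MeasurableSpace α] {μ : Measure α} {E : Type*}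
    [NormedAddCommGroup E] {p : ℝ≥0∞} [Fact (1 ≤ p)] {f : ℕ → Lp E p μ} {g : Lp E p μ}
    (h : Filter.Tendsto f Filter.atTop (nhds g)) :
    ∃ ns : ℕ → ℕ, StrictMono ns ∧
      ∀ᵐ x ∂μ, Filter.Tendsto (fun k => f (ns k) x) Filter.atTop (nhds (g x)) :=
  (tendstoInMeasure_of_tendsto_Lp h).exists_seq_tendsto_ae

/-- Fatou's lemma in the form of the stability of exponential bounds under limits almost
everywhere. -/
theorem lintegral_exp_le_of_tendsto_ae {α : Type*} [MeasurableSpace α] {μ : Measure α}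
    {f : ℕ → α → ℝ} {g : α → ℝ} {c β C : ℝ} (hβ : 0 ≤ β)
    (hf : ∀ k, AEStronglyMeasurable (f k) μ)
    (hfg : ∀ᵐ x ∂μ, Filter.Tendsto (fun k => f k x) Filter.atTop (nhds (g x)))
    (hC : ∀ᶠ k in Filter.atTop,
      ∫⁻ x, ENNReal.ofReal (Real.exp (c * |f k x| ^ β)) ∂μ ≤ ENNReal.ofReal C) :
    ∫⁻ x, ENNReal.ofReal (Real.exp (c * |g x| ^ β)) ∂μ ≤ ENNReal.ofReal C := by
  have hcont : Continuous fun s : ℝ => ENNReal.ofReal (Real.exp (c * |s| ^ β)) := by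
    have : Continuous fun s : ℝ => |s| ^ β := continuous_abs.rpow_const fun _ => Or.inr hβ
    exact ENNReal.continuous_ofReal.comp (by fun_prop)
  calc _ = ∫⁻ x, Filter.liminf (fun k => ENNReal.ofReal (Real.exp (c * |f k x| ^ β)))
        Filter.atTop ∂μ := by
        refine lintegral_congr_ae ?_
        filter_upwards [hfg] with x hx
        exact (((hcont.tendsto _).comp hx).liminf_eq).symm
    _ ≤ Filter.liminf (fun k => ∫⁻ x, ENNReal.ofReal (Real.exp (c * |f k x| ^ β)) ∂μ)
        Filter.atTop := by
        refine lintegral_liminf_le' fun k => ?_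
        exact (hcont.comp_aestronglyMeasurable (hf k)).aemeasurable
    _ ≤ ENNReal.ofReal C := Filter.liminf_le_of_frequently_le' hC.frequently

/-- The subcritical Trudinger inequality in `W₀^{1,n}(Ω)`. -/
theorem exists_lintegral_exp_fn_le (hΩ : Bornology.IsBounded Ω) {β : ℝ} (hβ0 : 0 < β)
    (hβ : β < (n : ℝ) / (n - 1)) {c : ℝ} (hc : 0 ≤ c) (K : ℝ) :
    ∃ C : ℝ, ∀ u : W0 Ω, gradNorm u ≤ K →
      ∫⁻ x in Ω, ENNReal.ofReal (Real.exp (c * |fn u x| ^ β)) ≤ ENNReal.ofReal C := by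
  obtain ⟨C, hC⟩ := exists_lintegral_exp_le hn.out hΩ hβ0 hβ hc
    (K := |K| + 1) (by positivity)
  refine ⟨C, fun u hu => ?_⟩
  choose φ hφ h1 h2 using fun k : ℕ => exists_test_near u (ε := 1 / ((k : ℝ) + 1)) (by positivity)
  have hlim : Filter.Tendsto (fun k => (ofTest (hφ k)).1.1) Filter.atTop (nhds u.1.1) := by
    rw [tendsto_iff_norm_sub_tendsto_zero]
    refine squeeze_zero (fun _ => norm_nonneg _) (fun k => ?_)
      tendsto_one_div_add_atTop_nhds_zero_nat
    rw [norm_sub_rev]; exact (h1 k).le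
  obtain ⟨ns, -, hns⟩ := exists_subseq_tendsto_ae hlim
  refine lintegral_exp_le_of_tendsto_ae hβ0.le
    (fun k => fn_aestronglyMeasurable (ofTest (hφ (ns k))))
    hns (Filter.Eventually.of_forall fun k => ?_)
  have hK : gradNorm (ofTest (hφ (ns k))) ≤ |K| + 1 := by
    have h3 := abs_le.1 (abs_gradNorm_sub_le u (ofTest (hφ (ns k))))
    have h4 := h2 (ns k)
    have h5 : 1 / (((ns k : ℕ) : ℝ) + 1) ≤ 1 := by
      rw [div_le_one (by positivity)]
      have : (0 : ℝ) ≤ (ns k : ℕ) := Nat.cast_nonneg _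
      linarith
    have h6 := le_abs_self K
    linarith
  refine le_trans (le_of_eq ?_) (hC (φ (ns k)) (hφ _).contDiff_one (hφ _).hasCompactSupport
    (hφ _).tsupport_subset (lintegral_fderiv_le (hφ _) hK))
  refine lintegral_congr_ae ?_
  filter_upwards [fn_ofTest (hφ (ns k))] with x hx
  rw [hx]

/-- The Poincaré inequality. -/
theorem exists_norm_le_gradNorm (hΩ : Bornology.IsBounded Ω) :
    ∃ C : ℝ, 0 ≤ C ∧ ∀ u : W0 Ω, ‖u.1.1‖ ≤ C * gradNorm u := by
  have hn0 : (0 : ℝ) < n := by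
    have := hn.out
    positivity
  have hn2 : (2 : ℝ) ≤ n := by exact_mod_cast hn.out
  obtain ⟨C, hC⟩ := exists_lintegral_exp_fn_le hΩ one_pos
    (by rw [lt_div_iff₀ (by linarith)]; linarith) zero_le_one 1
  set D : ℝ := (n.factorial * max C 0) ^ (1 / (n : ℝ)) with hD
  have hunit : ∀ u : W0 Ω, gradNorm u ≤ 1 → ‖u.1.1‖ ≤ D := by
    intro u hu
    have h1 := hC u hu
    have h2 : ‖u.1.1‖ₑ ^ (n : ℝ) ≤ ENNReal.ofReal (n.factorial * max C 0) := by
      rw [enorm_rpow_eq_lintegral]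
      calc _ ≤ ∫⁻ x in Ω, ENNReal.ofReal n.factorial *
            ENNReal.ofReal (Real.exp (1 * |fn u x| ^ (1 : ℝ))) := by
            refine lintegral_mono fun x => ?_
            rw [← ofReal_norm, ENNReal.ofReal_rpow_of_nonneg (norm_nonneg _) hn0.le,
              ← ENNReal.ofReal_mul (by positivity)]
            apply ENNReal.ofReal_le_ofReal
            have := Real.pow_div_factorial_le_exp _ (abs_nonneg (fn u x)) n
            rw [div_le_iff₀ (by positivity)] at this
            rw [Real.rpow_natCast, one_mul, Real.rpow_one, mul_comm]
            exact this
        _ = ENNReal.ofReal n.factorial *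
            ∫⁻ x in Ω, ENNReal.ofReal (Real.exp (1 * |fn u x| ^ (1 : ℝ))) :=
            lintegral_const_mul' _ _ ENNReal.ofReal_ne_top
        _ ≤ _ := by
            rw [ENNReal.ofReal_mul (by positivity)]
            gcongr
            exact h1.trans (ENNReal.ofReal_le_ofReal (le_max_left _ _))
    rw [← ofReal_norm, ENNReal.ofReal_rpow_of_nonneg (norm_nonneg _) hn0.le,
      ENNReal.ofReal_le_ofReal_iff (by positivity)] at h2
    rw [hD, ← Real.rpow_le_rpow_iff (norm_nonneg _) (by positivity) hn0, ← Real.rpow_mul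
      (by positivity), one_div_mul_cancel hn0.ne', Real.rpow_one]
    exact h2
  have hD0 : 0 ≤ D := by positivity
  refine ⟨D, hD0, fun u => ?_⟩
  refine le_of_forall_pos_le_add fun ε hε => ?_
  set s : ℝ := gradNorm u + ε / (D + 1) with hs
  have hs0 : 0 < s := by
    have := gradNorm_nonneg u
    positivity
  have h1 : gradNorm (s⁻¹ • u) ≤ 1 := by
    rw [gradNorm_smul, abs_of_pos (by positivity), inv_mul_le_one₀ hs0, hs]
    have : 0 < ε / (D + 1) := by positivity
    linarith
  have h2 := hunit _ h1
  have h3 : ‖(s⁻¹ • u).1.1‖ = s⁻¹ * ‖u.1.1‖ := by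
    show ‖s⁻¹ • u.1.1‖ = _
    rw [norm_smul, Real.norm_of_nonneg (by positivity)]
  rw [h3, inv_mul_le_iff₀ hs0] at h2
  have h4 : D * (ε / (D + 1)) ≤ ε := by
    rw [mul_div_assoc', div_le_iff₀ (by positivity)]
    nlinarith
  calc ‖u.1.1‖ ≤ s * D := h2
    _ = D * gradNorm u + D * (ε / (D + 1)) := by rw [hs]; ring
    _ ≤ _ := by linarith

theorem eq_zero_of_gradNorm_eq_zero (hΩ : Bornology.IsBounded Ω) {u : W0 Ω}
    (hu : gradNorm u = 0) : u = 0 := by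
  obtain ⟨C, -, hC⟩ := exists_norm_le_gradNorm hΩ
  have h1 : u.1.1 = 0 := by
    have := hC u
    rw [hu, mul_zero] at this
    exact norm_le_zero_iff.1 this
  have h2 : u.1.2 = 0 := norm_eq_zero.1 hu
  exact Subtype.ext (Prod.ext h1 h2)

end Space

/-! ### Uniform convexity and weak limits -/

theorem rpow_norm_add_add_rpow_norm_sub_le {E : Type*} [NormedAddCommGroup E]
    [InnerProductSpace ℝ E] {p : ℝ} (hp : 2 ≤ p) (x y : E) :
    ‖x + y‖ₑ ^ p + ‖x - y‖ₑ ^ p ≤ 2 ^ (p - 1) * (‖x‖ₑ ^ p + ‖y‖ₑ ^ p) := by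
  have hp2 : 1 ≤ p / 2 := by linarith
  have hsq : ∀ z : E, ‖z‖ₑ ^ p = (‖z‖ₑ ^ (2 : ℝ)) ^ (p / 2) := fun z => by
    rw [← ENNReal.rpow_mul]; congr 1; ring
  have hpar : ‖x + y‖ₑ ^ (2 : ℝ) + ‖x - y‖ₑ ^ (2 : ℝ) =
      2 * (‖x‖ₑ ^ (2 : ℝ) + ‖y‖ₑ ^ (2 : ℝ)) := by
    have h := parallelogram_law_with_norm ℝ x y
    have h2 : ∀ z : E, ‖z‖ₑ ^ (2 : ℝ) = ENNReal.ofReal (‖z‖ ^ 2) := fun z => by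
      rw [← ofReal_norm, ENNReal.ofReal_pow (norm_nonneg _), ENNReal.rpow_ofNat]
    have h3 : (2 : ℝ≥0∞) = ENNReal.ofReal 2 := by simp
    rw [h2, h2, h2, h2, h3, ← ENNReal.ofReal_add (by positivity) (by positivity),
      ← ENNReal.ofReal_add (by positivity) (by positivity), ← ENNReal.ofReal_mul (by norm_num), h]
  calc ‖x + y‖ₑ ^ p + ‖x - y‖ₑ ^ p
      ≤ (‖x + y‖ₑ ^ (2 : ℝ) + ‖x - y‖ₑ ^ (2 : ℝ)) ^ (p / 2) := by
        rw [hsq, hsq (x - y)]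
        exact ENNReal.add_rpow_le_rpow_add _ _ hp2
    _ = 2 ^ (p / 2) * (‖x‖ₑ ^ (2 : ℝ) + ‖y‖ₑ ^ (2 : ℝ)) ^ (p / 2) := by
        rw [hpar, ENNReal.mul_rpow_of_nonneg _ _ (by linarith)]
    _ ≤ 2 ^ (p / 2) * (2 ^ (p / 2 - 1) * (‖x‖ₑ ^ p + ‖y‖ₑ ^ p)) := by
        rw [hsq x, hsq y]
        gcongr
        exact ENNReal.rpow_add_le_mul_rpow_add_rpow _ _ hp2
    _ = 2 ^ (p - 1) * (‖x‖ₑ ^ p + ‖y‖ₑ ^ p) := by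
        rw [← mul_assoc, ← ENNReal.rpow_add _ _ (by norm_num) (by norm_num)]
        congr 2
        ring

/-- The regularization `√(φ² + δ²) - δ` of `|φ|`. -/
theorem IsTest.sqrt_add_sub {n : ℕ} {Ω : Set (Eucl n)} {φ : Eucl n → ℝ} (hφ : IsTest Ω φ)
    {δ : ℝ} (hδ : 0 < δ) :
    IsTest Ω (fun x => Real.sqrt (φ x ^ 2 + δ ^ 2) - δ) ∧
      ∀ x, ‖gradient (fun x => Real.sqrt (φ x ^ 2 + δ ^ 2) - δ) x‖ ≤ ‖gradient φ x‖ := by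
  have hsupp : Function.support (fun x => Real.sqrt (φ x ^ 2 + δ ^ 2) - δ) ⊆
      Function.support φ := by
    intro x hx
    simp only [Function.mem_support, ne_eq] at hx ⊢
    intro h
    apply hx
    rw [h]
    simp [Real.sqrt_sq hδ.le]
  refine ⟨⟨?_, hφ.hasCompactSupport.mono hsupp,
    (closure_mono hsupp).trans hφ.tsupport_subset⟩, fun x => ?_⟩
  · exact (((hφ.contDiff.pow 2).add contDiff_const).sqrt fun x => by positivity).sub contDiff_const
  · have hd : HasFDerivAt φ (fderiv ℝ φ x) x := (hφ.differentiable x).hasFDerivAt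
    have h1 : HasFDerivAt (fun x => Real.sqrt (φ x ^ 2 + δ ^ 2) - δ)
        ((1 / (2 * Real.sqrt (φ x ^ 2 + δ ^ 2))) • ((2 * φ x) • fderiv ℝ φ x)) x := by
      have h2 := ((hd.pow 2).add_const (δ ^ 2)).sqrt (by positivity)
      simpa using h2.sub_const δ
    rw [norm_gradient, norm_gradient, h1.fderiv, smul_smul, norm_smul]
    have h3 : 0 < Real.sqrt (φ x ^ 2 + δ ^ 2) := Real.sqrt_pos.2 (by positivity)
    have h4 : ‖1 / (2 * Real.sqrt (φ x ^ 2 + δ ^ 2)) * (2 * φ x)‖ ≤ 1 := by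
      rw [Real.norm_eq_abs, show 1 / (2 * Real.sqrt (φ x ^ 2 + δ ^ 2)) * (2 * φ x) =
        φ x / Real.sqrt (φ x ^ 2 + δ ^ 2) by field_simp, abs_div, abs_of_pos h3, div_le_one h3]
      apply Real.le_sqrt_of_sq_le
      rw [sq_abs]
      nlinarith
    exact mul_le_of_le_one_left (norm_nonneg _) h4

section Space

variable {n : ℕ} [hn : Fact (2 ≤ n)] {Ω : Set (Eucl n)}

/-- **Clarkson's inequality** in `Lⁿ`, `n ≥ 2`, for functions with values in a Hilbert space. -/
theorem norm_add_pow_add_norm_sub_pow_le {E : Type*} [NormedAddCommGroup E]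
    [InnerProductSpace ℝ E] {α : Type*} [MeasurableSpace α] {μ : Measure α}
    (f g : Lp E (n : ℝ≥0∞) μ) :
    ‖f + g‖ ^ n + ‖f - g‖ ^ n ≤ 2 ^ ((n : ℝ) - 1) * (‖f‖ ^ n + ‖g‖ ^ n) := by
  have hn2 : (2 : ℝ) ≤ n := by exact_mod_cast hn.out
  have key : ‖f + g‖ₑ ^ (n : ℝ) + ‖f - g‖ₑ ^ (n : ℝ) ≤
      2 ^ ((n : ℝ) - 1) * (‖f‖ₑ ^ (n : ℝ) + ‖g‖ₑ ^ (n : ℝ)) := by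
    have hm : ∀ w : Lp E (n : ℝ≥0∞) μ, AEMeasurable (fun x => ‖w x‖ₑ ^ (n : ℝ)) μ := fun w =>
      (Lp.aestronglyMeasurable w).enorm.pow_const _
    simp only [enorm_rpow_eq_lintegral]
    rw [← lintegral_add_left' (hm _), ← lintegral_add_left' (hm _),
      ← lintegral_const_mul' _ _ (by finiteness)]
    refine lintegral_mono_ae ?_
    filter_upwards [Lp.coeFn_add f g, Lp.coeFn_sub f g] with x h1 h2
    rw [h1, h2]
    exact rpow_norm_add_add_rpow_norm_sub_le hn2 _ _
  have h3 : (2 : ℝ≥0∞) = ENNReal.ofReal 2 := by simp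
  have hr : ∀ w : Lp E (n : ℝ≥0∞) μ, ‖w‖ₑ ^ (n : ℝ) = ENNReal.ofReal (‖w‖ ^ n) := fun w => by
    rw [← ofReal_norm, ENNReal.rpow_natCast, ENNReal.ofReal_pow (norm_nonneg _)]
  rw [hr, hr, hr, hr, h3, ENNReal.ofReal_rpow_of_pos (by norm_num),
    ← ENNReal.ofReal_add (by positivity) (by positivity),
    ← ENNReal.ofReal_add (by positivity) (by positivity), ← ENNReal.ofReal_mul (by positivity),
    ENNReal.ofReal_le_ofReal_iff (by positivity)] at key
  exact key

/-- Uniform convexity: if the norms of the terms of a sequence are asymptotically at most `D` and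
those of the midpoints at least `D`, then the sequence is a Cauchy sequence. -/
theorem cauchySeq_of_norm_midpoint {E : Type*} [NormedAddCommGroup E]
    [InnerProductSpace ℝ E] {α : Type*} [MeasurableSpace α] {μ : Measure α}
    {x : ℕ → Lp E (n : ℝ≥0∞) μ} {D : ℝ} (hD : 0 ≤ D)
    (hx : ∀ δ > 0, ∃ N : ℕ, ∀ k ≥ N, ∀ l ≥ N,
      ‖x k‖ ≤ D + δ ∧ 2 * max (D - δ) 0 ≤ ‖x k + x l‖) : CauchySeq x := by
  rw [Metric.cauchySeq_iff]
  intro η hη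
  set F : ℝ → ℝ := fun δ => 2 ^ n * ((D + δ) ^ n - (max (D - δ) 0) ^ n) with hF
  have hFc : Continuous F := by fun_prop
  have hF0 : F 0 = 0 := by simp [hF, max_eq_left hD]
  have hFη : ∀ᶠ δ in nhdsWithin 0 (Set.Ioi 0), F δ < η ^ n := by
    have h1 : F 0 < η ^ n := by rw [hF0]; positivity
    exact ((hFc.tendsto 0).eventually_lt_const h1).filter_mono nhdsWithin_le_nhds
  obtain ⟨δ, hδF, hδ⟩ := (hFη.and self_mem_nhdsWithin).exists
  obtain ⟨N, hN⟩ := hx δ hδ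
  refine ⟨N, fun k hk l hl => ?_⟩
  have hcl := norm_add_pow_add_norm_sub_pow_le (x k) (x l)
  have e1 : (2 : ℝ) ^ ((n : ℝ) - 1) = 2 ^ n / 2 := by
    rw [Real.rpow_sub (by norm_num), Real.rpow_natCast, Real.rpow_one]
  rw [e1] at hcl
  have h4 : (2 * max (D - δ) 0) ^ n ≤ ‖x k + x l‖ ^ n := by
    gcongr
    exact (hN k hk l hl).2
  have h5 : ‖x k‖ ^ n ≤ (D + δ) ^ n := by gcongr; exact (hN k hk k hk).1
  have h6 : ‖x l‖ ^ n ≤ (D + δ) ^ n := by gcongr; exact (hN l hl l hl).1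
  rw [mul_pow] at h4
  have h7 : ‖x k - x l‖ ^ n < η ^ n := by
    refine lt_of_le_of_lt ?_ hδF
    have h8 : (0 : ℝ) < 2 ^ n := by positivity
    have h9 : 2 ^ n / 2 * (‖x k‖ ^ n + ‖x l‖ ^ n) ≤ 2 ^ n * (D + δ) ^ n := by
      have := mul_le_mul_of_nonneg_left (add_le_add h5 h6) (show (0 : ℝ) ≤ 2 ^ n / 2 by positivity)
      linarith
    simp only [hF, mul_sub]
    linarith
  rw [dist_eq_norm]
  exact lt_of_pow_lt_pow_left₀ n hη.le h7

/-- Weak lower semicontinuity of `‖·‖`: if elements of `W₀^{1,n}(Ω)` of norm at most `ℓ + ε` lie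
`ε`-close to `U` in `Lⁿ` for every `ε`, then `U` carries an element of `W₀^{1,n}(Ω)` of norm at
most `ℓ`. Elements close to `U` of almost minimal norm form a Cauchy sequence by Clarkson's
inequality, as their midpoints are close to `U` too. -/
theorem exists_mem_W0_of_approx (U : Lp ℝ (n : ℝ≥0∞) (volume.restrict Ω)) {ℓ : ℝ}
    (hU : ∀ ε > 0, ∃ v : W0 Ω, ‖v.1.1 - U‖ ≤ ε ∧ gradNorm v ≤ ℓ + ε) :
    ∃ w : W0 Ω, w.1.1 = U ∧ gradNorm w ≤ ℓ := by
  -- `sSup S` is the limit, as `ε → 0`, of the infimum of `‖v‖` over all `v` within `ε` of `U`.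
  set S : Set ℝ := {c | ∃ ε > 0, ∀ v : W0 Ω, ‖v.1.1 - U‖ ≤ ε → c ≤ gradNorm v} with hS
  have h0S : (0 : ℝ) ∈ S := ⟨1, one_pos, fun v _ => gradNorm_nonneg v⟩
  have hub : ∀ c ∈ S, c ≤ ℓ := by
    rintro c ⟨ε, hε, hc⟩
    refine le_of_forall_pos_le_add fun η hη => ?_
    obtain ⟨v, hv1, hv2⟩ := hU (min ε η) (lt_min hε hη)
    exact (hc v (hv1.trans (min_le_left _ _))).trans
      (hv2.trans (by gcongr; exact min_le_right _ _))
  have hbdd : BddAbove S := ⟨ℓ, hub⟩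
  set D := sSup S with hD
  have hD0 : 0 ≤ D := le_csSup hbdd h0S
  have hDℓ : D ≤ ℓ := csSup_le ⟨0, h0S⟩ hub
  have hlow : ∀ δ > 0, ∃ ε > 0, ∀ v : W0 Ω, ‖v.1.1 - U‖ ≤ ε → max (D - δ) 0 ≤ gradNorm v := by
    intro δ hδ
    obtain ⟨c, ⟨ε, hε, hc⟩, hcD⟩ := exists_lt_of_lt_csSup ⟨0, h0S⟩ (show D - δ < sSup S by linarith)
    exact ⟨ε, hε, fun v hv => max_le (hcD.le.trans (hc v hv)) (gradNorm_nonneg v)⟩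
  have hup : ∀ k : ℕ, ∃ v : W0 Ω, ‖v.1.1 - U‖ ≤ 1 / ((k : ℝ) + 1) ∧
      gradNorm v < D + 1 / ((k : ℝ) + 1) := by
    intro k
    by_contra! hcon
    have hk : (0 : ℝ) < 1 / ((k : ℝ) + 1) := by positivity
    have : D + 1 / ((k : ℝ) + 1) ∈ S := ⟨_, hk, fun v hv => hcon v hv⟩
    linarith [le_csSup hbdd this]
  choose v hv1 hv2 using hup
  have hlim1 : Filter.Tendsto (fun k => (v k).1.1) Filter.atTop (nhds U) := by
    rw [tendsto_iff_norm_sub_tendsto_zero]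
    exact squeeze_zero (fun _ => norm_nonneg _) hv1 tendsto_one_div_add_atTop_nhds_zero_nat
  have hcau : CauchySeq fun k => (v k).1.2 := by
    refine cauchySeq_of_norm_midpoint hD0 fun δ hδ0 => ?_
    obtain ⟨ε, hε, hlowδ⟩ := hlow δ hδ0
    obtain ⟨N, hN⟩ := exists_nat_one_div_lt (lt_min hε hδ0)
    refine ⟨N, fun k hk l hl => ?_⟩
    have hsmall : ∀ k ≥ N, 1 / ((k : ℝ) + 1) < min ε δ := by
      intro k hk
      refine lt_of_le_of_lt ?_ hN
      have : (N : ℝ) ≤ k := by exact_mod_cast hk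
      gcongr
    have hg : gradNorm (v k) ≤ D + δ := by
      have := hsmall k hk
      have := min_le_right ε δ
      linarith [hv2 k]
    have hmid : max (D - δ) 0 ≤ gradNorm ((1 / 2 : ℝ) • (v k + v l)) := by
      apply hlowδ
      have e : ((1 / 2 : ℝ) • (v k + v l)).1.1 - U =
          (1 / 2 : ℝ) • (((v k).1.1 - U) + ((v l).1.1 - U)) := by
        show (1 / 2 : ℝ) • ((v k).1.1 + (v l).1.1) - U = _
        module
      rw [e, norm_smul]
      have h1 := (hv1 k).trans ((hsmall k hk).le.trans (min_le_left _ _))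
      have h2 := (hv1 l).trans ((hsmall l hl).le.trans (min_le_left _ _))
      have h3 := norm_add_le ((v k).1.1 - U) ((v l).1.1 - U)
      rw [Real.norm_of_nonneg (by norm_num)]
      linarith
    rw [gradNorm_smul, abs_of_pos (by norm_num)] at hmid
    refine ⟨hg, ?_⟩
    have : gradNorm (v k + v l) = ‖(v k).1.2 + (v l).1.2‖ := rfl
    linarith
  obtain ⟨ξ, hξ⟩ := cauchySeq_tendsto_of_complete hcau
  have hmem : (U, ξ) ∈ W0 Ω := by
    refine (Submodule.isClosed_topologicalClosure _).mem_of_tendsto (hlim1.prodMk_nhds hξ)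
      (Filter.Eventually.of_forall fun k => ?_)
    exact (v k).2
  refine ⟨⟨(U, ξ), hmem⟩, rfl, ?_⟩
  refine le_trans ?_ hDℓ
  have h1 : Filter.Tendsto (fun k => ‖(v k).1.2‖) Filter.atTop (nhds ‖ξ‖) := hξ.norm
  have h2 : Filter.Tendsto (fun k : ℕ => D + 1 / ((k : ℝ) + 1)) Filter.atTop (nhds (D + 0)) :=
    tendsto_const_nhds.add tendsto_one_div_add_atTop_nhds_zero_nat
  rw [add_zero] at h2
  exact le_of_tendsto_of_tendsto' h1 h2 fun k => (hv2 k).le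

/-- `W₀^{1,n}(Ω)` is stable under `u ↦ |u|`, which does not increase the norm. -/
theorem exists_abs (hΩ : Bornology.IsBounded Ω) (u : W0 Ω) :
    ∃ w : W0 Ω, (fn w =ᵐ[volume.restrict Ω] fun x => |fn u x|) ∧ gradNorm w ≤ gradNorm u := by
  have : IsFiniteMeasure (volume.restrict Ω) := ⟨by simpa using hΩ.measure_lt_top⟩
  obtain ⟨w, hw1, hw2⟩ := exists_mem_W0_of_approx (Ω := Ω) |u.1.1| (ℓ := gradNorm u) (by
    intro ε hε
    set m : ℝ := (measureUnivNNReal (volume.restrict Ω) : ℝ) ^ ((n : ℝ≥0∞).toReal)⁻¹ with hm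
    have hm0 : 0 ≤ m := by positivity
    set δ : ℝ := ε / (2 * (m + 1)) with hδ
    have hδ0 : 0 < δ := by positivity
    have hδε : m * δ ≤ ε / 2 := by
      rw [hδ, mul_div_assoc', div_le_div_iff₀ (by positivity) (by positivity)]
      nlinarith
    obtain ⟨φ, hφ, h1, h2⟩ := exists_test_near u (half_pos hε)
    obtain ⟨hv, hvg⟩ := hφ.sqrt_add_sub hδ0
    refine ⟨ofTest hv, ?_, ?_⟩
    · have h3 : ‖(ofTest hv).1.1 - |(ofTest hφ).1.1|‖ ≤ m * δ := by
        refine Lp.norm_le_of_ae_bound hδ0.le ?_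
        filter_upwards [Lp.coeFn_sub (ofTest hv).1.1 |(ofTest hφ).1.1|,
          Lp.coeFn_abs (ofTest hφ).1.1, fn_ofTest hφ, fn_ofTest hv] with x e1 e2 e3 e4
        simp only [fn] at e3 e4
        rw [e1, Pi.sub_apply, e2, e3, e4, Real.norm_eq_abs, abs_le]
        have a1 : |φ x| ≤ Real.sqrt (φ x ^ 2 + δ ^ 2) :=
          Real.le_sqrt_of_sq_le (by rw [sq_abs]; nlinarith)
        have a2 : Real.sqrt (φ x ^ 2 + δ ^ 2) ≤ |φ x| + δ := by
          rw [Real.sqrt_le_left (by positivity)]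
          nlinarith [sq_abs (φ x), abs_nonneg (φ x)]
        constructor <;> linarith
      have h4 : ‖|(ofTest hφ).1.1| - |u.1.1|‖ ≤ ε / 2 := by
        refine (norm_abs_sub_abs _ _).trans ?_
        rw [norm_sub_rev]; exact h1.le
      calc _ = ‖((ofTest hv).1.1 - |(ofTest hφ).1.1|) + (|(ofTest hφ).1.1| - |u.1.1|)‖ := by
            congr 1; abel
        _ ≤ _ := (norm_add_le _ _).trans (by linarith)
    · have h5 : gradNorm (ofTest hv) ≤ gradNorm (ofTest hφ) := by
        refine Lp.norm_le_norm_of_ae_le ?_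
        filter_upwards [MemLp.coeFn_toLp (hφ.memLp_gradient (Ω := Ω) n),
          MemLp.coeFn_toLp (hv.memLp_gradient (Ω := Ω) n)] with x e1 e2
        have e3 : (ofTest hv).1.2 x = gradient (fun x => Real.sqrt (φ x ^ 2 + δ ^ 2) - δ) x := e2
        have e4 : (ofTest hφ).1.2 x = gradient φ x := e1
        rw [e3, e4]
        exact hvg x
      have h6 := abs_le.1 (abs_gradNorm_sub_le u (ofTest hφ))
      linarith)
  refine ⟨w, ?_, hw2⟩
  have : fn w = (|u.1.1| : Lp ℝ (n : ℝ≥0∞) (volume.restrict Ω)) := by rw [fn, hw1]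
  rw [this]
  exact Lp.coeFn_abs _

end Space

/-! ### Compactness in `L¹` -/

theorem lintegral_enorm_translate_sub_le {n : ℕ} {φ : Eucl n → ℝ} (hφ : ContDiff ℝ 1 φ)
    (h : Eucl n) :
    ∫⁻ x, ‖φ (x + h) - φ x‖ₑ ≤ ‖h‖ₑ * ∫⁻ x, ‖fderiv ℝ φ x‖ₑ := by
  have hc : Continuous (fderiv ℝ φ) := hφ.continuous_fderiv one_ne_zero
  have h1 : ∀ x, ‖φ (x + h) - φ x‖ₑ ≤
      ∫⁻ s in Set.Ioc (0 : ℝ) 1, ‖h‖ₑ * ‖fderiv ℝ φ (x + s • h)‖ₑ := by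
    intro x
    have hd : ∀ s : ℝ, HasDerivAt (fun s : ℝ => φ (x + s • h)) (fderiv ℝ φ (x + s • h) h) s := by
      intro s
      have e1 : HasDerivAt (fun s : ℝ => x + s • h) h s := by
        simpa using ((hasDerivAt_id s).smul_const h).const_add x
      exact (hφ.differentiable one_ne_zero _).hasFDerivAt.comp_hasDerivAt s e1
    have e2 : Continuous fun s : ℝ => fderiv ℝ φ (x + s • h) h := by fun_prop
    have e3 := intervalIntegral.integral_eq_sub_of_hasDerivAt (a := 0) (b := 1)
      (fun s _ => hd s) (e2.intervalIntegrable _ _)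
    simp only [one_smul, zero_smul, add_zero] at e3
    rw [← e3, intervalIntegral.integral_of_le zero_le_one]
    refine (enorm_integral_le_lintegral_enorm _).trans (lintegral_mono fun s => ?_)
    rw [mul_comm]
    exact ContinuousLinearMap.le_opENorm _ _
  have hm : Measurable (Function.uncurry fun (x : Eucl n) (s : ℝ) =>
      ‖h‖ₑ * ‖fderiv ℝ φ (x + s • h)‖ₑ) := by
    have : Continuous fun p : Eucl n × ℝ => fderiv ℝ φ (p.1 + p.2 • h) := by fun_prop
    exact this.enorm.measurable.const_mul _
  calc _ ≤ ∫⁻ x, ∫⁻ s in Set.Ioc (0 : ℝ) 1, ‖h‖ₑ * ‖fderiv ℝ φ (x + s • h)‖ₑ := lintegral_mono h1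
    _ = ∫⁻ s in Set.Ioc (0 : ℝ) 1, ∫⁻ x, ‖h‖ₑ * ‖fderiv ℝ φ (x + s • h)‖ₑ :=
        lintegral_lintegral_swap hm.aemeasurable
    _ = ∫⁻ s in Set.Ioc (0 : ℝ) 1, ‖h‖ₑ * ∫⁻ x, ‖fderiv ℝ φ x‖ₑ := by
        refine lintegral_congr fun s => ?_
        rw [lintegral_const_mul' _ _ (by finiteness),
          lintegral_add_right_eq_self (fun x => ‖fderiv ℝ φ x‖ₑ)]
    _ = _ := by simp

/-- The cell of the cubic grid of mesh `ε` with index `k`. -/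
def gridCell {n : ℕ} (ε : ℝ) (k : Fin n → ℤ) : Set (Eucl n) :=
  {x | ∀ i, x i ∈ Set.Ico (k i * ε) ((k i + 1) * ε)}

/-- The index of the cell of the cubic grid of mesh `ε` which contains `x`. -/
noncomputable def gridIndex {n : ℕ} (ε : ℝ) (x : Eucl n) : Fin n → ℤ := fun i => ⌊x i / ε⌋

theorem mem_gridCell_iff {n : ℕ} {ε : ℝ} (hε : 0 < ε) {k : Fin n → ℤ} {x : Eucl n} :
    x ∈ gridCell ε k ↔ gridIndex ε x = k := by
  simp only [gridCell, gridIndex, funext_iff, Int.floor_eq_iff, le_div_iff₀ hε, div_lt_iff₀ hε]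
  rfl

theorem gridCell_eq_preimage {n : ℕ} (ε : ℝ) (k : Fin n → ℤ) :
    gridCell ε k = (MeasurableEquiv.toLp 2 (Fin n → ℝ)).symm ⁻¹'
      (Set.univ.pi fun i => Set.Ico (k i * ε) ((k i + 1) * ε)) := by
  ext x
  simp [gridCell, Set.mem_pi]

theorem measurableSet_gridCell {n : ℕ} (ε : ℝ) (k : Fin n → ℤ) :
    MeasurableSet (gridCell ε k) := by
  rw [gridCell_eq_preimage]
  exact (MeasurableEquiv.measurable _)
    (MeasurableSet.univ_pi fun i => measurableSet_Ico)

theorem volume_gridCell {n : ℕ} (ε : ℝ) (k : Fin n → ℤ) :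
    volume (gridCell ε k) = ENNReal.ofReal ε ^ n := by
  rw [gridCell_eq_preimage,
    (EuclideanSpace.volume_preserving_symm_measurableEquiv_toLp (Fin n)).measure_preimage
      (MeasurableSet.univ_pi fun i => measurableSet_Ico).nullMeasurableSet, volume_pi_pi]
  have : ∀ i, (k i + 1) * ε - k i * ε = ε := fun i => by ring
  simp [Real.volume_Ico, this]

theorem norm_sub_le_of_mem_gridCell {n : ℕ} {ε : ℝ} (hε : 0 < ε) {k : Fin n → ℤ} {x z : Eucl n}
    (hx : x ∈ gridCell ε k) (hz : z ∈ gridCell ε k) : ‖z - x‖ ≤ n * ε := by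
  rw [EuclideanSpace.norm_eq, Real.sqrt_le_left (by positivity)]
  have h1 : ∀ i, ‖(z - x) i‖ ^ 2 ≤ ε ^ 2 := by
    intro i
    have h2 := hx i
    have h3 := hz i
    rw [Set.mem_Ico] at h2 h3
    rw [Real.norm_eq_abs, sq_abs]
    apply sq_le_sq'
    · simp only [PiLp.sub_apply]; nlinarith
    · simp only [PiLp.sub_apply]; nlinarith
  calc _ ≤ ∑ i : Fin n, ε ^ 2 := Finset.sum_le_sum fun i _ => h1 i
    _ = n * ε ^ 2 := by simp
    _ ≤ (n * ε) ^ 2 := by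
        rw [mul_pow]
        gcongr
        rcases Nat.eq_zero_or_pos n with h | h
        · simp [h]
        · have : (1 : ℝ) ≤ n := by exact_mod_cast h
          nlinarith

/-- The mean value of `φ` on a grid cell. -/
noncomputable def cellMean {n : ℕ} (ε : ℝ) (φ : Eucl n → ℝ) (k : Fin n → ℤ) : ℝ :=
  (ε ^ n)⁻¹ * ∫ z in gridCell ε k, φ z

/-- Replacing `φ` by its mean values on the cells of a grid of mesh `ε` costs at most a multiple of
`ε ‖∇φ‖₁` in `L¹`. -/
theorem lintegral_enorm_sub_cellMean_le {n : ℕ} {φ : Eucl n → ℝ}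
    (hφ : ContDiff ℝ 1 φ) (hφc : HasCompactSupport φ) {ε : ℝ} (hε : 0 < ε) :
    ∫⁻ x, ‖φ x - cellMean ε φ (gridIndex ε x)‖ₑ ≤
      ENNReal.ofReal ((n : ℝ) ^ n * volume.real (Metric.closedBall (0 : Eucl n) 1) * (n * ε)) *
        ∫⁻ x, ‖fderiv ℝ φ x‖ₑ := by
  set B := Metric.closedBall (0 : Eucl n) (n * ε) with hB
  have hεn : (0 : ℝ) < ε ^ n := by positivity
  have hint : Integrable φ volume := hφ.continuous.integrable_of_hasCompactSupport hφc
  have h1 : ∀ x, ‖φ x - cellMean ε φ (gridIndex ε x)‖ₑ ≤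
      ENNReal.ofReal ((ε ^ n)⁻¹) * ∫⁻ h in B, ‖φ (x + h) - φ x‖ₑ := by
    intro x
    set k := gridIndex ε x with hk
    have hxk : x ∈ gridCell ε k := (mem_gridCell_iff hε).2 rfl
    have hvol : volume.real (gridCell ε k) = ε ^ n := by
      simp [measureReal_def, volume_gridCell, ENNReal.toReal_pow, ENNReal.toReal_ofReal hε.le]
    have hfin : volume (gridCell ε k) ≠ ⊤ := by rw [volume_gridCell]; finiteness
    have e1 : φ x - cellMean ε φ k = (ε ^ n)⁻¹ * ∫ z in gridCell ε k, (φ x - φ z) := by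
      rw [integral_sub (integrableOn_const (C := φ x) hfin (by finiteness)) hint.integrableOn,
      setIntegral_const, hvol,
        cellMean, smul_eq_mul, mul_sub, inv_mul_cancel_left₀ hεn.ne']
    rw [e1, enorm_mul, Real.enorm_of_nonneg (by positivity)]
    gcongr
    calc _ ≤ ∫⁻ z in gridCell ε k, ‖φ x - φ z‖ₑ := enorm_integral_le_lintegral_enorm _
      _ = ∫⁻ z, (gridCell ε k).indicator (fun z => ‖φ x - φ z‖ₑ) z :=
          (lintegral_indicator (measurableSet_gridCell ε k) _).symm
      _ = ∫⁻ h, (gridCell ε k).indicator (fun z => ‖φ x - φ z‖ₑ) (x + h) :=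
          (lintegral_add_left_eq_self _ x).symm
      _ ≤ ∫⁻ h, B.indicator (fun h => ‖φ (x + h) - φ x‖ₑ) h := by
          refine lintegral_mono fun h => ?_
          by_cases hh : x + h ∈ gridCell ε k
          · have : h ∈ B := by
              rw [hB, mem_closedBall_zero_iff]
              simpa using norm_sub_le_of_mem_gridCell hε hxk hh
            rw [Set.indicator_of_mem hh, Set.indicator_of_mem this, enorm_sub_rev]
          · rw [Set.indicator_of_notMem hh]
            exact zero_le
      _ = _ := lintegral_indicator measurableSet_closedBall _
  have hm : Measurable (Function.uncurry fun (x h : Eucl n) => ‖φ (x + h) - φ x‖ₑ) := by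
    have : Continuous fun p : Eucl n × Eucl n => φ (p.1 + p.2) - φ p.1 := by
      have := hφ.continuous
      fun_prop
    exact this.enorm.measurable
  have hvB : volume B =
        ENNReal.ofReal ((n * ε) ^ n) * volume (Metric.closedBall (0 : Eucl n) 1) := by
    rw [hB, Measure.addHaar_closedBall' _ _ (by positivity)]
    simp
  have hB1 : volume (Metric.closedBall (0 : Eucl n) 1) ≠ ⊤ := measure_closedBall_lt_top.ne
  calc _ ≤ ∫⁻ x, ENNReal.ofReal ((ε ^ n)⁻¹) * ∫⁻ h in B, ‖φ (x + h) - φ x‖ₑ := lintegral_mono h1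
    _ = ENNReal.ofReal ((ε ^ n)⁻¹) * ∫⁻ h in B, ∫⁻ x, ‖φ (x + h) - φ x‖ₑ := by
        rw [lintegral_const_mul' _ _ ENNReal.ofReal_ne_top,
          lintegral_lintegral_swap hm.aemeasurable]
    _ ≤ ENNReal.ofReal ((ε ^ n)⁻¹) *
        ∫⁻ h in B, ENNReal.ofReal (n * ε) * ∫⁻ x, ‖fderiv ℝ φ x‖ₑ := by
        refine mul_le_mul_right ?_ _
        refine setLIntegral_mono' measurableSet_closedBall fun h hh => ?_
        refine (lintegral_enorm_translate_sub_le hφ h).trans ?_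
        gcongr
        rw [← ofReal_norm]
        exact ENNReal.ofReal_le_ofReal (mem_closedBall_zero_iff.1 hh)
    _ = _ := by
        rw [setLIntegral_const, hvB, ← ofReal_measureReal hB1, mul_comm (_ * _) (_ * _),
          ← mul_assoc, ← mul_assoc, ← ENNReal.ofReal_mul (by positivity),
          ← ENNReal.ofReal_mul (by positivity), ← ENNReal.ofReal_mul (by positivity)]
        congr 2
        rw [mul_pow]
        field_simp

/-- The **Rellich–Kondrachov theorem** in the form used here: functions supported in a fixed bounded
set which are bounded in `W^{1,1}` form a totally bounded set in `L¹`. Averaging over the cells of a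
fine grid approximates them by a bounded set in a finite-dimensional space. -/
theorem totallyBounded_of_lintegral_fderiv_le {n : ℕ} {Ω : Set (Eucl n)}
    (hΩ : Bornology.IsBounded Ω) (R : ℝ) :
    TotallyBounded {f : Lp ℝ 1 (volume : Measure (Eucl n)) | ∃ φ : Eucl n → ℝ, ContDiff ℝ 1 φ ∧
      HasCompactSupport φ ∧ tsupport φ ⊆ Ω ∧ ∫⁻ x, ‖φ x‖ₑ ≤ ENNReal.ofReal R ∧
      ∫⁻ x, ‖fderiv ℝ φ x‖ₑ ≤ ENNReal.ofReal R ∧ f =ᵐ[volume] φ} := by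
  rw [Metric.totallyBounded_iff]
  intro η hη
  set C : ℝ := (n : ℝ) ^ n * volume.real (Metric.closedBall (0 : Eucl n) 1) * n with hC
  have hC0 : 0 ≤ C := by positivity
  set ε : ℝ := η / (4 * (C + 1) * (|R| + 1)) with hε
  have hε0 : 0 < ε := by positivity
  have hεη : C * ε * |R| ≤ η / 4 := by
    rw [hε, mul_div_assoc', div_mul_eq_mul_div, div_le_div_iff₀ (by positivity) (by positivity)]
    nlinarith [abs_nonneg R, mul_nonneg hC0 (abs_nonneg R), mul_nonneg hη.le (abs_nonneg R),
      mul_nonneg hη.le hC0]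
  obtain ⟨ρ, hρ0, hρ⟩ := hΩ.exists_pos_norm_le
  obtain ⟨N, hN⟩ := exists_nat_gt (ρ / ε + 1)
  set F : Finset (Fin n → ℤ) := Fintype.piFinset fun _ => Finset.Icc (-(N : ℤ)) N with hF
  have hFmem : ∀ x ∈ Ω, gridIndex ε x ∈ F := by
    intro x hx
    rw [hF, Fintype.mem_piFinset]
    intro i
    have h1 : |x i| ≤ ρ := (PiLp.norm_apply_le x i).trans (hρ x hx)
    have h2 := abs_le.1 h1
    rw [Finset.mem_Icc]
    constructor
    · rw [gridIndex, Int.le_floor]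
      push_cast
      rw [le_div_iff₀ hε0]
      have : ρ / ε ≤ N := by linarith
      rw [div_le_iff₀ hε0] at this
      linarith
    · rw [gridIndex, ← Int.lt_add_one_iff, Int.floor_lt]
      push_cast
      rw [div_lt_iff₀ hε0]
      have : ρ / ε < N + 1 := by linarith
      rw [div_lt_iff₀ hε0] at this
      linarith
  have hfin : ∀ k : Fin n → ℤ, volume (gridCell ε k) ≠ ⊤ := fun k => by
    rw [volume_gridCell]; finiteness
  -- The step function with value `a k` on the cell with index `k`.
  set Λ : (F → ℝ) → Lp ℝ 1 (volume : Measure (Eucl n)) := fun a =>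
    ∑ k : F, a k • indicatorConstLp 1 (measurableSet_gridCell ε k.1) (hfin k) (1 : ℝ) with hΛ
  have hΛc : Continuous Λ :=
    continuous_finsetSum _ fun k _ => (continuous_apply k).smul continuous_const
  have hcpt : IsCompact (Λ '' Metric.closedBall 0 ((ε ^ n)⁻¹ * |R|)) :=
    (isCompact_closedBall _ _).image hΛc
  obtain ⟨t, htf, ht⟩ := Metric.totallyBounded_iff.1 hcpt.totallyBounded (η / 2) (half_pos hη)
  refine ⟨t, htf, ?_⟩
  rintro f ⟨φ, hφ, hφc, hφΩ, hφ1, hφ2, hfφ⟩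
  set a : F → ℝ := fun k => cellMean ε φ k.1 with ha
  have haR : a ∈ Metric.closedBall (0 : F → ℝ) ((ε ^ n)⁻¹ * |R|) := by
    rw [mem_closedBall_zero_iff, pi_norm_le_iff_of_nonneg (by positivity)]
    intro k
    show ‖(ε ^ n)⁻¹ * ∫ z in gridCell ε k.1, φ z‖ ≤ _
    rw [norm_mul, norm_inv, norm_pow, Real.norm_of_nonneg hε0.le]
    gcongr
    have h1 : ‖∫ z in gridCell ε k.1, φ z‖ₑ ≤ ENNReal.ofReal |R| :=
      (enorm_integral_le_lintegral_enorm _).trans ((setLIntegral_le_lintegral _ _).trans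
        (hφ1.trans (ENNReal.ofReal_le_ofReal (le_abs_self R))))
    rwa [← ofReal_norm, ENNReal.ofReal_le_ofReal_iff (abs_nonneg R)] at h1
  have hΛa : Λ a =ᵐ[volume] fun x => cellMean ε φ (gridIndex ε x) := by
    have e1 : Λ a =ᵐ[volume] fun x => ∑ k : F, a k *
        (gridCell ε k.1).indicator (fun _ => (1 : ℝ)) x := by
      have e2 : ∀ᵐ x ∂(volume : Measure (Eucl n)), ∀ k : F,
          (a k • indicatorConstLp 1 (measurableSet_gridCell ε k.1) (hfin k) (1 : ℝ) :
            Lp ℝ 1 (volume : Measure (Eucl n))) x =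
          a k * (gridCell ε k.1).indicator (fun _ => (1 : ℝ)) x := by
        rw [ae_all_iff]
        intro k
        filter_upwards [Lp.coeFn_smul (a k)
          (indicatorConstLp 1 (measurableSet_gridCell ε k.1) (hfin k) (1 : ℝ)),
          indicatorConstLp_coeFn (p := 1) (hs := measurableSet_gridCell ε k.1) (hμs := hfin k)
            (c := (1 : ℝ))] with x h1 h2
        rw [h1, Pi.smul_apply, h2, smul_eq_mul]
      filter_upwards [Lp.coeFn_finsetSum Finset.univ fun k : F =>
        a k • indicatorConstLp 1 (measurableSet_gridCell ε k.1) (hfin k) (1 : ℝ), e2] with x h1 h2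
      rw [hΛ]
      simp only
      rw [h1, Finset.sum_apply]
      exact Finset.sum_congr rfl fun k _ => h2 k
    refine e1.trans (Filter.Eventually.of_forall fun x => ?_)
    simp only
    by_cases hx : gridIndex ε x ∈ F
    · rw [Finset.sum_eq_single ⟨gridIndex ε x, hx⟩]
      · rw [Set.indicator_of_mem ((mem_gridCell_iff hε0).2 rfl), mul_one]
      · intro k _ hk
        rw [Set.indicator_of_notMem, mul_zero]
        rw [mem_gridCell_iff hε0]
        intro h
        exact hk (Subtype.ext h.symm)
      · simp
    -- A cell with index outside `F` does not meet `Ω`, so the mean value of `φ` there is zero.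
    · rw [Finset.sum_eq_zero]
      · have : ∀ z ∈ gridCell ε (gridIndex ε x), φ z = 0 := by
          intro z hz
          by_contra hne
          apply hx
          rw [mem_gridCell_iff hε0] at hz
          rw [← hz]
          exact hFmem z (hφΩ (subset_tsupport _ hne))
        rw [cellMean, setIntegral_congr_fun (measurableSet_gridCell _ _) this]
        simp
      · intro k _
        rw [Set.indicator_of_notMem, mul_zero]
        rw [mem_gridCell_iff hε0]
        intro h
        exact hx (h ▸ k.2)
  have hdist : dist f (Λ a) < η / 2 := by
    have h1 : edist f (Λ a) ≤ ENNReal.ofReal (η / 4) := by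
      rw [Lp.edist_def, eLpNorm_one_eq_lintegral_enorm]
      calc _ = ∫⁻ x, ‖φ x - cellMean ε φ (gridIndex ε x)‖ₑ := by
            refine lintegral_congr_ae ?_
            filter_upwards [hfφ, hΛa] with x h1 h2
            rw [Pi.sub_apply, h1, h2]
        _ ≤ _ := lintegral_enorm_sub_cellMean_le hφ hφc hε0
        _ ≤ ENNReal.ofReal (C * ε) * ENNReal.ofReal |R| := by
            refine mul_le_mul' (ENNReal.ofReal_le_ofReal (le_of_eq ?_))
              (hφ2.trans (ENNReal.ofReal_le_ofReal (le_abs_self R)))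
            rw [hC]; ring
        _ ≤ _ := by
            rw [← ENNReal.ofReal_mul (by positivity)]
            exact ENNReal.ofReal_le_ofReal hεη
    rw [edist_dist, ENNReal.ofReal_le_ofReal_iff (by positivity)] at h1
    linarith
  obtain ⟨y, hy, hyd⟩ := Set.mem_iUnion₂.1 (ht ⟨a, haR, rfl⟩)
  refine Set.mem_iUnion₂.2 ⟨y, hy, ?_⟩
  rw [Metric.mem_ball] at hyd ⊢
  linarith [dist_triangle f (Λ a) y]

/-! ### Convergence of integrals of functions of exponential growth -/

theorem enorm_abs_rpow {r : ℝ} (hr : 0 ≤ r) (y : ℝ) : ‖|y| ^ r‖ₑ = ‖y‖ₑ ^ r := by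
  rw [Real.enorm_of_nonneg (by positivity), Real.enorm_eq_ofReal_abs,
    ENNReal.ofReal_rpow_of_nonneg (abs_nonneg _) hr]

/-- A sequence which converges to zero almost everywhere and is bounded in `L²` over a finite
measure space converges to zero in `L¹`. -/
theorem tendsto_lintegral_enorm_of_sq_bounded {α : Type*} [MeasurableSpace α] {μ : Measure α}
    [IsFiniteMeasure μ] {f : ℕ → α → ℝ} (hf : ∀ k, AEStronglyMeasurable (f k) μ)
    (hlim : ∀ᵐ x ∂μ, Filter.Tendsto (fun k => f k x) Filter.atTop (nhds 0)) {C : ℝ}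
    (hC : ∀ k, ∫⁻ x, ‖f k x ^ 2‖ₑ ∂μ ≤ ENNReal.ofReal C) :
    Filter.Tendsto (fun k => ∫⁻ x, ‖f k x‖ₑ ∂μ) Filter.atTop (nhds 0) := by
  rw [ENNReal.tendsto_nhds_zero]
  intro ε hε
  rcases eq_or_ne ε ⊤ with rfl | hεtop
  · exact Filter.Eventually.of_forall fun _ => le_top
  have hε2 : 0 < (ε / 2).toReal :=
    ENNReal.toReal_pos (ENNReal.half_pos hε.ne').ne' (by finiteness)
  -- In `|y| ≤ min |y| R + y ^ 2 / R` the first term is treated by dominated convergence, and this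
  -- choice of `R` makes the integral of the second one at most `ε / 2`.
  set R : ℝ := max C 1 / (ε / 2).toReal with hR
  have hC1 : (0 : ℝ) < max C 1 := lt_max_of_lt_right one_pos
  have hR0 : 0 < R := div_pos hC1 hε2
  have hpt : ∀ y : ℝ, ‖y‖ₑ ≤ ENNReal.ofReal (min |y| R) + ENNReal.ofReal R⁻¹ * ‖y ^ 2‖ₑ := by
    intro y
    rw [Real.enorm_eq_ofReal_abs, Real.enorm_eq_ofReal_abs, ← ENNReal.ofReal_mul (by positivity),
      ← ENNReal.ofReal_add (by positivity) (by positivity)]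
    apply ENNReal.ofReal_le_ofReal
    rw [abs_pow]
    rcases le_total |y| R with h | h
    · rw [min_eq_left h]
      have : 0 ≤ R⁻¹ * |y| ^ 2 := by positivity
      linarith
    · rw [min_eq_right h, sq, ← mul_assoc]
      have : 1 ≤ R⁻¹ * |y| := by rw [inv_mul_eq_div, one_le_div hR0]; exact h
      nlinarith [abs_nonneg y]
  have hmc : Continuous fun y : ℝ => ENNReal.ofReal (min |y| R) :=
    ENNReal.continuous_ofReal.comp (by fun_prop)
  have h1 : Filter.Tendsto (fun k => ∫⁻ x, ENNReal.ofReal (min |f k x| R) ∂μ) Filter.atTop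
      (nhds (∫⁻ _, 0 ∂μ)) := by
    refine tendsto_lintegral_of_dominated_convergence' (fun _ => ENNReal.ofReal R)
      (fun k => (hmc.comp_aestronglyMeasurable (hf k)).aemeasurable)
      (fun k => Filter.Eventually.of_forall fun x =>
        ENNReal.ofReal_le_ofReal (min_le_right _ _)) ?_ ?_
    · rw [lintegral_const]; finiteness
    · filter_upwards [hlim] with x hx
      have h2 := (hmc.tendsto 0).comp hx
      simpa [Function.comp_def, min_eq_left hR0.le] using h2
  rw [lintegral_zero, ENNReal.tendsto_nhds_zero] at h1
  filter_upwards [h1 (ε / 2) (ENNReal.half_pos hε.ne')] with k hk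
  calc _ ≤ ∫⁻ x, (ENNReal.ofReal (min |f k x| R) + ENNReal.ofReal R⁻¹ * ‖f k x ^ 2‖ₑ) ∂μ :=
        lintegral_mono fun x => hpt _
    _ = ∫⁻ x, ENNReal.ofReal (min |f k x| R) ∂μ +
          ENNReal.ofReal R⁻¹ * ∫⁻ x, ‖f k x ^ 2‖ₑ ∂μ := by
        rw [lintegral_add_left' (hmc.comp_aestronglyMeasurable (hf k)).aemeasurable,
          lintegral_const_mul' _ _ ENNReal.ofReal_ne_top]
    _ ≤ ε / 2 + ENNReal.ofReal R⁻¹ * ENNReal.ofReal (max C 1) := by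
        gcongr
        exact (hC k).trans (ENNReal.ofReal_le_ofReal (le_max_left _ _))
    _ = ε / 2 + ε / 2 := by
        rw [← ENNReal.ofReal_mul (by positivity)]
        congr 1
        rw [hR, inv_div, div_mul_cancel₀ _ hC1.ne', ENNReal.ofReal_toReal (by finiteness)]
    _ = ε := ENNReal.add_halves ε

/-- The functions `F` with `|F(s)| ≤ C exp (c |s| ^ β)` for some constants `C` and `c`. -/
def ExpGrowth (β : ℝ) (F : ℝ → ℝ) : Prop :=
  ∃ C c : ℝ, 0 ≤ C ∧ 0 ≤ c ∧ ∀ s, |F s| ≤ C * Real.exp (c * |s| ^ β)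

namespace ExpGrowth

variable {β : ℝ} {F F' : ℝ → ℝ}

theorem mono (h : ExpGrowth β F) (h' : ∀ s, |F' s| ≤ |F s|) : ExpGrowth β F' := by
  obtain ⟨C, c, hC, hc, hF⟩ := h
  exact ⟨C, c, hC, hc, fun s => (h' s).trans (hF s)⟩

theorem const (β a : ℝ) : ExpGrowth β fun _ => a :=
  ⟨|a|, 0, abs_nonneg a, le_rfl, fun s => by simp⟩

theorem mul (h : ExpGrowth β F) (h' : ExpGrowth β F') : ExpGrowth β fun s => F s * F' s := by
  obtain ⟨C, c, hC, hc, hF⟩ := h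
  obtain ⟨C', c', hC', hc', hF'⟩ := h'
  refine ⟨C * C', c + c', by positivity, by positivity, fun s => ?_⟩
  rw [abs_mul, add_mul, Real.exp_add]
  calc _ ≤ (C * Real.exp (c * |s| ^ β)) * (C' * Real.exp (c' * |s| ^ β)) := by
        gcongr
        · exact hF s
        · exact hF' s
    _ = _ := by ring

theorem add (h : ExpGrowth β F) (h' : ExpGrowth β F') : ExpGrowth β fun s => F s + F' s := by
  obtain ⟨C, c, hC, hc, hF⟩ := h
  obtain ⟨C', c', hC', hc', hF'⟩ := h'
  refine ⟨C + C', max c c', by positivity, le_max_of_le_left hc, fun s => ?_⟩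
  calc _ ≤ |F s| + |F' s| := abs_add_le _ _
    _ ≤ C * Real.exp (c * |s| ^ β) + C' * Real.exp (c' * |s| ^ β) := add_le_add (hF s) (hF' s)
    _ ≤ C * Real.exp (max c c' * |s| ^ β) + C' * Real.exp (max c c' * |s| ^ β) := by
        gcongr
        · exact le_max_left _ _
        · exact le_max_right _ _
    _ = _ := by ring

theorem exp (β : ℝ) : ExpGrowth β fun s => Real.exp (|s| ^ β) :=
  ⟨1, 1, zero_le_one, zero_le_one, fun s => by simp⟩

theorem rpow_abs (h : ExpGrowth β F) {r : ℝ} (hr : 0 ≤ r) : ExpGrowth β fun s => |F s| ^ r := by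
  obtain ⟨C, c, hC, hc, hF⟩ := h
  refine ⟨C ^ r, c * r, by positivity, by positivity, fun s => ?_⟩
  rw [abs_of_nonneg (by positivity)]
  calc |F s| ^ r ≤ (C * Real.exp (c * |s| ^ β)) ^ r := by gcongr; exact hF s
    _ = _ := by
      rw [Real.mul_rpow hC (Real.exp_pos _).le, ← Real.exp_mul]
      ring_nf

theorem comp_mul (h : ExpGrowth β F) (t : ℝ) : ExpGrowth β fun s => F (t * s) := by
  obtain ⟨C, c, hC, hc, hF⟩ := h
  refine ⟨C, c * |t| ^ β, hC, by positivity, fun s => (hF _).trans (le_of_eq ?_)⟩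
  rw [abs_mul, Real.mul_rpow (abs_nonneg t) (abs_nonneg s)]
  ring_nf

theorem id (hβ : 1 ≤ β) : ExpGrowth β fun s => s := by
  refine ⟨Real.exp 1, 1, (Real.exp_pos _).le, zero_le_one, fun s => ?_⟩
  rw [← Real.exp_add]
  have h1 : |s| ≤ 1 + |s| ^ β := by
    rcases le_total |s| 1 with h | h
    · have : 0 ≤ |s| ^ β := by positivity
      linarith
    · have := Real.rpow_le_rpow_of_exponent_le h hβ
      rw [Real.rpow_one] at this
      linarith
  have h2 := Real.add_one_le_exp (1 + 1 * |s| ^ β)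
  linarith

theorem abs_rpow (hβ : 1 ≤ β) {r : ℝ} (hr : 0 ≤ r) : ExpGrowth β fun s => |s| ^ r :=
  (id hβ).rpow_abs hr

end ExpGrowth

/-- A family of functions with uniform bounds for the integrals of `exp (c |v| ^ β)`, for every
`c`. -/
def UnifExp {α : Type*} [MeasurableSpace α] (μ : Measure α) (β : ℝ) {ι : Type*}
    (v : ι → α → ℝ) : Prop :=
  ∀ c : ℝ, 0 ≤ c → ∃ C : ℝ, ∀ k,
    ∫⁻ x, ENNReal.ofReal (Real.exp (c * |v k x| ^ β)) ∂μ ≤ ENNReal.ofReal C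

section Conv

variable {α : Type*} [MeasurableSpace α] {μ : Measure α} {β : ℝ}

theorem UnifExp.exists_lintegral_le {ι : Type*} {v : ι → α → ℝ} (hv : UnifExp μ β v) {F : ℝ → ℝ}
    (hF : ExpGrowth β F) : ∃ C : ℝ, ∀ k, ∫⁻ x, ‖F (v k x)‖ₑ ∂μ ≤ ENNReal.ofReal C := by
  obtain ⟨C, c, hC, hc, hF⟩ := hF
  obtain ⟨D, hD⟩ := hv c hc
  refine ⟨C * D, fun k => ?_⟩
  rw [ENNReal.ofReal_mul hC]
  calc _ ≤ ∫⁻ x, ENNReal.ofReal C * ENNReal.ofReal (Real.exp (c * |v k x| ^ β)) ∂μ := by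
        refine lintegral_mono fun x => ?_
        rw [← ENNReal.ofReal_mul hC, Real.enorm_eq_ofReal_abs]
        exact ENNReal.ofReal_le_ofReal (hF _)
    _ = ENNReal.ofReal C * ∫⁻ x, ENNReal.ofReal (Real.exp (c * |v k x| ^ β)) ∂μ :=
        lintegral_const_mul' _ _ ENNReal.ofReal_ne_top
    _ ≤ _ := by gcongr; exact hD k

theorem UnifExp.integrable {ι : Type*} {v : ι → α → ℝ} (hv : UnifExp μ β v) {F : ℝ → ℝ}
    (hF : ExpGrowth β F) (hFc : Continuous F) (k : ι) (hm : AEStronglyMeasurable (v k) μ) :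
    Integrable (fun x => F (v k x)) μ := by
  obtain ⟨C, hC⟩ := hv.exists_lintegral_le hF
  exact ⟨hFc.comp_aestronglyMeasurable hm, (hC k).trans_lt ENNReal.ofReal_lt_top⟩

theorem UnifExp.of_tendsto {v : ℕ → α → ℝ} {w : α → ℝ} (hβ : 0 ≤ β) (hv : UnifExp μ β v)
    (hm : ∀ k, AEStronglyMeasurable (v k) μ)
    (hlim : ∀ᵐ x ∂μ, Filter.Tendsto (fun k => v k x) Filter.atTop (nhds (w x))) :
    UnifExp μ β fun _ : Unit => w := by
  intro c hc
  obtain ⟨C, hC⟩ := hv c hc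
  exact ⟨C, fun _ => lintegral_exp_le_of_tendsto_ae hβ hm hlim (Filter.Eventually.of_forall hC)⟩

/-- Convergence almost everywhere and uniform exponential bounds imply convergence of `F ∘ v k` in
every `L^r`, for continuous `F` of exponential growth. -/
theorem UnifExp.tendsto_lintegral_rpow [IsFiniteMeasure μ] {v : ℕ → α → ℝ} {w : α → ℝ}
    (hβ : 0 ≤ β) (hv : UnifExp μ β v) (hm : ∀ k, AEStronglyMeasurable (v k) μ)
    (hlim : ∀ᵐ x ∂μ, Filter.Tendsto (fun k => v k x) Filter.atTop (nhds (w x)))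
    {F : ℝ → ℝ} (hF : ExpGrowth β F) (hFc : Continuous F) {r : ℝ} (hr : 0 < r) :
    Filter.Tendsto (fun k => ∫⁻ x, ‖F (v k x) - F (w x)‖ₑ ^ r ∂μ) Filter.atTop (nhds 0) := by
  have hwm : AEStronglyMeasurable w μ := aestronglyMeasurable_of_tendsto_ae _ hm hlim
  have hw := hv.of_tendsto hβ hm hlim
  have hF2 : ExpGrowth β fun s => |F s| ^ (2 * r) := hF.rpow_abs (by positivity)
  obtain ⟨C₁, hC₁⟩ := hv.exists_lintegral_le hF2
  obtain ⟨C₂, hC₂⟩ := hw.exists_lintegral_le hF2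
  have hdm : ∀ k, AEStronglyMeasurable (fun x => F (v k x) - F (w x)) μ := fun k =>
    (hFc.comp_aestronglyMeasurable (hm k)).sub (hFc.comp_aestronglyMeasurable hwm)
  have hrc : Continuous fun y : ℝ => |y| ^ r := continuous_abs.rpow_const fun _ => Or.inr hr.le
  have key := tendsto_lintegral_enorm_of_sq_bounded (μ := μ)
    (f := fun k x => |F (v k x) - F (w x)| ^ r)
    (fun k => hrc.comp_aestronglyMeasurable (hdm k)) (by
      filter_upwards [hlim] with x hx
      have h1 : Filter.Tendsto (fun k => F (v k x) - F (w x)) Filter.atTop (nhds 0) := by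
        have := ((hFc.tendsto _).comp hx).sub_const (F (w x))
        simpa using this
      have h2 := (hrc.tendsto 0).comp h1
      simpa [Function.comp_def, Real.zero_rpow hr.ne'] using h2)
    (C := 2 ^ (2 * r) * (max C₁ 0 + max C₂ 0)) (fun k => by
      calc _ ≤ ∫⁻ x, ENNReal.ofReal (2 ^ (2 * r)) * (‖|F (v k x)| ^ (2 * r)‖ₑ +
              ‖|F (w x)| ^ (2 * r)‖ₑ) ∂μ := by
            refine lintegral_mono fun x => ?_
            rw [Real.enorm_of_nonneg (by positivity), Real.enorm_of_nonneg (by positivity),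
              Real.enorm_of_nonneg (by positivity), ← ENNReal.ofReal_add (by positivity)
              (by positivity), ← ENNReal.ofReal_mul (by positivity)]
            apply ENNReal.ofReal_le_ofReal
            rw [← Real.rpow_natCast, ← Real.rpow_mul (abs_nonneg _), mul_comm r]
            have h1 : |F (v k x) - F (w x)| ≤ 2 * max |F (v k x)| |F (w x)| := by
              have := abs_sub (F (v k x)) (F (w x))
              have := le_max_left |F (v k x)| |F (w x)|
              have := le_max_right |F (v k x)| |F (w x)|
              linarith
            have h2 : (0 : ℝ) ≤ max |F (v k x)| |F (w x)| := le_max_of_le_left (abs_nonneg _)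
            calc |F (v k x) - F (w x)| ^ ((2 : ℕ) * r)
                ≤ (2 * max |F (v k x)| |F (w x)|) ^ (2 * r) := by
                  push_cast
                  gcongr
              _ = 2 ^ (2 * r) * (max |F (v k x)| |F (w x)|) ^ (2 * r) :=
                  Real.mul_rpow (by norm_num) h2
              _ ≤ _ := by
                  gcongr
                  rcases max_choice |F (v k x)| |F (w x)| with h | h <;> rw [h]
                  · exact le_add_of_nonneg_right (by positivity)
                  · exact le_add_of_nonneg_left (by positivity)
        _ = ENNReal.ofReal (2 ^ (2 * r)) * (∫⁻ x, ‖|F (v k x)| ^ (2 * r)‖ₑ ∂μ +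
              ∫⁻ x, ‖|F (w x)| ^ (2 * r)‖ₑ ∂μ) := by
            rw [lintegral_const_mul' _ _ ENNReal.ofReal_ne_top, lintegral_add_left']
            have hc : Continuous fun s => |F s| ^ (2 * r) :=
              hFc.abs.rpow_const fun _ => Or.inr (by positivity)
            exact (hc.comp_aestronglyMeasurable (hm k)).enorm
        _ ≤ _ := by
            rw [ENNReal.ofReal_mul (by positivity),
              ENNReal.ofReal_add (le_max_right _ _) (le_max_right _ _)]
            gcongr
            · exact (hC₁ k).trans (ENNReal.ofReal_le_ofReal (le_max_left _ _))
            · exact (hC₂ ()).trans (ENNReal.ofReal_le_ofReal (le_max_left _ _)))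
  refine key.congr fun k => lintegral_congr fun x => ?_
  rw [enorm_abs_rpow hr.le]

theorem UnifExp.tendsto_integral [IsFiniteMeasure μ] {v : ℕ → α → ℝ} {w : α → ℝ}
    (hβ : 0 ≤ β) (hv : UnifExp μ β v) (hm : ∀ k, AEStronglyMeasurable (v k) μ)
    (hlim : ∀ᵐ x ∂μ, Filter.Tendsto (fun k => v k x) Filter.atTop (nhds (w x)))
    {F : ℝ → ℝ} (hF : ExpGrowth β F) (hFc : Continuous F) :
    Filter.Tendsto (fun k => ∫ x, F (v k x) ∂μ) Filter.atTop (nhds (∫ x, F (w x) ∂μ)) := by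
  have hwm : AEStronglyMeasurable w μ := aestronglyMeasurable_of_tendsto_ae _ hm hlim
  refine tendsto_integral_of_L1 _
    ((hv.of_tendsto hβ hm hlim).integrable hF hFc () hwm).aestronglyMeasurable
    (Filter.Eventually.of_forall fun k => hv.integrable hF hFc k (hm k)) ?_
  simpa using hv.tendsto_lintegral_rpow hβ hm hlim hF hFc one_pos

/-- Convergence of integrals against a weight `h ∈ L^γ`, by Hölder's inequality. -/
theorem UnifExp.tendsto_integral_mul [IsFiniteMeasure μ] {v : ℕ → α → ℝ} {w : α → ℝ}
    (hβ : 0 ≤ β) (hv : UnifExp μ β v) (hm : ∀ k, AEStronglyMeasurable (v k) μ)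
    (hlim : ∀ᵐ x ∂μ, Filter.Tendsto (fun k => v k x) Filter.atTop (nhds (w x)))
    {F : ℝ → ℝ} (hF : ExpGrowth β F) (hFc : Continuous F) {γ r : ℝ} (hγr : γ.HolderConjugate r)
    {h : α → ℝ} (hh : MemLp h (ENNReal.ofReal γ) μ) :
    Filter.Tendsto (fun k => ∫ x, h x * F (v k x) ∂μ) Filter.atTop
      (nhds (∫ x, h x * F (w x) ∂μ)) := by
  have hwm : AEStronglyMeasurable w μ := aestronglyMeasurable_of_tendsto_ae _ hm hlim
  have hw := hv.of_tendsto hβ hm hlim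
  have hγ : ∫⁻ x, ‖h x‖ₑ ^ γ ∂μ ≠ ⊤ := by
    have := lintegral_rpow_enorm_lt_top_of_eLpNorm_lt_top (f := h) (p := ENNReal.ofReal γ)
      (ENNReal.ofReal_pos.2 hγr.pos).ne' ENNReal.ofReal_ne_top hh.2
    rw [ENNReal.toReal_ofReal hγr.nonneg] at this
    exact this.ne
  have hHol : ∀ f : α → ℝ, AEStronglyMeasurable f μ → ∫⁻ x, ‖h x * f x‖ₑ ∂μ ≤
      (∫⁻ x, ‖h x‖ₑ ^ γ ∂μ) ^ (1 / γ) * (∫⁻ x, ‖f x‖ₑ ^ r ∂μ) ^ (1 / r) := by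
    intro f hf
    simp only [enorm_mul]
    exact ENNReal.lintegral_mul_le_Lp_mul_Lq μ hγr hh.1.enorm hf.enorm
  have hint : ∀ z : α → ℝ, AEStronglyMeasurable z μ → (UnifExp μ β fun _ : Unit => z) →
      Integrable (fun x => h x * F (z x)) μ := by
    intro z hz hzu
    have hFz := hFc.comp_aestronglyMeasurable hz
    refine ⟨hh.1.mul hFz, (hHol _ hFz).trans_lt ?_⟩
    obtain ⟨C, hC⟩ := hzu.exists_lintegral_le (hF.rpow_abs hγr.symm.nonneg)
    have : ∫⁻ x, ‖F (z x)‖ₑ ^ r ∂μ ≤ ENNReal.ofReal C := by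
      refine le_trans (le_of_eq (lintegral_congr fun x => ?_)) (hC ())
      rw [enorm_abs_rpow hγr.symm.nonneg]
    refine ENNReal.mul_lt_top ?_ ?_
    · exact ENNReal.rpow_lt_top_of_nonneg (by have := hγr.pos; positivity) hγ
    · exact ENNReal.rpow_lt_top_of_nonneg (by have := hγr.symm.pos; positivity)
        (ne_top_of_le_ne_top ENNReal.ofReal_ne_top this)
  have hvk : ∀ k, UnifExp μ β fun _ : Unit => v k := fun k c hc => by
    obtain ⟨C, hC⟩ := hv c hc
    exact ⟨C, fun _ => hC k⟩
  refine tendsto_integral_of_L1 _ (hint w hwm hw).aestronglyMeasurable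
    (Filter.Eventually.of_forall fun k => hint _ (hm k) (hvk k)) ?_
  have hr := hγr.symm.pos
  have h1 := hv.tendsto_lintegral_rpow hβ hm hlim hF hFc hr
  have h2 : Filter.Tendsto (fun k => (∫⁻ x, ‖h x‖ₑ ^ γ ∂μ) ^ (1 / γ) *
      (∫⁻ x, ‖F (v k x) - F (w x)‖ₑ ^ r ∂μ) ^ (1 / r)) Filter.atTop (nhds 0) := by
    have h3 := (ENNReal.continuous_rpow_const (y := 1 / r)).tendsto 0 |>.comp h1
    rw [ENNReal.zero_rpow_of_pos (by positivity)] at h3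
    have h4 := ENNReal.Tendsto.const_mul h3 (a := (∫⁻ x, ‖h x‖ₑ ^ γ ∂μ) ^ (1 / γ))
      (Or.inr (ENNReal.rpow_ne_top_of_nonneg (by have := hγr.pos; positivity) hγ))
    rw [mul_zero] at h4
    exact h4
  refine tendsto_of_tendsto_of_tendsto_of_le_of_le tendsto_const_nhds h2 (fun _ => zero_le)
    fun k => ?_
  simp only [← mul_sub]
  exact hHol (fun x => F (v k x) - F (w x))
    ((hFc.comp_aestronglyMeasurable (hm k)).sub (hFc.comp_aestronglyMeasurable hwm))

end Conv

section Space

variable {n : ℕ} [hn : Fact (2 ≤ n)] {Ω : Set (Eucl n)}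

theorem unifExp_of_gradNorm_le (hΩ : Bornology.IsBounded Ω) {β : ℝ} (hβ0 : 0 < β)
    (hβ : β < (n : ℝ) / (n - 1)) {ι : Type*} {u : ι → W0 Ω} {K : ℝ}
    (hu : ∀ k, gradNorm (u k) ≤ K) :
    UnifExp (volume.restrict Ω) β fun k => fn (u k) := by
  intro c hc
  obtain ⟨C, hC⟩ := exists_lintegral_exp_fn_le (Ω := Ω) hΩ hβ0 hβ hc K
  exact ⟨C, fun k => hC _ (hu k)⟩

/-- Bounded sequences in `W₀^{1,n}(Ω)` have subsequences converging almost everywhere. -/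
theorem exists_subseq_tendsto_ae_fn (hΩ : Bornology.IsBounded Ω) {u : ℕ → W0 Ω} {K : ℝ}
    (hu : ∀ k, gradNorm (u k) ≤ K) :
    ∃ (σ : ℕ → ℕ) (f : Eucl n → ℝ), StrictMono σ ∧
      ∀ᵐ x ∂(volume.restrict Ω),
        Filter.Tendsto (fun k => fn (u (σ k)) x) Filter.atTop (nhds (f x)) := by
  have hn1 : (1 : ℝ) < n := by
    have : (2 : ℝ) ≤ n := by exact_mod_cast hn.out
    linarith
  choose φ hφ h1 h2 using fun k : ℕ => exists_test_near (u k) (ε := 1 / ((k : ℝ) + 1))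
    (by positivity)
  have hK : ∀ k, gradNorm (ofTest (hφ k)) ≤ |K| + 1 := by
    intro k
    have h3 := abs_le.1 (abs_gradNorm_sub_le (u k) (ofTest (hφ k)))
    have h5 : 1 / ((k : ℝ) + 1) ≤ 1 := by
      rw [div_le_one (by positivity)]
      have : (0 : ℝ) ≤ k := Nat.cast_nonneg _
      linarith
    linarith [le_abs_self K, h2 k, hu k]
  -- The Rellich–Kondrachov theorem applies to test functions `φ k` that differ from `u k` by a null
  -- sequence in `Lⁿ`.
  obtain ⟨C, hC⟩ := (unifExp_of_gradNorm_le hΩ one_pos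
    (by rw [lt_div_iff₀ (by linarith)]; linarith) hK).exists_lintegral_le (ExpGrowth.id le_rfl)
  have hφ1 : ∀ k, ∫⁻ x, ‖φ k x‖ₑ ≤ ENNReal.ofReal C := by
    intro k
    rw [← setLIntegral_eq_of_support_subset (s := Ω)]
    · refine le_trans (le_of_eq (lintegral_congr_ae ?_)) (hC k)
      filter_upwards [fn_ofTest (hφ k)] with x hx
      rw [hx]
    · intro x hx
      apply (hφ k).tsupport_subset
      apply subset_tsupport
      simpa using hx
  set V := volume.real Ω with hV
  have hΩtop : volume Ω ≠ ⊤ := hΩ.measure_lt_top.ne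
  have hφ2 : ∀ k, ∫⁻ x, ‖fderiv ℝ (φ k) x‖ₑ ≤ ENNReal.ofReal (V + (|K| + 1) ^ (n : ℝ)) := by
    intro k
    have e1 : Function.support (fun x => ‖fderiv ℝ (φ k) x‖ₑ) ⊆ Ω := by
      intro x hx
      apply (hφ k).tsupport_subset
      apply tsupport_fderiv_subset ℝ
      apply subset_tsupport
      rw [Function.mem_support] at hx ⊢
      intro h
      apply hx
      rw [h]
      exact enorm_zero (E := Eucl n →L[ℝ] ℝ)
    rw [← setLIntegral_eq_of_support_subset e1]
    calc _ ≤ ∫⁻ x in Ω, (1 + ‖fderiv ℝ (φ k) x‖ₑ ^ (n : ℝ)) := by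
          refine lintegral_mono fun x => ?_
          rcases le_total ‖fderiv ℝ (φ k) x‖ₑ 1 with h | h
          · exact h.trans le_self_add
          · exact (ENNReal.le_rpow_self_of_one_le h hn1.le).trans le_add_self
      _ = volume Ω + ∫⁻ x in Ω, ‖fderiv ℝ (φ k) x‖ₑ ^ (n : ℝ) := by
          rw [lintegral_add_left measurable_const]
          simp
      _ ≤ _ := by
          rw [ENNReal.ofReal_add measureReal_nonneg (by positivity), ofReal_measureReal hΩtop]
          gcongr
          exact (setLIntegral_le_lintegral _ _).trans (lintegral_fderiv_le (hφ k) (hK k))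
  set R := max C (V + (|K| + 1) ^ (n : ℝ)) with hR
  have hmem : ∀ k, MemLp (φ k) 1 volume := fun k =>
    (hφ k).contDiff.continuous.memLp_of_hasCompactSupport (hφ k).hasCompactSupport
  have htb := (totallyBounded_of_lintegral_fderiv_le hΩ R).closure
  have hcpt := htb.isCompact_of_isClosed isClosed_closure
  obtain ⟨f, -, σ₁, hσ₁, hf⟩ := hcpt.tendsto_subseq (x := fun k => (hmem k).toLp (φ k))
    (fun k => subset_closure ⟨φ k, (hφ k).contDiff_one, (hφ k).hasCompactSupport,
      (hφ k).tsupport_subset, (hφ1 k).trans (ENNReal.ofReal_le_ofReal (le_max_left _ _)),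
      (hφ2 k).trans (ENNReal.ofReal_le_ofReal (le_max_right _ _)), MemLp.coeFn_toLp _⟩)
  obtain ⟨σ₂, hσ₂, hf2⟩ := exists_subseq_tendsto_ae hf
  have hdiff : Filter.Tendsto
      (fun k => (u (σ₁ (σ₂ k))).1.1 - (ofTest (hφ (σ₁ (σ₂ k)))).1.1) Filter.atTop (nhds 0) := by
    rw [tendsto_zero_iff_norm_tendsto_zero]
    refine squeeze_zero (fun _ => norm_nonneg _) (fun k => (h1 _).le) ?_
    exact tendsto_one_div_add_atTop_nhds_zero_nat.comp (hσ₁.comp hσ₂).tendsto_atTop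
  obtain ⟨σ₃, hσ₃, hf3⟩ := exists_subseq_tendsto_ae hdiff
  refine ⟨σ₁ ∘ σ₂ ∘ σ₃, f, hσ₁.comp (hσ₂.comp hσ₃), ?_⟩
  have e1 : ∀ᵐ x ∂(volume.restrict Ω), ∀ k, (hmem k).toLp (φ k) x = φ k x :=
    ae_all_iff.2 fun k => ae_restrict_of_ae (MemLp.coeFn_toLp (hmem k))
  have e2 : ∀ᵐ x ∂(volume.restrict Ω), ∀ k, fn (ofTest (hφ k)) x = φ k x :=
    ae_all_iff.2 fun k => fn_ofTest (hφ k)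
  have e3 : ∀ᵐ x ∂(volume.restrict Ω), ∀ k,
      ((u k).1.1 - (ofTest (hφ k)).1.1) x = fn (u k) x - fn (ofTest (hφ k)) x :=
    ae_all_iff.2 fun k => Lp.coeFn_sub _ _
  filter_upwards [e1, e2, e3, ae_restrict_of_ae hf2, hf3, Lp.coeFn_zero ℝ (n : ℝ≥0∞)
    (volume.restrict Ω)] with x a1 a2 a3 a4 a5 a6
  rw [a6, Pi.zero_apply] at a5
  have a7 := a5.add (a4.comp hσ₃.tendsto_atTop)
  rw [zero_add] at a7
  refine a7.congr fun k => ?_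
  simp only [Function.comp_apply, a3, a2, a1]
  ring

/-- Weak compactness of bounded sequences in `W₀^{1,n}(Ω)`, stated through convergence almost
everywhere and the weak lower semicontinuity of the norm. -/
theorem exists_subseq_weakLimit (hΩ : Bornology.IsBounded Ω) {u : ℕ → W0 Ω} {K : ℝ}
    (hu : ∀ k, gradNorm (u k) ≤ K) :
    ∃ (σ : ℕ → ℕ) (w : W0 Ω) (ℓ : ℝ), StrictMono σ ∧
      (∀ᵐ x ∂(volume.restrict Ω),
        Filter.Tendsto (fun k => fn (u (σ k)) x) Filter.atTop (nhds (fn w x))) ∧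
      Filter.Tendsto (fun k => gradNorm (u (σ k))) Filter.atTop (nhds ℓ) ∧ gradNorm w ≤ ℓ := by
  have hn1 : (1 : ℝ) < n := by
    have : (2 : ℝ) ≤ n := by exact_mod_cast hn.out
    linarith
  have hn0 : (0 : ℝ) < n := by linarith
  have : IsFiniteMeasure (volume.restrict Ω) := ⟨by simpa using hΩ.measure_lt_top⟩
  obtain ⟨σ₁, f, hσ₁, hf⟩ := exists_subseq_tendsto_ae_fn hΩ hu
  obtain ⟨ℓ, -, σ₂, hσ₂, hℓ⟩ := (isCompact_Icc (a := (0 : ℝ)) (b := K)).tendsto_subseq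
    (x := fun k => gradNorm (u (σ₁ k))) (fun k => ⟨gradNorm_nonneg _, hu _⟩)
  set v : ℕ → W0 Ω := fun k => u (σ₁ (σ₂ k)) with hv
  have hvf : ∀ᵐ x ∂(volume.restrict Ω),
      Filter.Tendsto (fun k => fn (v k) x) Filter.atTop (nhds (f x)) := by
    filter_upwards [hf] with x hx
    exact hx.comp hσ₂.tendsto_atTop
  have hue : UnifExp (volume.restrict Ω) 1 fun k => fn (v k) :=
    unifExp_of_gradNorm_le hΩ one_pos (by rw [lt_div_iff₀ (by linarith)]; linarith)
      (K := K) fun k => hu _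
  have hvm : ∀ k, AEStronglyMeasurable (fn (v k)) (volume.restrict Ω) := fun k =>
    fn_aestronglyMeasurable _
  have hfm : AEStronglyMeasurable f (volume.restrict Ω) :=
    aestronglyMeasurable_of_tendsto_ae _ hvm hvf
  have hLn := hue.tendsto_lintegral_rpow zero_le_one hvm hvf (ExpGrowth.id le_rfl)
    continuous_id hn0
  have hn0' : (n : ℝ≥0∞) ≠ 0 := dim_cast_ne_zero
  have hfL : MemLp f n (volume.restrict Ω) := by
    refine ⟨hfm, ?_⟩
    rw [eLpNorm_lt_top_iff_lintegral_rpow_enorm_lt_top hn0' (ENNReal.natCast_ne_top n)]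
    obtain ⟨C, hC⟩ := (hue.of_tendsto zero_le_one hvm hvf).exists_lintegral_le
      (ExpGrowth.abs_rpow le_rfl hn0.le)
    refine lt_of_le_of_lt (le_trans (le_of_eq (lintegral_congr fun x => ?_)) (hC ()))
      ENNReal.ofReal_lt_top
    rw [enorm_abs_rpow hn0.le, ENNReal.toReal_natCast]
  set U : Lp ℝ (n : ℝ≥0∞) (volume.restrict Ω) := hfL.toLp f with hU
  have hlim : Filter.Tendsto (fun k => (v k).1.1) Filter.atTop (nhds U) := by
    rw [tendsto_iff_norm_sub_tendsto_zero]
    have e1 : ∀ k, ‖(v k).1.1 - U‖ = ((∫⁻ x in Ω, ‖fn (v k) x - f x‖ₑ ^ (n : ℝ)) ^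
        (1 / (n : ℝ))).toReal := by
      intro k
      rw [Lp.norm_def, eLpNorm_eq_lintegral_rpow_enorm_toReal hn0' (ENNReal.natCast_ne_top n)]
      congr 2
      refine lintegral_congr_ae ?_
      filter_upwards [Lp.coeFn_sub (v k).1.1 U, MemLp.coeFn_toLp hfL] with x h1 h2
      rw [h1, Pi.sub_apply, h2, ENNReal.toReal_natCast]
      rfl
    simp only [e1]
    have h3 := (ENNReal.continuous_rpow_const (y := 1 / (n : ℝ))).tendsto 0 |>.comp hLn
    rw [ENNReal.zero_rpow_of_pos (by positivity)] at h3
    exact (ENNReal.tendsto_toReal ENNReal.zero_ne_top).comp h3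
  obtain ⟨w, hw1, hw2⟩ := exists_mem_W0_of_approx (Ω := Ω) U (ℓ := ℓ) (by
    intro ε hε
    rw [tendsto_iff_norm_sub_tendsto_zero] at hlim
    have h1 := hlim.eventually_le_const hε
    have h2 : ∀ᶠ k in Filter.atTop, gradNorm (v k) ≤ ℓ + ε :=
      hℓ.eventually_le_const (show ℓ < ℓ + ε by linarith)
    obtain ⟨k, hk1, hk2⟩ := (h1.and h2).exists
    exact ⟨v k, hk1, hk2⟩)
  refine ⟨σ₁ ∘ σ₂, w, ℓ, hσ₁.comp hσ₂, ?_, hℓ, hw2⟩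
  filter_upwards [hvf, MemLp.coeFn_toLp hfL] with x h1 h2
  have : fn w x = f x := by rw [fn, hw1]; exact h2
  rw [this]
  exact h1

end Space

/-! ### The nonlinearity and its primitive -/

theorem M_eq (a b t : ℝ) : M a b t = a * t ^ 2 / 2 + b * t := by
  have h : ∀ s ∈ Set.uIcc 0 t, HasDerivAt (fun s => a * s ^ 2 / 2 + b * s) (m a b s) s := by
    intro s _
    have h1 := (((hasDerivAt_pow 2 s).const_mul a).div_const 2).add
      ((hasDerivAt_id s).const_mul b)
    refine h1.congr_deriv ?_
    simp only [m]
    push_cast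
    ring
  have hc : Continuous (m a b) := by unfold m; fun_prop
  rw [M, intervalIntegral.integral_eq_sub_of_hasDerivAt h (hc.intervalIntegrable _ _)]
  ring

theorem nonneg_of_mul_deriv_nonneg {F F' : ℝ → ℝ} (hF : ∀ t, HasDerivAt F (F' t) t)
    (h0 : F 0 = 0) (h : ∀ t, 0 ≤ t * F' t) (t : ℝ) : 0 ≤ F t := by
  have hc : Continuous F := continuous_iff_continuousAt.2 fun t => (hF t).continuousAt
  rcases lt_trichotomy t 0 with ht | rfl | ht
  · obtain ⟨c, hc1, hc2⟩ := exists_hasDerivAt_eq_slope F F' ht hc.continuousOn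
      fun x _ => hF x
    rw [eq_div_iff (by linarith)] at hc2
    have := h c
    nlinarith [hc1.2]
  · exact h0.ge
  · obtain ⟨c, hc1, hc2⟩ := exists_hasDerivAt_eq_slope F F' ht hc.continuousOn
      fun x _ => hF x
    rw [eq_div_iff (by linarith)] at hc2
    have := h c
    nlinarith [hc1.1]

section Nonlinearity

variable {p β : ℝ}

theorem abs_rpow_sub_two_mul {r : ℝ} (hr : r ≠ 0) (s : ℝ) :
    |s| ^ (r - 2) * s * s = |s| ^ r := by
  rcases eq_or_ne s 0 with rfl | hs
  · simp [Real.zero_rpow hr]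
  · have hs' : 0 < |s| := abs_pos.2 hs
    rw [mul_assoc, ← abs_mul_abs_self s, Real.rpow_sub hs']
    have : |s| ^ (2 : ℝ) = |s| * |s| := by rw [Real.rpow_two, sq]
    rw [this]
    field_simp

theorem abs_rpow_add_two {r : ℝ} (hr : 0 < r) (s : ℝ) : |s| ^ (r + 2) = |s| ^ r * s ^ 2 := by
  rw [Real.rpow_add' (abs_nonneg s) (by linarith), Real.rpow_two, sq_abs]

theorem hasDerivAt_g (hp : 1 < p) (hβ : 1 < β) (s : ℝ) :
    HasDerivAt (g p β) ((p + 1 + β * |s| ^ β) * |s| ^ p * Real.exp (|s| ^ β)) s := by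
  have h := ((hasDerivAt_id s).mul (hasDerivAt_abs_rpow s hp)).mul (hasDerivAt_abs_rpow s hβ).exp
  refine h.congr_deriv ?_
  have h1 := abs_rpow_sub_two_mul (r := p) (by linarith) s
  have h2 := abs_rpow_sub_two_mul (r := β) (by linarith) s
  simp only [id, Pi.mul_apply]
  linear_combination (p * Real.exp (|s| ^ β)) * h1 + (β * |s| ^ p * Real.exp (|s| ^ β)) * h2

theorem deriv_g (hp : 1 < p) (hβ : 1 < β) (s : ℝ) :
    deriv (g p β) s = (p + 1 + β * |s| ^ β) * |s| ^ p * Real.exp (|s| ^ β) :=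
  (hasDerivAt_g hp hβ s).deriv

theorem continuous_abs_rpow {r : ℝ} (hr : 0 ≤ r) : Continuous fun s : ℝ => |s| ^ r :=
  continuous_abs.rpow_const fun _ => Or.inr hr

theorem continuous_g (hp : 0 ≤ p) (hβ : 0 ≤ β) : Continuous (g p β) := by
  have h1 := continuous_abs_rpow hp
  have h2 := continuous_abs_rpow hβ
  unfold g
  fun_prop

theorem continuous_deriv_g (hp : 1 < p) (hβ : 1 < β) : Continuous (deriv (g p β)) := by
  have h1 := continuous_abs_rpow (show 0 ≤ p by linarith)
  have h2 := continuous_abs_rpow (show 0 ≤ β by linarith)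
  rw [funext (deriv_g hp hβ)]
  fun_prop

theorem hasDerivAt_G (hp : 0 ≤ p) (hβ : 0 ≤ β) (t : ℝ) : HasDerivAt (G p β) (g p β t) t :=
  intervalIntegral.integral_hasDerivAt_right ((continuous_g hp hβ).intervalIntegrable _ _)
    ((continuous_g hp hβ).stronglyMeasurableAtFilter _ _) (continuous_g hp hβ).continuousAt

theorem continuous_G (hp : 0 ≤ p) (hβ : 0 ≤ β) : Continuous (G p β) :=
  continuous_iff_continuousAt.2 fun t => (hasDerivAt_G hp hβ t).continuousAt

theorem g_mul_self (hp : 0 < p) (s : ℝ) : g p β s * s = |s| ^ (p + 2) * Real.exp (|s| ^ β) := by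
  rw [abs_rpow_add_two hp, g]; ring

theorem g_mul_self_nonneg (s : ℝ) : 0 ≤ g p β s * s := by
  have : g p β s * s = s ^ 2 * |s| ^ p * Real.exp (|s| ^ β) := by rw [g]; ring
  rw [this]
  positivity

theorem G_nonneg (hp : 0 ≤ p) (hβ : 0 ≤ β) (t : ℝ) : 0 ≤ G p β t :=
  nonneg_of_mul_deriv_nonneg (hasDerivAt_G hp hβ) (by simp [G])
    (fun t => by rw [mul_comm]; exact g_mul_self_nonneg t) t

theorem mul_G_le (hp : 1 < p) (hβ : 1 < β) (t : ℝ) : (p + 2) * G p β t ≤ g p β t * t := by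
  have h : 0 ≤ g p β t * t - (p + 2) * G p β t := by
    refine nonneg_of_mul_deriv_nonneg (F := fun t => g p β t * t - (p + 2) * G p β t)
      (fun t => ((hasDerivAt_g hp hβ t).mul (hasDerivAt_id t)).sub
        ((hasDerivAt_G (by linarith) (by linarith) t).const_mul (p + 2))) (by simp [G]) ?_ t
    intro t
    have h1 : t * ((p + 1 + β * |t| ^ β) * |t| ^ p * Real.exp (|t| ^ β) * id t + g p β t * 1 -
        (p + 2) * g p β t) = β * |t| ^ β * |t| ^ p * Real.exp (|t| ^ β) * t ^ 2 := by
      simp only [g, id]; ring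
    rw [h1]
    have : 0 ≤ β := by linarith
    positivity
  linarith

theorem expGrowth_g (hp : 0 ≤ p) (hβ : 1 ≤ β) : ExpGrowth β (g p β) :=
  ((ExpGrowth.id hβ).mul (ExpGrowth.abs_rpow hβ hp)).mul (ExpGrowth.exp β)

theorem expGrowth_deriv_g (hp : 1 < p) (hβ : 1 < β) : ExpGrowth β (deriv (g p β)) := by
  rw [funext (deriv_g hp hβ)]
  exact (((ExpGrowth.const β (p + 1)).add ((ExpGrowth.const β β).mul
    (ExpGrowth.abs_rpow hβ.le (by linarith)))).mul (ExpGrowth.abs_rpow hβ.le (by linarith))).mul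
      (ExpGrowth.exp β)

theorem expGrowth_G (hp : 1 < p) (hβ : 1 < β) : ExpGrowth β (G p β) := by
  refine ((expGrowth_g (p := p) (by linarith) hβ.le).mul (ExpGrowth.id hβ.le)).mono
    (F' := G p β) fun s => ?_
  have h1 := G_nonneg (p := p) (β := β) (by linarith) (by linarith) s
  rw [abs_of_nonneg h1, abs_of_nonneg (g_mul_self_nonneg s)]
  have := mul_G_le hp hβ s
  nlinarith

end Nonlinearity

/-- Differentiation of `t ↦ ∫ F (t v) v ^ j` under the integral sign, for `F'` of exponential
growth. -/
theorem hasDerivAt_integral_comp_mul {α : Type*} [MeasurableSpace α] {μ : Measure α} {β : ℝ}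
    (hβ : 1 ≤ β) {v : α → ℝ} (hv : UnifExp μ β fun _ : Unit => v)
    (hm : AEStronglyMeasurable v μ) {F F' : ℝ → ℝ} (hF : ∀ s, HasDerivAt F (F' s) s)
    (hF'c : Continuous F') (hFg : ExpGrowth β F) (hF'g : ExpGrowth β F') (j : ℕ) (t : ℝ) :
    HasDerivAt (fun t => ∫ x, F (t * v x) * v x ^ j ∂μ) (∫ x, F' (t * v x) * v x ^ (j + 1) ∂μ)
      t := by
  have hFc : Continuous F := continuous_iff_continuousAt.2 fun t => (hF t).continuousAt
  obtain ⟨C, c, hC, hc, hCc⟩ := hF'g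
  -- `T` bounds the unit ball around `t`, which yields the dominating function.
  set T : ℝ := |t| + 1 with hT
  have hT0 : 0 ≤ T := by positivity
  have hpow : ∀ k : ℕ, ExpGrowth β fun s => s ^ k := by
    intro k
    induction k with
    | zero => simpa using ExpGrowth.const β 1
    | succ k ih => simpa [pow_succ] using ih.mul (ExpGrowth.id hβ)
  have hFj : ∀ t : ℝ, Integrable (fun x => F (t * v x) * v x ^ j) μ := fun t =>
    hv.integrable (F := fun s => F (t * s) * s ^ j) ((hFg.comp_mul t).mul (hpow j)) (by fun_prop)
      () hm
  have hbg : ExpGrowth β fun s => C * Real.exp (c * T ^ β * |s| ^ β) * |s ^ (j + 1)| :=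
    ExpGrowth.mul ⟨C, c * T ^ β, hC, by positivity, fun s => by
      rw [abs_of_nonneg (by positivity)]⟩ ((hpow (j + 1)).mono fun s => (abs_abs _).le)
  have hbc : Continuous fun s : ℝ => C * Real.exp (c * T ^ β * |s| ^ β) * |s ^ (j + 1)| := by
    have := continuous_abs_rpow (show 0 ≤ β by linarith)
    fun_prop
  refine (hasDerivAt_integral_of_dominated_loc_of_deriv_le (s := Metric.ball t 1)
    (bound := fun x => C * Real.exp (c * T ^ β * |v x| ^ β) * |v x ^ (j + 1)|)
    (F' := fun t x => F' (t * v x) * v x ^ (j + 1))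
    (Metric.ball_mem_nhds t one_pos) (Filter.Eventually.of_forall fun t =>
      (hFj t).aestronglyMeasurable) (hFj t) ?_ ?_ (hv.integrable hbg hbc () hm) ?_).2
  · have h1 : Continuous fun s => F' (t * s) * s ^ (j + 1) := by fun_prop
    exact h1.comp_aestronglyMeasurable hm
  · refine Filter.Eventually.of_forall fun x s hs => ?_
    rw [norm_mul, Real.norm_eq_abs, Real.norm_eq_abs]
    refine mul_le_mul_of_nonneg_right ((hCc _).trans ?_) (abs_nonneg _)
    have hsT : |s| ≤ T := by
      rw [Metric.mem_ball, Real.dist_eq] at hs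
      have := abs_sub_abs_le_abs_sub s t
      rw [hT]; linarith
    rw [mul_assoc, abs_mul, ← Real.mul_rpow hT0 (abs_nonneg _)]
    gcongr
  · refine Filter.Eventually.of_forall fun x s _ => ?_
    have h1 : HasDerivAt (fun s : ℝ => s * v x) (v x) s := by
      simpa using (hasDerivAt_id s).mul_const (v x)
    have h2 := ((hF (s * v x)).comp s h1).mul_const (v x ^ j)
    refine h2.congr_deriv ?_
    rw [pow_succ]; ring

/-! ### The energy and its fibering maps -/

/-- The standing assumptions on the data of the problem. -/
structure Admissible {n : ℕ} (Ω : Set (Eucl n)) (h : Eucl n → ℝ) (a b p q β lam : ℝ) :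
    Prop where
  bounded : Bornology.IsBounded Ω
  a_pos : 0 < a
  b_pos : 0 < b
  q_pos : 0 < q
  q_lt : q < n - 1
  lt_p : 2 * (n : ℝ) - 1 < p + 1
  one_lt_β : 1 < β
  β_lt : β < n / (n - 1)
  lam_pos : 0 < lam
  memLp : MemLp h (ENNReal.ofReal (n / (n - q - 1))) (volume.restrict Ω)

theorem rpow_two_mul_dim {n : ℕ} {t : ℝ} (ht : 0 < t) : t ^ (2 * (n : ℝ)) = (t ^ (n : ℝ)) ^ 2 := by
  rw [mul_comm, Real.rpow_mul ht.le, Real.rpow_two]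

theorem Admissible.isFiniteMeasure {n : ℕ} {Ω : Set (Eucl n)} {h : Eucl n → ℝ}
    {a b p q β lam : ℝ} (A : Admissible Ω h a b p q β lam) : IsFiniteMeasure (volume.restrict Ω) :=
  ⟨by simpa using A.bounded.measure_lt_top⟩

section Functional

variable {n : ℕ} [hn : Fact (2 ≤ n)] {Ω : Set (Eucl n)} {h : Eucl n → ℝ} {a b p q β lam : ℝ}

/-- The functional `∫_Ω g(u) u`. -/
noncomputable def intG (p β : ℝ) (u : W0 Ω) : ℝ := ∫ x in Ω, g p β (fn u x) * fn u x

/-- The functional `∫_Ω g'(u) u²`. -/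
noncomputable def intDG (p β : ℝ) (u : W0 Ω) : ℝ :=
  ∫ x in Ω, deriv (g p β) (fn u x) * fn u x ^ 2

/-- The value `φ_u'(1)` of the derivative of the fibering map. -/
noncomputable def dFiber (h : Eucl n → ℝ) (a b p q β lam : ℝ) (u : W0 Ω) : ℝ :=
  a * (gradNorm u ^ n) ^ 2 + b * gradNorm u ^ n - lam * H h q u - intG p β u

/-- The value `φ_u''(1)` of the second derivative of the fibering map. -/
noncomputable def ddFiber (h : Eucl n → ℝ) (a b p q β lam : ℝ) (u : W0 Ω) : ℝ :=
  (2 * n - 1) * (a * (gradNorm u ^ n) ^ 2) + (n - 1) * (b * gradNorm u ^ n) -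
    q * (lam * H h q u) - intDG p β u

namespace Admissible

theorem two_le_dim (_ : Admissible Ω h a b p q β lam) : (2 : ℝ) ≤ n := by exact_mod_cast hn.out

theorem two_lt_p (A : Admissible Ω h a b p q β lam) : 2 < p := by
  have := A.two_le_dim
  have := A.lt_p
  linarith

theorem holderConjugate (A : Admissible Ω h a b p q β lam) :
    ((n : ℝ) / (n - q - 1)).HolderConjugate (n / (q + 1)) := by
  have h1 := A.two_le_dim
  have h2 := A.q_pos
  have h3 := A.q_lt
  have h4 : 0 < (n : ℝ) - q - 1 := by linarith
  have hn0 : (0 : ℝ) < n := by linarith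
  rw [Real.holderConjugate_iff]
  refine ⟨by rw [one_lt_div h4]; linarith, ?_⟩
  rw [inv_div, inv_div]
  field_simp
  ring

theorem unifExp (A : Admissible Ω h a b p q β lam) {ι : Type*} {u : ι → W0 Ω} {K : ℝ}
    (hu : ∀ k, gradNorm (u k) ≤ K) : UnifExp (volume.restrict Ω) β fun k => fn (u k) :=
  unifExp_of_gradNorm_le A.bounded (by linarith [A.one_lt_β]) A.β_lt hu

theorem unifExp_self (A : Admissible Ω h a b p q β lam) (u : W0 Ω) :
    UnifExp (volume.restrict Ω) β fun _ : Unit => fn u :=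
  A.unifExp (u := fun _ : Unit => u) fun _ => le_rfl

theorem integrable (A : Admissible Ω h a b p q β lam) (u : W0 Ω) {F : ℝ → ℝ}
    (hF : ExpGrowth β F) (hFc : Continuous F) :
    Integrable (fun x => F (fn u x)) (volume.restrict Ω) :=
  (A.unifExp_self u).integrable hF hFc () (fn_aestronglyMeasurable u)

theorem tendsto_H (A : Admissible Ω h a b p q β lam) {u : ℕ → W0 Ω} {w : W0 Ω} {K : ℝ}
    (hu : ∀ k, gradNorm (u k) ≤ K) (hw : ∀ᵐ x ∂(volume.restrict Ω),
      Filter.Tendsto (fun k => fn (u k) x) Filter.atTop (nhds (fn w x))) :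
    Filter.Tendsto (fun k => H h q (u k)) Filter.atTop (nhds (H h q w)) := by
  have := A.isFiniteMeasure
  have hq := A.q_pos
  exact (A.unifExp hu).tendsto_integral_mul (by linarith [A.one_lt_β])
    (fun k => fn_aestronglyMeasurable _) hw
    (ExpGrowth.abs_rpow A.one_lt_β.le (by linarith : 0 ≤ q + 1))
    (continuous_abs_rpow (by linarith)) A.holderConjugate A.memLp

theorem tendsto_integral (A : Admissible Ω h a b p q β lam) {u : ℕ → W0 Ω} {w : W0 Ω} {K : ℝ}
    (hu : ∀ k, gradNorm (u k) ≤ K) (hw : ∀ᵐ x ∂(volume.restrict Ω),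
      Filter.Tendsto (fun k => fn (u k) x) Filter.atTop (nhds (fn w x))) {F : ℝ → ℝ}
    (hF : ExpGrowth β F) (hFc : Continuous F) :
    Filter.Tendsto (fun k => ∫ x in Ω, F (fn (u k) x)) Filter.atTop
      (nhds (∫ x in Ω, F (fn w x))) := by
  have := A.isFiniteMeasure
  exact (A.unifExp hu).tendsto_integral (by linarith [A.one_lt_β])
    (fun k => fn_aestronglyMeasurable _) hw hF hFc

theorem J_eq (u : W0 Ω) : J h a b p q β lam u =
    1 / (n : ℝ) * (a * (gradNorm u ^ n) ^ 2 / 2 + b * gradNorm u ^ n) -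
      lam / (q + 1) * H h q u - ∫ x in Ω, G p β (fn u x) := by
  rw [J, M_eq]

/-- `J` is continuous for the norm `‖·‖`. -/
theorem tendsto_J (A : Admissible Ω h a b p q β lam) {u : ℕ → W0 Ω} {w : W0 Ω}
    (hu : Filter.Tendsto (fun k => gradNorm (u k - w)) Filter.atTop (nhds 0)) :
    Filter.Tendsto (fun k => J h a b p q β lam (u k)) Filter.atTop
      (nhds (J h a b p q β lam w)) := by
  have hp := A.two_lt_p
  refine Filter.tendsto_of_subseq_tendsto fun ns hns => ?_
  have hu' := hu.comp hns
  obtain ⟨C, hC0, hC⟩ := exists_norm_le_gradNorm (Ω := Ω) A.bounded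
  have hLp : Filter.Tendsto (fun k => (u (ns k)).1.1) Filter.atTop (nhds w.1.1) := by
    rw [tendsto_iff_norm_sub_tendsto_zero]
    refine squeeze_zero (fun _ => norm_nonneg _) (fun k => hC (u (ns k) - w)) ?_
    simpa using hu'.const_mul C
  obtain ⟨ms, hms, hae⟩ := exists_subseq_tendsto_ae hLp
  have hnorm : Filter.Tendsto (fun k => gradNorm (u (ns (ms k)))) Filter.atTop
      (nhds (gradNorm w)) := by
    rw [tendsto_iff_norm_sub_tendsto_zero]
    exact squeeze_zero (fun _ => norm_nonneg _) (fun k => abs_gradNorm_sub_le _ _)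
      (hu'.comp hms.tendsto_atTop)
  obtain ⟨K, hK⟩ := hnorm.bddAbove_range
  have hK' : ∀ k, gradNorm (u (ns (ms k))) ≤ K := fun k => hK ⟨k, rfl⟩
  refine ⟨ms, ?_⟩
  simp only [J_eq]
  have h1 := A.tendsto_H hK' hae
  have h2 := A.tendsto_integral hK' hae (expGrowth_G (p := p) (by linarith) A.one_lt_β)
    (continuous_G (by linarith) (by linarith [A.one_lt_β]))
  have h3 := hnorm.pow n
  exact (((((h3.pow 2).const_mul a).div_const 2).add (h3.const_mul b)).const_mul _ |>.sub
    (h1.const_mul _)).sub h2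

theorem H_smul (t : ℝ) (u : W0 Ω) : H h q (t • u) = |t| ^ (q + 1) * H h q u := by
  rw [H, H, ← integral_const_mul]
  refine integral_congr_ae ?_
  filter_upwards [fn_smul t u] with x hx
  rw [hx, abs_mul, Real.mul_rpow (abs_nonneg t) (abs_nonneg _)]
  ring

theorem gradNorm_smul_pow {t : ℝ} (ht : 0 < t) (u : W0 Ω) :
    gradNorm (t • u) ^ n = t ^ (n : ℝ) * gradNorm u ^ n := by
  rw [gradNorm_smul, abs_of_pos ht, mul_pow, Real.rpow_natCast]

theorem intG_smul (t : ℝ) (u : W0 Ω) :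
    intG p β (t • u) = t * ∫ x in Ω, g p β (t * fn u x) * fn u x ^ 1 := by
  rw [intG, ← integral_const_mul]
  refine integral_congr_ae ?_
  filter_upwards [fn_smul t u] with x hx
  rw [hx]
  ring

theorem intDG_smul (t : ℝ) (u : W0 Ω) :
    intDG p β (t • u) = t ^ 2 * ∫ x in Ω, deriv (g p β) (t * fn u x) * fn u x ^ 2 := by
  rw [intDG, ← integral_const_mul]
  refine integral_congr_ae ?_
  filter_upwards [fn_smul t u] with x hx
  rw [hx]
  ring

theorem fiber_eq {t : ℝ} (ht : 0 < t) (u : W0 Ω) : fiber h a b p q β lam u t =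
    a * (gradNorm u ^ n) ^ 2 / (2 * n) * t ^ (2 * (n : ℝ)) +
      b * gradNorm u ^ n / n * t ^ (n : ℝ) - lam / (q + 1) * H h q u * t ^ (q + 1) -
      ∫ x in Ω, G p β (t * fn u x) * fn u x ^ 0 := by
  have h1 : ∫ x in Ω, G p β (fn (t • u) x) = ∫ x in Ω, G p β (t * fn u x) * fn u x ^ 0 := by
    refine integral_congr_ae ?_
    filter_upwards [fn_smul t u] with x hx
    rw [hx, pow_zero, mul_one]
  have h2 := gradNorm_smul_pow ht u
  have h3 := H_smul (h := h) (q := q) t u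
  have h4 : fiber h a b p q β lam u t = J h a b p q β lam (t • u) := rfl
  have hn0 : (n : ℝ) ≠ 0 := by
    have := hn.out
    positivity
  rw [h4, J_eq, h1]
  generalize t • u = w at h2 h3 ⊢
  rw [h2, h3, abs_of_pos ht, rpow_two_mul_dim ht]
  field_simp

theorem dFiber_smul {t : ℝ} (ht : 0 < t) (u : W0 Ω) : dFiber h a b p q β lam (t • u) =
    a * (gradNorm u ^ n) ^ 2 * t ^ (2 * (n : ℝ)) + b * gradNorm u ^ n * t ^ (n : ℝ) -
      lam * H h q u * t ^ (q + 1) - intG p β (t • u) := by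
  have h1 := gradNorm_smul_pow ht u
  have h2 := H_smul (h := h) (q := q) t u
  have h3 : dFiber h a b p q β lam (t • u) = a * (gradNorm (t • u) ^ n) ^ 2 +
    b * gradNorm (t • u) ^ n - lam * H h q (t • u) - intG p β (t • u) := rfl
  generalize t • u = w at h1 h2 h3 ⊢
  rw [h3, h1, h2, rpow_two_mul_dim ht, abs_of_pos ht]
  ring

theorem ddFiber_smul {t : ℝ} (ht : 0 < t) (u : W0 Ω) : ddFiber h a b p q β lam (t • u) =
    (2 * n - 1) * (a * (gradNorm u ^ n) ^ 2) * t ^ (2 * (n : ℝ)) +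
      (n - 1) * (b * gradNorm u ^ n) * t ^ (n : ℝ) - q * (lam * H h q u) * t ^ (q + 1) -
      intDG p β (t • u) := by
  have h1 := gradNorm_smul_pow ht u
  have h2 := H_smul (h := h) (q := q) t u
  have h3 : ddFiber h a b p q β lam (t • u) = (2 * n - 1) * (a * (gradNorm (t • u) ^ n) ^ 2) +
    (n - 1) * (b * gradNorm (t • u) ^ n) - q * (lam * H h q (t • u)) - intDG p β (t • u) := rfl
  generalize t • u = w at h1 h2 h3 ⊢
  rw [h3, h1, h2, rpow_two_mul_dim ht, abs_of_pos ht]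
  ring

theorem H_smul_pos {t : ℝ} (ht : 0 < t) {u : W0 Ω} (hu : 0 < H h q u) : 0 < H h q (t • u) := by
  have h2 := H_smul (h := h) (q := q) t u
  generalize t • u = w at h2 ⊢
  rw [h2]
  positivity

theorem dFiber_smul_div {t : ℝ} (ht : 0 < t) (u : W0 Ω) : dFiber h a b p q β lam (t • u) / t =
    a * (gradNorm u ^ n) ^ 2 * t ^ (2 * (n : ℝ) - 1) + b * gradNorm u ^ n * t ^ ((n : ℝ) - 1) -
      lam * H h q u * t ^ q - ∫ x in Ω, g p β (t * fn u x) * fn u x ^ 1 := by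
  rw [dFiber_smul ht u, intG_smul t u, Real.rpow_sub_one ht.ne', Real.rpow_sub_one ht.ne',
    Real.rpow_add_one ht.ne']
  field_simp

theorem ddFiber_smul_div {t : ℝ} (ht : 0 < t) (u : W0 Ω) :
    ddFiber h a b p q β lam (t • u) / t ^ 2 =
    (2 * n - 1) * (a * (gradNorm u ^ n) ^ 2) * t ^ (2 * (n : ℝ) - 1 - 1) +
      (n - 1) * (b * gradNorm u ^ n) * t ^ ((n : ℝ) - 1 - 1) -
      q * (lam * H h q u) * t ^ (q - 1) -
      ∫ x in Ω, deriv (g p β) (t * fn u x) * fn u x ^ 2 := by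
  rw [ddFiber_smul ht u, intDG_smul t u, Real.rpow_sub_one ht.ne', Real.rpow_sub_one ht.ne',
    Real.rpow_sub_one ht.ne', Real.rpow_sub_one ht.ne', Real.rpow_sub_one ht.ne',
    Real.rpow_add_one ht.ne']
  field_simp

theorem hasDerivAt_fiber (A : Admissible Ω h a b p q β lam) (u : W0 Ω) {t : ℝ} (ht : 0 < t) :
    HasDerivAt (fiber h a b p q β lam u) (dFiber h a b p q β lam (t • u) / t) t := by
  have hp := A.two_lt_p
  have hβ := A.one_lt_β
  have hn0 : (n : ℝ) ≠ 0 := by linarith [A.two_le_dim]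
  have hq1 : q + 1 ≠ 0 := by linarith [A.q_pos]
  have hev : fiber h a b p q β lam u =ᶠ[nhds t] fun t =>
      a * (gradNorm u ^ n) ^ 2 / (2 * n) * t ^ (2 * (n : ℝ)) +
      b * gradNorm u ^ n / n * t ^ (n : ℝ) - lam / (q + 1) * H h q u * t ^ (q + 1) -
      ∫ x in Ω, G p β (t * fn u x) * fn u x ^ 0 := by
    filter_upwards [lt_mem_nhds ht] with s hs
    exact fiber_eq hs u
  refine HasDerivAt.congr_of_eventuallyEq ?_ hev
  have hI := hasDerivAt_integral_comp_mul hβ.le (A.unifExp_self u) (fn_aestronglyMeasurable u)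
    (hasDerivAt_G (p := p) (β := β) (by linarith) (by linarith))
    (continuous_g (by linarith) (by linarith)) (expGrowth_G (by linarith) hβ)
    (expGrowth_g (by linarith) hβ.le) 0 t
  have hr : ∀ r : ℝ, HasDerivAt (fun t : ℝ => t ^ r) (r * t ^ (r - 1)) t := fun r =>
    Real.hasDerivAt_rpow_const (Or.inl ht.ne')
  refine ((((hr (2 * n)).const_mul _).add ((hr n).const_mul _)).sub
    ((hr (q + 1)).const_mul _)).sub hI |>.congr_deriv ?_
  rw [dFiber_smul_div ht, add_sub_cancel_right]
  field_simp
  ring_nf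

theorem hasDerivAt_dFiber (A : Admissible Ω h a b p q β lam) (u : W0 Ω) {t : ℝ} (ht : 0 < t) :
    HasDerivAt (fun t => dFiber h a b p q β lam (t • u) / t)
      (ddFiber h a b p q β lam (t • u) / t ^ 2) t := by
  have hp := A.two_lt_p
  have hβ := A.one_lt_β
  have hev : (fun t => dFiber h a b p q β lam (t • u) / t) =ᶠ[nhds t] fun t =>
      a * (gradNorm u ^ n) ^ 2 * t ^ (2 * (n : ℝ) - 1) + b * gradNorm u ^ n * t ^ ((n : ℝ) - 1) -
      lam * H h q u * t ^ q - ∫ x in Ω, g p β (t * fn u x) * fn u x ^ 1 := by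
    filter_upwards [lt_mem_nhds ht] with s hs
    exact dFiber_smul_div hs u
  refine HasDerivAt.congr_of_eventuallyEq ?_ hev
  have hI := hasDerivAt_integral_comp_mul hβ.le (A.unifExp_self u) (fn_aestronglyMeasurable u)
    (fun s => (hasDerivAt_g (p := p) (by linarith) hβ s).differentiableAt.hasDerivAt)
    (continuous_deriv_g (by linarith) hβ) (expGrowth_g (by linarith) hβ.le)
    (expGrowth_deriv_g (by linarith) hβ) 1 t
  have hr : ∀ r : ℝ, HasDerivAt (fun t : ℝ => t ^ r) (r * t ^ (r - 1)) t := fun r =>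
    Real.hasDerivAt_rpow_const (Or.inl ht.ne')
  refine ((((hr (2 * n - 1)).const_mul _).add ((hr (n - 1)).const_mul _)).sub
    ((hr q).const_mul _)).sub hI |>.congr_deriv ?_
  rw [ddFiber_smul_div ht]
  ring

theorem deriv_fiber (A : Admissible Ω h a b p q β lam) (u : W0 Ω) {t : ℝ} (ht : 0 < t) :
    deriv (fiber h a b p q β lam u) t = dFiber h a b p q β lam (t • u) / t :=
  (A.hasDerivAt_fiber u ht).deriv

theorem mem_nehari_iff (A : Admissible Ω h a b p q β lam) (u : W0 Ω) :
    u ∈ nehari Ω h a b p q β lam ↔ dFiber h a b p q β lam u = 0 := by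
  show deriv (fiber h a b p q β lam u) 1 = 0 ↔ _
  rw [A.deriv_fiber u one_pos, one_smul, div_one]

theorem deriv_deriv_fiber (A : Admissible Ω h a b p q β lam) (u : W0 Ω) :
    deriv (deriv (fiber h a b p q β lam u)) 1 = ddFiber h a b p q β lam u := by
  have hev : deriv (fiber h a b p q β lam u) =ᶠ[nhds 1]
      fun t => dFiber h a b p q β lam (t • u) / t := by
    filter_upwards [lt_mem_nhds one_pos] with s hs
    exact A.deriv_fiber u hs
  rw [hev.deriv_eq, (A.hasDerivAt_dFiber u one_pos).deriv, one_smul, one_pow, div_one]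

theorem mem_nehariPlus_iff (A : Admissible Ω h a b p q β lam) (u : W0 Ω) :
    u ∈ nehariPlus Ω h a b p q β lam ↔
      dFiber h a b p q β lam u = 0 ∧ 0 < ddFiber h a b p q β lam u := by
  rw [← A.mem_nehari_iff, ← A.deriv_deriv_fiber]
  rfl

end Admissible

end Functional

/-! ### Critical points of the fibering maps -/

/-- The first zero of a function which is negative near zero and positive somewhere. -/
theorem exists_first_zero {f f' : ℝ → ℝ} (hf : ∀ t, 0 < t → HasDerivAt f (f' t) t)
    (h0 : ∀ᶠ t in nhdsWithin (0 : ℝ) (Set.Ioi 0), f t < 0) {T : ℝ} (hT0 : 0 < T) (hT : 0 < f T) :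
    ∃ t₁ : ℝ, 0 < t₁ ∧ f t₁ = 0 ∧ 0 ≤ f' t₁ ∧ ∀ t, 0 < t → t < t₁ → f t < 0 := by
  obtain ⟨ε, hε0, hε⟩ : ∃ ε > 0, ∀ t, 0 < t → t < ε → f t < 0 := by
    rw [eventually_nhdsWithin_iff, Metric.eventually_nhds_iff] at h0
    obtain ⟨ε, hε0, hε⟩ := h0
    refine ⟨ε, hε0, fun t ht1 ht2 => hε ?_ ht1⟩
    rwa [Real.dist_eq, sub_zero, abs_of_pos ht1]
  have hcont : ContinuousOn f (Set.Icc (ε / 2) T) := fun t ht =>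
    (hf t (by linarith [ht.1])).continuousAt.continuousWithinAt
  have hεT : ε ≤ T := by
    by_contra hlt
    exact lt_asymm hT (hε T hT0 (not_le.1 hlt))
  set S : Set ℝ := Set.Icc (ε / 2) T ∩ f ⁻¹' Set.Ici 0 with hS
  have hScl : IsClosed S := hcont.preimage_isClosed_of_isClosed isClosed_Icc isClosed_Ici
  have hScpt : IsCompact S := isCompact_Icc.of_isClosed_subset hScl Set.inter_subset_left
  obtain ⟨t₁, ⟨ht₁I, ht₁f⟩, ht₁min⟩ := hScpt.exists_isLeast ⟨T, ⟨by linarith, le_rfl⟩, hT.le⟩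
  have ht₁0 : 0 < t₁ := lt_of_lt_of_le (half_pos hε0) ht₁I.1
  have hneg : ∀ t, 0 < t → t < t₁ → f t < 0 := by
    intro t ht0 htt
    by_cases hte : t < ε
    · exact hε t ht0 hte
    · by_contra hge
      exact absurd (ht₁min ⟨⟨by linarith, htt.le.trans ht₁I.2⟩, not_lt.1 hge⟩) (not_le.2 htt)
  have hleft : ∀ᶠ t in nhdsWithin t₁ (Set.Iio t₁), f t < 0 := by
    filter_upwards [self_mem_nhdsWithin, (lt_mem_nhds ht₁0).filter_mono nhdsWithin_le_nhds]
      with t ht1 ht2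
    exact hneg t ht2 ht1
  have hzero : f t₁ = 0 := le_antisymm (le_of_tendsto
    ((hf t₁ ht₁0).continuousAt.tendsto.mono_left (nhdsWithin_le_nhds (s := Set.Iio t₁)))
    (hleft.mono fun _ h => h.le)) ht₁f
  refine ⟨t₁, ht₁0, hzero, ?_, hneg⟩
  refine ge_of_tendsto (hasDerivAt_iff_tendsto_slope_left_right.1 (hf t₁ ht₁0)).1 ?_
  filter_upwards [hleft, self_mem_nhdsWithin] with t ht1 ht2
  have ht2 : t < t₁ := ht2
  rw [slope_def_field, hzero, sub_zero]
  exact (div_pos_of_neg_of_neg ht1 (by linarith)).le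

section Functional

variable {n : ℕ} [hn : Fact (2 ≤ n)] {Ω : Set (Eucl n)} {h : Eucl n → ℝ} {a b p q β lam : ℝ}

/-- The integrand of `∫_Ω (g'(u) u² - q g(u) u)`. -/
noncomputable def kernel (p q β s : ℝ) : ℝ :=
  (p + 1 - q + β * |s| ^ β) * |s| ^ (p + 2) * Real.exp (|s| ^ β)

namespace Admissible

theorem ne_zero_of_H_pos (A : Admissible Ω h a b p q β lam) {u : W0 Ω} (hu : 0 < H h q u) :
    u ≠ 0 := by
  rintro rfl
  have h0 := H_smul (h := h) (q := q) 0 (0 : W0 Ω)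
  rw [zero_smul, abs_zero, Real.zero_rpow (by linarith [A.q_pos]), zero_mul] at h0
  exact hu.ne' h0

theorem gradNorm_pos (A : Admissible Ω h a b p q β lam) {u : W0 Ω} (hu : u ≠ 0) :
    0 < gradNorm u :=
  lt_of_le_of_ne (gradNorm_nonneg u) fun h0 => hu (eq_zero_of_gradNorm_eq_zero A.bounded h0.symm)

theorem integrable_g_mul (A : Admissible Ω h a b p q β lam) (u : W0 Ω) :
    Integrable (fun x => g p β (fn u x) * fn u x) (volume.restrict Ω) := by
  have hp := A.two_lt_p
  have hβ := A.one_lt_β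
  exact A.integrable u (F := fun s => g p β s * s)
    ((expGrowth_g (by linarith) hβ.le).mul (ExpGrowth.id hβ.le))
    ((continuous_g (by linarith) (by linarith)).mul continuous_id)

theorem integrable_deriv_g_mul (A : Admissible Ω h a b p q β lam) (u : W0 Ω) :
    Integrable (fun x => deriv (g p β) (fn u x) * fn u x ^ 2) (volume.restrict Ω) := by
  have hp := A.two_lt_p
  have hβ := A.one_lt_β
  refine A.integrable u (F := fun s => deriv (g p β) s * s ^ 2) ?_
    ((continuous_deriv_g (by linarith) hβ).mul (continuous_pow 2))
  have := (ExpGrowth.id hβ.le).mul (ExpGrowth.id hβ.le)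
  simp only [← sq] at this
  exact (expGrowth_deriv_g (by linarith) hβ).mul this

theorem intG_nonneg (u : W0 Ω) : 0 ≤ intG p β u :=
  integral_nonneg fun _ => g_mul_self_nonneg _

theorem intDG_sub_mul_intG (A : Admissible Ω h a b p q β lam) (c : ℝ) (u : W0 Ω) :
    intDG p β u - c * intG p β u = ∫ x in Ω,
      (p + 1 - c + β * |fn u x| ^ β) * |fn u x| ^ (p + 2) * Real.exp (|fn u x| ^ β) := by
  have hp := A.two_lt_p
  have hβ := A.one_lt_β
  rw [intDG, intG, ← integral_const_mul,
    ← integral_sub (A.integrable_deriv_g_mul u) ((A.integrable_g_mul u).const_mul c)]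
  refine integral_congr_ae (Filter.Eventually.of_forall fun x => ?_)
  simp only
  rw [deriv_g (by linarith) hβ, g_mul_self (by linarith), abs_rpow_add_two (by linarith)]
  ring

/-- The consequence of the assumption on `lam` on which the argument rests: along the ray through
`v`, with `H(v) ≥ 0`, the function `t ↦ φ_v'(t) / t ^ q` is positive wherever its derivative
vanishes. By the inequality of arithmetic and geometric means such a point lies in `Λ`. -/
theorem dFiber_pos_of_ddFiber_eq (A : Admissible Ω h a b p q β lam)
    (hLam : 0 < LambdaInf Ω h a b p q β lam) {v : W0 Ω} (hv : v ≠ 0) (hH : 0 ≤ H h q v)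
    (hcrit : ddFiber h a b p q β lam v = q * dFiber h a b p q β lam v) :
    0 < dFiber h a b p q β lam v := by
  have hK := A.gradNorm_pos hv
  have hn2 := A.two_le_dim
  have hq := A.q_lt
  have hq0 := A.q_pos
  have ha := A.a_pos
  have hb := A.b_pos
  have hlam := A.lam_pos
  set X := a * (gradNorm v ^ n) ^ 2 with hX
  set Y := b * gradNorm v ^ n with hY
  have hX0 : 0 < X := by positivity
  have hY0 : 0 < Y := by positivity
  have hQ0 : 0 ≤ intG p β v := intG_nonneg v
  have hc1 : 0 < 2 * (n : ℝ) - 1 - q := by linarith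
  have hc2 : 0 < (n : ℝ) - 1 - q := by linarith
  have hE : (2 * n - 1 - q) * X + (n - 1 - q) * Y = intDG p β v - q * intG p β v := by
    simp only [ddFiber, dFiber, ← hX, ← hY] at hcrit
    linarith
  have hmem : v ∈ LambdaSet Ω a b p q β := by
    show gradNorm v ^ (3 * (n : ℝ) / 2) ≤ intDG p β v /
      (2 * Real.sqrt (a * b * (2 * n - 1 - q) * (n - 1 - q)))
    have hab : 0 < a * b * (2 * n - 1 - q) * (n - 1 - q) := by positivity
    rw [le_div_iff₀ (by positivity)]
    have e1 : gradNorm v ^ (3 * (n : ℝ) / 2) *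
        Real.sqrt (a * b * (2 * n - 1 - q) * (n - 1 - q)) =
        Real.sqrt (((2 * n - 1 - q) * X) * ((n - 1 - q) * Y)) := by
      have e2 : gradNorm v ^ (3 * (n : ℝ) / 2) = Real.sqrt ((gradNorm v ^ n) ^ 3) := by
        rw [Real.sqrt_eq_rpow, ← Real.rpow_natCast, ← Real.rpow_natCast, ← Real.rpow_mul hK.le,
          ← Real.rpow_mul hK.le]
        congr 1
        push_cast
        ring
      rw [e2, ← Real.sqrt_mul (by positivity)]
      congr 1
      rw [hX, hY]; ring
    have e3 : 2 * Real.sqrt (((2 * n - 1 - q) * X) * ((n - 1 - q) * Y)) ≤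
        (2 * n - 1 - q) * X + (n - 1 - q) * Y := by
      rw [Real.sqrt_mul (by positivity)]
      have s1 := Real.sq_sqrt (show 0 ≤ (2 * (n : ℝ) - 1 - q) * X by positivity)
      have s2 := Real.sq_sqrt (show 0 ≤ ((n : ℝ) - 1 - q) * Y by positivity)
      nlinarith [sq_nonneg (Real.sqrt ((2 * n - 1 - q) * X) - Real.sqrt ((n - 1 - q) * Y))]
    have e4 : 0 ≤ q * intG p β v := by positivity
    linarith
  have hinf := lt_of_lt_of_le hLam (iInf₂_le v ⟨⟨hmem, hv⟩, hH⟩)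
  rw [← EReal.coe_zero, EReal.coe_lt_coe_iff] at hinf
  have hid := A.intDG_sub_mul_intG (2 * (n : ℝ) - 1) v
  rw [show p + 1 - (2 * (n : ℝ) - 1) = p + 2 - 2 * n by ring] at hid
  rw [← hid] at hinf
  have hfin : 0 < (2 * n - 1 - q) * dFiber h a b p q β lam v := by
    simp only [dFiber, ← hX, ← hY]
    have : 0 < (n : ℝ) * Y := by positivity
    nlinarith
  exact (pos_iff_pos_of_mul_pos hfin).1 hc1

/-- If `H(u) > 0`, the fibering map of `u` decreases near zero. -/
theorem eventually_dFiber_neg (A : Admissible Ω h a b p q β lam) {u : W0 Ω} (hu : 0 < H h q u) :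
    ∀ᶠ t in nhdsWithin (0 : ℝ) (Set.Ioi 0), dFiber h a b p q β lam (t • u) < 0 := by
  have hn2 := A.two_le_dim
  have hq := A.q_lt
  have hlam := A.lam_pos
  have hc : Continuous fun t : ℝ => a * (gradNorm u ^ n) ^ 2 * t ^ (2 * (n : ℝ) - 1 - q) +
      b * gradNorm u ^ n * t ^ ((n : ℝ) - 1 - q) - lam * H h q u := by
    have h1 := Real.continuous_rpow_const (q := 2 * (n : ℝ) - 1 - q) (by linarith)
    have h2 := Real.continuous_rpow_const (q := (n : ℝ) - 1 - q) (by linarith)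
    fun_prop
  have h0 : a * (gradNorm u ^ n) ^ 2 * (0 : ℝ) ^ (2 * (n : ℝ) - 1 - q) +
      b * gradNorm u ^ n * (0 : ℝ) ^ ((n : ℝ) - 1 - q) - lam * H h q u < 0 := by
    rw [Real.zero_rpow (by linarith), Real.zero_rpow (by linarith)]
    have : 0 < lam * H h q u := by positivity
    linarith
  have hev := ((hc.tendsto 0).eventually_lt_const h0).filter_mono
    (nhdsWithin_le_nhds (s := Set.Ioi (0 : ℝ)))
  filter_upwards [hev, self_mem_nhdsWithin] with t ht ht0
  have ht0 : 0 < t := ht0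
  have hQ : 0 ≤ intG p β (t • u) := intG_nonneg _
  rw [dFiber_smul ht0 u]
  have e1 : t ^ (2 * (n : ℝ) - 1 - q) * t ^ (q + 1) = t ^ (2 * (n : ℝ)) := by
    rw [← Real.rpow_add ht0]; congr 1; ring
  have e2 : t ^ ((n : ℝ) - 1 - q) * t ^ (q + 1) = t ^ (n : ℝ) := by
    rw [← Real.rpow_add ht0]; congr 1; ring
  have e3 : 0 < t ^ (q + 1) := by positivity
  have e4 := mul_neg_of_neg_of_pos ht e3
  rw [← e1, ← e2]
  linarith

/-- The function `t ^ 2 φ_u''(t) - q t φ_u'(t)`, whose sign is that of the derivative of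
`φ_u'(t) / t ^ q`. -/
theorem ddFiber_sub_dFiber_smul (A : Admissible Ω h a b p q β lam) (u : W0 Ω) {t : ℝ} (ht : 0 < t) :
    ddFiber h a b p q β lam (t • u) - q * dFiber h a b p q β lam (t • u) =
      (2 * n - 1 - q) * (a * (gradNorm u ^ n) ^ 2) * t ^ (2 * (n : ℝ)) +
      (n - 1 - q) * (b * gradNorm u ^ n) * t ^ (n : ℝ) -
      ∫ x in Ω, kernel p q β (t * fn u x) := by
  have h1 := A.intDG_sub_mul_intG q (t • u)
  have h2 : ∫ x in Ω, (p + 1 - q + β * |fn (t • u) x| ^ β) * |fn (t • u) x| ^ (p + 2) *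
      Real.exp (|fn (t • u) x| ^ β) = ∫ x in Ω, kernel p q β (t * fn u x) := by
    refine integral_congr_ae ?_
    filter_upwards [fn_smul t u] with x hx
    rw [hx, kernel]
  rw [← h2, ← h1, ddFiber_smul ht u, dFiber_smul ht u]
  ring

theorem continuous_kernel (A : Admissible Ω h a b p q β lam) :
    Continuous (kernel p q β) := by
  have := A.two_lt_p
  have h1 := continuous_abs_rpow (show 0 ≤ β by linarith [A.one_lt_β])
  have h2 := continuous_abs_rpow (show 0 ≤ p + 2 by linarith)
  unfold kernel
  fun_prop

theorem expGrowth_kernel (A : Admissible Ω h a b p q β lam) :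
    ExpGrowth β (kernel p q β) := by
  have hp := A.two_lt_p
  have hβ := A.one_lt_β
  exact (((ExpGrowth.const β (p + 1 - q)).add ((ExpGrowth.const β β).mul
    (ExpGrowth.abs_rpow hβ.le (by linarith)))).mul (ExpGrowth.abs_rpow hβ.le (by linarith))).mul
      (ExpGrowth.exp β)

/-- The derivative of `φ_u'(t) / t ^ q`. -/
theorem hasDerivAt_dFiber_div_rpow (A : Admissible Ω h a b p q β lam) (u : W0 Ω) {t : ℝ}
    (ht : 0 < t) :
    HasDerivAt (fun t => dFiber h a b p q β lam (t • u) / t / t ^ q)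
      ((ddFiber h a b p q β lam (t • u) - q * dFiber h a b p q β lam (t • u)) / (t ^ 2 * t ^ q))
      t := by
  have h1 := A.hasDerivAt_dFiber u ht
  generalize ddFiber h a b p q β lam (t • u) = D at h1 ⊢
  have h2 := h1.div (Real.hasDerivAt_rpow_const (p := q) (Or.inl ht.ne')) (by positivity)
  refine h2.congr_deriv ?_
  generalize dFiber h a b p q β lam (t • u) = E
  rw [Real.rpow_sub_one ht.ne']
  have : 0 < t ^ q := by positivity
  field_simp

theorem integrable_kernel (A : Admissible Ω h a b p q β lam) (u : W0 Ω) (t : ℝ) :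
    Integrable (fun x => kernel p q β (t * fn u x)) (volume.restrict Ω) :=
  A.integrable u (F := fun s => kernel p q β (t * s)) (A.expGrowth_kernel.comp_mul t)
    (A.continuous_kernel.comp (continuous_const_mul t))

/-- Near zero the derivative of `φ_u'(t) / t ^ q` is positive: the integral is of order
`t ^ (p + 2)`, and `p + 2 > n`. -/
theorem exists_small_ddFiber_pos (A : Admissible Ω h a b p q β lam) {u : W0 Ω} (hu : u ≠ 0) :
    ∃ ε : ℝ, 0 < ε ∧ ε < 1 ∧
      0 < ddFiber h a b p q β lam (ε • u) - q * dFiber h a b p q β lam (ε • u) := by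
  have hp := A.two_lt_p
  have hpn := A.lt_p
  have hβ := A.one_lt_β
  have hn2 := A.two_le_dim
  have hq := A.q_lt
  have ha := A.a_pos
  have hb := A.b_pos
  have hK := A.gradNorm_pos hu
  have hc1 : 0 < 2 * (n : ℝ) - 1 - q := by linarith
  have hc2 : 0 < (n : ℝ) - 1 - q := by linarith
  have hc3 : 0 < p + 1 - q := by linarith
  have hY0 : 0 < (n - 1 - q) * (b * gradNorm u ^ n) := by positivity
  set I := ∫ x in Ω, kernel p q β (fn u x) with hI
  have hc : Continuous fun t : ℝ => (n - 1 - q) * (b * gradNorm u ^ n) - t ^ (p + 2 - n) * I := by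
    have h1 := Real.continuous_rpow_const (q := p + 2 - n) (by linarith)
    fun_prop
  have h0 : 0 < (n - 1 - q) * (b * gradNorm u ^ n) - (0 : ℝ) ^ (p + 2 - n) * I := by
    rw [Real.zero_rpow (by linarith)]
    linarith
  have hev := ((hc.tendsto 0).eventually_const_lt h0).filter_mono
    (nhdsWithin_le_nhds (s := Set.Ioi (0 : ℝ)))
  have hev2 : ∀ᶠ t in nhdsWithin (0 : ℝ) (Set.Ioi 0), t < 1 :=
    (gt_mem_nhds one_pos).filter_mono nhdsWithin_le_nhds
  obtain ⟨t, ⟨ht1, ht2⟩, ht0⟩ := ((hev.and hev2).and self_mem_nhdsWithin).exists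
  have ht0 : 0 < t := ht0
  refine ⟨t, ht0, ht2, ?_⟩
  rw [A.ddFiber_sub_dFiber_smul u ht0]
  have hle : ∫ x in Ω, kernel p q β (t * fn u x) ≤ t ^ (p + 2) * I := by
    have hint : Integrable (fun x => kernel p q β (fn u x)) (volume.restrict Ω) :=
      A.integrable u A.expGrowth_kernel A.continuous_kernel
    rw [hI, ← integral_const_mul]
    refine integral_mono (A.integrable_kernel u t) (hint.const_mul _) fun x => ?_
    simp only [kernel]
    have hts : |t * fn u x| ^ β ≤ |fn u x| ^ β := by
      rw [abs_mul, abs_of_pos ht0]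
      have := abs_nonneg (fn u x)
      gcongr
      nlinarith
    have hts2 : |t * fn u x| ^ (p + 2) = t ^ (p + 2) * |fn u x| ^ (p + 2) := by
      rw [abs_mul, abs_of_pos ht0, Real.mul_rpow ht0.le (abs_nonneg _)]
    rw [hts2]
    have hβ0 : 0 ≤ β := by linarith
    calc (p + 1 - q + β * |t * fn u x| ^ β) * (t ^ (p + 2) * |fn u x| ^ (p + 2)) *
          Real.exp (|t * fn u x| ^ β)
        ≤ (p + 1 - q + β * |fn u x| ^ β) * (t ^ (p + 2) * |fn u x| ^ (p + 2)) *
          Real.exp (|fn u x| ^ β) := by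
          gcongr
      _ = _ := by ring
  have e1 : t ^ (p + 2) = t ^ (n : ℝ) * t ^ (p + 2 - n) := by
    rw [← Real.rpow_add ht0]; congr 1; ring
  have e2 : 0 < t ^ (n : ℝ) := by positivity
  have e3 : 0 < (2 * n - 1 - q) * (a * (gradNorm u ^ n) ^ 2) * t ^ (2 * (n : ℝ)) := by positivity
  have e4 := mul_pos e2 ht1
  rw [e1] at hle
  linarith

/-- For large `t` the derivative of `φ_u'(t) / t ^ q` is negative: the integral is at least of order
`t ^ (p + 2)`, and `p + 2 > 2 n`. -/
theorem exists_large_ddFiber_neg (A : Admissible Ω h a b p q β lam) {u : W0 Ω}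
    (hu : 0 < H h q u) : ∃ S : ℝ, 1 ≤ S ∧
      ddFiber h a b p q β lam (S • u) - q * dFiber h a b p q β lam (S • u) < 0 := by
  have hp := A.two_lt_p
  have hpn := A.lt_p
  have hβ := A.one_lt_β
  have hn2 := A.two_le_dim
  have hq := A.q_lt
  have hb := A.b_pos
  have hc2 : 0 < (n : ℝ) - 1 - q := by linarith
  have hc3 : 0 < p + 1 - q := by linarith
  set X := (2 * n - 1 - q) * (a * (gradNorm u ^ n) ^ 2) with hX
  set Y := (n - 1 - q) * (b * gradNorm u ^ n) with hY
  have hK := gradNorm_nonneg u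
  have hY0 : 0 ≤ Y := by positivity
  set Z := ∫ x in Ω, |fn u x| ^ (p + 2) with hZ
  have hZint : Integrable (fun x => |fn u x| ^ (p + 2)) (volume.restrict Ω) :=
    A.integrable u (F := fun s => |s| ^ (p + 2)) (ExpGrowth.abs_rpow hβ.le (by linarith))
      (continuous_abs_rpow (by linarith))
  have hZ0 : 0 < Z := by
    refine lt_of_le_of_ne (integral_nonneg fun x => by positivity) fun h0 => ?_
    rw [hZ, eq_comm, integral_eq_zero_iff_of_nonneg (fun x => by positivity) hZint] at h0
    have : H h q u = 0 := by
      rw [H]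
      refine integral_eq_zero_of_ae ?_
      filter_upwards [h0] with x hx
      have hx' : |fn u x| = 0 := by
        by_contra hne
        have : 0 < |fn u x| := lt_of_le_of_ne (abs_nonneg _) (Ne.symm hne)
        have h2 : 0 < |fn u x| ^ (p + 2) := by positivity
        exact h2.ne' hx
      rw [hx', Real.zero_rpow (by linarith [A.q_pos]), mul_zero, Pi.zero_apply]
    exact hu.ne' this
  have hlim : Filter.Tendsto (fun t : ℝ => (p + 1 - q) * Z * t ^ (p + 2 - 2 * n)) Filter.atTop
      Filter.atTop := (tendsto_rpow_atTop (by linarith)).const_mul_atTop (by positivity)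
  obtain ⟨S, hS1, hS1'⟩ := ((hlim.eventually_gt_atTop (X + Y)).and
    (Filter.eventually_ge_atTop 1)).exists
  have hS0 : 0 < S := by linarith
  refine ⟨S, hS1', ?_⟩
  rw [A.ddFiber_sub_dFiber_smul u hS0, ← hX, ← hY]
  have hge : (p + 1 - q) * S ^ (p + 2) * Z ≤ ∫ x in Ω, kernel p q β (S * fn u x) := by
    rw [hZ, ← integral_const_mul]
    refine integral_mono (hZint.const_mul _) (A.integrable_kernel u S) fun x => ?_
    simp only [kernel]
    have hts2 : |S * fn u x| ^ (p + 2) = S ^ (p + 2) * |fn u x| ^ (p + 2) := by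
      rw [abs_mul, abs_of_pos hS0, Real.mul_rpow hS0.le (abs_nonneg _)]
    rw [hts2]
    have hβ0 : 0 ≤ β * |S * fn u x| ^ β := by
      have : 0 ≤ β := by linarith
      positivity
    have h1 : (1 : ℝ) ≤ Real.exp (|S * fn u x| ^ β) := Real.one_le_exp (by positivity)
    have h2 : 0 ≤ S ^ (p + 2) * |fn u x| ^ (p + 2) := by positivity
    calc (p + 1 - q) * S ^ (p + 2) * |fn u x| ^ (p + 2)
        = (p + 1 - q) * (S ^ (p + 2) * |fn u x| ^ (p + 2)) * 1 := by ring
      _ ≤ _ := by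
        gcongr
        linarith
  have e1 : S ^ (p + 2) = S ^ (2 * (n : ℝ)) * S ^ (p + 2 - 2 * n) := by
    rw [← Real.rpow_add hS0]; congr 1; ring
  have e2 : 0 < S ^ (2 * (n : ℝ)) := by positivity
  have e3 : S ^ (n : ℝ) ≤ S ^ (2 * (n : ℝ)) :=
    Real.rpow_le_rpow_of_exponent_le hS1' (by linarith)
  have e4 := mul_lt_mul_of_pos_left hS1 e2
  have e5 := mul_le_mul_of_nonneg_left e3 hY0
  rw [e1] at hge
  linarith

/-- If `H(u) > 0`, then `φ_u'` is positive somewhere: `φ_u'(t) / t ^ q` has a critical point, as its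
derivative is positive near zero and negative for large `t`. -/
theorem exists_dFiber_pos (A : Admissible Ω h a b p q β lam)
    (hLam : 0 < LambdaInf Ω h a b p q β lam) {u : W0 Ω} (hu : 0 < H h q u) :
    ∃ T : ℝ, 0 < T ∧ 0 < dFiber h a b p q β lam (T • u) := by
  have hu0 := A.ne_zero_of_H_pos hu
  obtain ⟨ε, hε0, hε1, hεE⟩ := A.exists_small_ddFiber_pos hu0
  obtain ⟨S, hS1, hSE⟩ := A.exists_large_ddFiber_neg hu
  have hS0 : 0 < S := by linarith
  -- Darboux's theorem for the derivative of `φ_u'(t) / t ^ q`.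
  obtain ⟨T, hT, hET⟩ := exists_hasDerivWithinAt_eq_of_lt_of_gt (by linarith)
    (fun t ht => (A.hasDerivAt_dFiber_div_rpow u (lt_of_lt_of_le hε0 ht.1)).hasDerivWithinAt)
    (div_pos hεE (by positivity)) (div_neg_of_neg_of_pos hSE (by positivity))
  have hT0 : 0 < T := hε0.trans hT.1
  replace hET := (div_eq_zero_iff.1 hET).resolve_right (by positivity)
  exact ⟨T, hT0, A.dFiber_pos_of_ddFiber_eq hLam (smul_ne_zero hT0.ne' hu0)
    (H_smul_pos hT0 hu).le (sub_eq_zero.1 hET)⟩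

/-- If `H(u) > 0`, the first critical point `t₁` of the fibering map of `u` is a point of
`𝒩⁺`. -/
theorem exists_first_critical (A : Admissible Ω h a b p q β lam)
    (hLam : 0 < LambdaInf Ω h a b p q β lam) {u : W0 Ω} (hu : 0 < H h q u) :
    ∃ t₁ : ℝ, 0 < t₁ ∧ dFiber h a b p q β lam (t₁ • u) = 0 ∧
      0 < ddFiber h a b p q β lam (t₁ • u) ∧
      ∀ t, 0 < t → t < t₁ → dFiber h a b p q β lam (t • u) < 0 := by
  have hu0 := A.ne_zero_of_H_pos hu
  obtain ⟨T, hT0, hT⟩ := A.exists_dFiber_pos hLam hu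
  obtain ⟨t₁, ht₁, h1, h2, h3⟩ := exists_first_zero (fun t ht => A.hasDerivAt_dFiber u ht)
    (by
      filter_upwards [A.eventually_dFiber_neg hu, self_mem_nhdsWithin] with t ht ht0
      exact div_neg_of_neg_of_pos ht ht0) hT0 (div_pos hT hT0)
  have h1' := (div_eq_zero_iff.1 h1).resolve_right ht₁.ne'
  have h2' : 0 ≤ ddFiber h a b p q β lam (t₁ • u) := by
    have := mul_nonneg h2 (sq_nonneg t₁)
    rwa [div_mul_cancel₀ _ (by positivity)] at this
  refine ⟨t₁, ht₁, h1', lt_of_le_of_ne h2' fun h0 => ?_, fun t ht htt => ?_⟩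
  · have hpos := A.dFiber_pos_of_ddFiber_eq hLam (smul_ne_zero ht₁.ne' hu0)
      (H_smul_pos ht₁ hu).le (h0.symm.trans (by rw [h1', mul_zero]))
    exact hpos.ne' h1'
  · exact (div_neg_iff.1 (h3 t ht htt)).elim (fun h => absurd h.2 ht.le.not_gt) fun h => h.1

end Admissible

end Functional

/-! ### Minimizers in `𝒩⁺` are local minima -/

/-- At a point where the second derivative is positive the first derivative changes sign, so a
critical point there is a strict local minimum. -/
theorem exists_lt_of_second_deriv_pos {f f' : ℝ → ℝ} {c : ℝ}
    (hf : ∀ t, 0 < t → HasDerivAt f (f' t) t) (h1 : f' 1 = 0) (hf' : HasDerivAt f' c 1)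
    (hc : 0 < c) : ∃ ε : ℝ, 0 < ε ∧ ε < 1 ∧ f 1 < f (1 - ε) ∧ f 1 < f (1 + ε) := by
  have hs := (hasDerivAt_iff_tendsto_slope.1 hf').eventually_const_lt hc
  rw [eventually_nhdsWithin_iff, Metric.eventually_nhds_iff] at hs
  obtain ⟨δ, hδ0, hδ⟩ := hs
  set ε := min (δ / 2) (1 / 2) with hε
  have hε0 : 0 < ε := by positivity
  have hε1 : ε ≤ 1 / 2 := min_le_right _ _
  have hεδ : ε < δ := lt_of_le_of_lt (min_le_left _ _) (by linarith)
  have hsign : ∀ t, |t - 1| < δ → t ≠ 1 → 0 < (t - 1) * f' t := by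
    intro t ht htn
    have h2 := hδ (by rwa [Real.dist_eq]) htn
    rw [slope_def_field, h1, sub_zero] at h2
    have h3 : 0 < (t - 1) ^ 2 := by
      have : t - 1 ≠ 0 := sub_ne_zero.2 htn
      positivity
    have h4 : (t - 1) * f' t = (t - 1) ^ 2 * (f' t / (t - 1)) := by
      have : t - 1 ≠ 0 := sub_ne_zero.2 htn
      field_simp
    rw [h4]
    exact mul_pos h3 h2
  have hcont : ∀ s t : ℝ, 0 < s → ContinuousOn f (Set.Icc s t) := fun s t hs x hx =>
    (hf x (lt_of_lt_of_le hs hx.1)).continuousAt.continuousWithinAt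
  refine ⟨ε, hε0, by linarith, ?_, ?_⟩
  · obtain ⟨x, hx, hx'⟩ := exists_hasDerivAt_eq_slope f f' (show 1 - ε < 1 by linarith)
      (hcont _ _ (by linarith)) fun x hx => hf x (by linarith [hx.1])
    have h2 := hsign x (by rw [abs_lt]; constructor <;> linarith [hx.1, hx.2]) hx.2.ne
    have h3 : f' x < 0 := by nlinarith [hx.2]
    rw [eq_div_iff (by linarith)] at hx'
    nlinarith
  · obtain ⟨x, hx, hx'⟩ := exists_hasDerivAt_eq_slope f f' (show 1 < 1 + ε by linarith)
      (hcont _ _ one_pos) fun x hx => hf x (by linarith [hx.1])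
    have h2 := hsign x (by rw [abs_lt]; constructor <;> linarith [hx.1, hx.2]) hx.1.ne'
    have h3 : 0 < f' x := by nlinarith [hx.1]
    rw [eq_div_iff (by linarith)] at hx'
    nlinarith

section Functional

variable {n : ℕ} [hn : Fact (2 ≤ n)] {Ω : Set (Eucl n)} {h : Eucl n → ℝ} {a b p q β lam : ℝ}

namespace Admissible

theorem continuousOn_fiber (A : Admissible Ω h a b p q β lam) (u : W0 Ω) :
    ContinuousOn (fiber h a b p q β lam u) (Set.Ioi 0) := fun _ ht =>
  (A.hasDerivAt_fiber u ht).continuousAt.continuousWithinAt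

/-- A nonzero `v` whose fibering map is smaller at `1` than at both ends of an interval around `1`
has a multiple in `𝒩 ∖ {0}` of at most the same energy. -/
theorem exists_mem_nehari_le (A : Admissible Ω h a b p q β lam) {v : W0 Ω} {s t : ℝ}
    (hs0 : 0 < s) (hs1 : s < 1) (ht1 : 1 < t)
    (hs : fiber h a b p q β lam v 1 < fiber h a b p q β lam v s)
    (ht : fiber h a b p q β lam v 1 < fiber h a b p q β lam v t) :
    ∃ w ∈ nehari Ω h a b p q β lam \ {0},
      J h a b p q β lam w ≤ fiber h a b p q β lam v 1 := by
  have hv : v ≠ 0 := by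
    rintro rfl
    simp only [fiber, smul_zero, lt_irrefl] at hs
  obtain ⟨r, hr, hmin⟩ := isCompact_Icc.exists_isMinOn (Set.nonempty_Icc.2 (hs1.trans ht1).le)
    ((A.continuousOn_fiber v).mono fun r (hr : r ∈ Set.Icc s t) => lt_of_lt_of_le hs0 hr.1)
  have hle : fiber h a b p q β lam v r ≤ fiber h a b p q β lam v 1 := hmin ⟨hs1.le, ht1.le⟩
  have hrs : s < r := lt_of_le_of_ne hr.1 fun he => by subst he; exact hs.not_ge hle
  have hrt : r < t := lt_of_le_of_ne hr.2 fun he => by subst he; exact ht.not_ge hle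
  have hr0 : 0 < r := hs0.trans hrs
  have hd := (hmin.isLocalMin (Icc_mem_nhds hrs hrt)).deriv_eq_zero
  rw [A.deriv_fiber v hr0] at hd
  refine ⟨r • v, ⟨(A.mem_nehari_iff _).2 ((div_eq_zero_iff.1 hd).resolve_right hr0.ne'), ?_⟩, hle⟩
  exact smul_ne_zero hr0.ne' hv

theorem isLocalMinimum (A : Admissible Ω h a b p q β lam) {u : W0 Ω}
    (hu : IsNehariMinimizer h a b p q β lam u) : IsLocalMinimum h a b p q β lam u := by
  obtain ⟨⟨hplus, -⟩, hmin⟩ := hu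
  obtain ⟨hd, hdd⟩ := (A.mem_nehariPlus_iff u).1 hplus
  have hdd1 := A.hasDerivAt_dFiber u one_pos
  rw [one_smul, one_pow, div_one] at hdd1
  obtain ⟨ε, hε0, hε1, hlo, hhi⟩ := exists_lt_of_second_deriv_pos
    (fun t ht => A.hasDerivAt_fiber u ht) (by rw [one_smul, hd, zero_div]) hdd1 hdd
  have h1 : fiber h a b p q β lam u 1 = J h a b p q β lam u := by rw [fiber, one_smul]
  rw [h1] at hlo hhi
  by_contra hcon
  simp only [IsLocalMinimum, not_exists, not_and, not_forall, not_le] at hcon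
  choose! v hv hvJ using hcon
  have hv0 : Filter.Tendsto (fun k : ℕ => gradNorm (v (1 / ((k : ℝ) + 1)) - u)) Filter.atTop
      (nhds 0) :=
    squeeze_zero (fun k => gradNorm_nonneg _)
      (fun k => (hv (1 / ((k : ℝ) + 1)) (by positivity)).le) tendsto_one_div_add_atTop_nhds_zero_nat
  have hlim : ∀ c : ℝ, Filter.Tendsto
      (fun k : ℕ => fiber h a b p q β lam (v (1 / ((k : ℝ) + 1))) c) Filter.atTop
      (nhds (fiber h a b p q β lam u c)) := by
    intro c
    refine A.tendsto_J (u := fun k : ℕ => c • v (1 / ((k : ℝ) + 1))) (w := c • u) ?_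
    have h2 := hv0.const_mul |c|
    rw [mul_zero] at h2
    refine h2.congr fun k => ?_
    exact (gradNorm_smul c _).symm.trans (congrArg gradNorm (smul_sub c _ u))
  obtain ⟨k, hk1, hk2⟩ := (((hlim (1 - ε)).eventually_const_lt hlo).and
    ((hlim (1 + ε)).eventually_const_lt hhi)).exists
  have hvJ' := hvJ (1 / ((k : ℝ) + 1)) (by positivity)
  generalize v (1 / ((k : ℝ) + 1)) = w at hk1 hk2 hvJ'
  have h2 : fiber h a b p q β lam w 1 = J h a b p q β lam w := by rw [fiber, one_smul]
  rw [← h2] at hvJ'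
  obtain ⟨z, hz, hzJ⟩ := A.exists_mem_nehari_le (by linarith) (by linarith) (by linarith)
    (hvJ'.trans hk1) (hvJ'.trans hk2)
  exact ((hmin hz).trans hzJ).not_gt hvJ'

end Admissible

end Functional

/-! ### Comparison of energies on the Nehari manifold -/

section Functional

variable {n : ℕ} [hn : Fact (2 ≤ n)] {Ω : Set (Eucl n)} {h : Eucl n → ℝ} {a b p q β lam : ℝ}

namespace Admissible

theorem fiber_anti (A : Admissible Ω h a b p q β lam) (u : W0 Ω) {s t : ℝ} (hs : 0 < s)
    (hst : s ≤ t) (hd : ∀ r, s < r → r < t → dFiber h a b p q β lam (r • u) ≤ 0) :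
    fiber h a b p q β lam u t ≤ fiber h a b p q β lam u s := by
  refine antitoneOn_of_deriv_nonpos (convex_Icc s t) ((A.continuousOn_fiber u).mono
    fun r (hr : r ∈ Set.Icc s t) => lt_of_lt_of_le hs hr.1) ?_ ?_ (Set.left_mem_Icc.2 hst)
    (Set.right_mem_Icc.2 hst) hst
  · rw [interior_Icc]
    intro r hr
    exact (A.hasDerivAt_fiber u (hs.trans hr.1)).differentiableAt.differentiableWithinAt
  · rw [interior_Icc]
    intro r hr
    have hr0 := hs.trans hr.1
    rw [A.deriv_fiber u hr0]
    exact div_nonpos_of_nonpos_of_nonneg (hd r hr.1 hr.2) hr0.le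

theorem fiber_mono (A : Admissible Ω h a b p q β lam) (u : W0 Ω) {s t : ℝ} (hs : 0 < s)
    (hst : s ≤ t) (hd : ∀ r, s < r → r < t → 0 ≤ dFiber h a b p q β lam (r • u)) :
    fiber h a b p q β lam u s ≤ fiber h a b p q β lam u t := by
  refine monotoneOn_of_deriv_nonneg (convex_Icc s t) ((A.continuousOn_fiber u).mono
    fun r (hr : r ∈ Set.Icc s t) => lt_of_lt_of_le hs hr.1) ?_ ?_ (Set.left_mem_Icc.2 hst)
    (Set.right_mem_Icc.2 hst) hst
  · rw [interior_Icc]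
    intro r hr
    exact (A.hasDerivAt_fiber u (hs.trans hr.1)).differentiableAt.differentiableWithinAt
  · rw [interior_Icc]
    intro r hr
    have hr0 := hs.trans hr.1
    rw [A.deriv_fiber u hr0]
    exact div_nonneg (hd r hr.1 hr.2) hr0.le

/-- By the Rellich compactness theorem `H` is bounded on the unit ball, and it is homogeneous. -/
theorem exists_H_le (A : Admissible Ω h a b p q β lam) :
    ∃ C : ℝ, 0 ≤ C ∧ ∀ u : W0 Ω, H h q u ≤ C * gradNorm u ^ (q + 1) := by
  have hbdd : ∃ C : ℝ, ∀ u : W0 Ω, gradNorm u ≤ 1 → H h q u ≤ C := by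
    by_contra! hcon
    choose u hu huH using fun k : ℕ => hcon k
    obtain ⟨σ, w, ℓ, hσ, hw, -, -⟩ := exists_subseq_weakLimit A.bounded hu
    have h1 := A.tendsto_H (fun k => hu (σ k)) hw
    have h2 : Filter.Tendsto (fun k => ((σ k : ℕ) : ℝ)) Filter.atTop Filter.atTop :=
      tendsto_natCast_atTop_atTop.comp hσ.tendsto_atTop
    exact not_tendsto_atTop_of_tendsto_nhds h1
      (Filter.tendsto_atTop_mono (fun k => (huH (σ k)).le) h2)
  obtain ⟨C, hC⟩ := hbdd
  have hq := A.q_pos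
  refine ⟨max C 0, le_max_right _ _, fun u => ?_⟩
  rcases (gradNorm_nonneg u).eq_or_lt with h0 | hpos
  · have hu : H h q u ≤ 0 := by
      by_contra! hlt
      exact (A.gradNorm_pos (A.ne_zero_of_H_pos hlt)).ne h0
    have := gradNorm_nonneg u
    exact hu.trans (by positivity)
  · have h1 := hC ((gradNorm u)⁻¹ • u)
      (by rw [gradNorm_smul, abs_of_pos (by positivity), inv_mul_cancel₀ hpos.ne'])
    rw [H_smul, abs_of_pos (by positivity), Real.inv_rpow hpos.le] at h1
    have h2 : 0 < gradNorm u ^ (q + 1) := by positivity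
    rw [inv_mul_le_iff₀ h2, mul_comm] at h1
    exact h1.trans (mul_le_mul_of_nonneg_right (le_max_left _ _) h2.le)

/-- On the Nehari manifold `J` is coercive, up to the lower order term `H`. -/
theorem le_J_of_dFiber_eq_zero (A : Admissible Ω h a b p q β lam) {u : W0 Ω}
    (hu : dFiber h a b p q β lam u = 0) :
    (1 / n - 1 / (p + 2)) * b * gradNorm u ^ n -
      (1 / (q + 1) - 1 / (p + 2)) * lam * H h q u ≤ J h a b p q β lam u := by
  have hp := A.two_lt_p
  have hpn := A.lt_p
  have hβ := A.one_lt_β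
  have hn2 := A.two_le_dim
  have ha := A.a_pos
  have hG : ∫ x in Ω, G p β (fn u x) ≤ 1 / (p + 2) * intG p β u := by
    rw [intG, ← integral_const_mul]
    refine integral_mono (A.integrable u (expGrowth_G (by linarith) hβ)
      (continuous_G (by linarith) (by linarith))) ((A.integrable_g_mul u).const_mul _) fun x => ?_
    have := mul_G_le (p := p) (by linarith) hβ (fn u x)
    rw [one_div, ← div_eq_inv_mul, le_div_iff₀ (by linarith)]
    linarith
  have hQ : intG p β u = a * (gradNorm u ^ n) ^ 2 + b * gradNorm u ^ n - lam * H h q u := by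
    simp only [dFiber] at hu
    linarith
  have h1 : 0 ≤ (1 / (2 * n) - 1 / (p + 2)) * (a * (gradNorm u ^ n) ^ 2) := by
    have : 1 / (p + 2) ≤ 1 / (2 * (n : ℝ)) := by
      apply one_div_le_one_div_of_le <;> linarith
    exact mul_nonneg (by linarith) (by positivity)
  rw [J_eq]
  rw [hQ] at hG
  have e1 : 1 / (n : ℝ) * (a * (gradNorm u ^ n) ^ 2 / 2 + b * gradNorm u ^ n) =
      1 / (2 * n) * (a * (gradNorm u ^ n) ^ 2) + 1 / n * (b * gradNorm u ^ n) := by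
    field_simp
  have e2 : lam / (q + 1) * H h q u = 1 / (q + 1) * (lam * H h q u) := by ring
  rw [e1, e2]
  linarith

theorem coeff_pos (A : Admissible Ω h a b p q β lam) :
    0 < (1 / n - 1 / (p + 2)) * b ∧ 0 < (1 / (q + 1) - 1 / (p + 2)) * lam := by
  have hp := A.two_lt_p
  have hpn := A.lt_p
  have hn2 := A.two_le_dim
  have hq := A.q_lt
  have hq0 := A.q_pos
  have h1 : 1 / (p + 2) < 1 / (n : ℝ) := one_div_lt_one_div_of_lt (by linarith) (by linarith)
  have h2 : 1 / (p + 2) < 1 / (q + 1) := one_div_lt_one_div_of_lt (by linarith) (by linarith)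
  exact ⟨mul_pos (by linarith) A.b_pos, mul_pos (by linarith) A.lam_pos⟩

theorem neg_J_le (A : Admissible Ω h a b p q β lam) {u : W0 Ω}
    (hu : dFiber h a b p q β lam u = 0) :
    -J h a b p q β lam u ≤ (1 / (q + 1) - 1 / (p + 2)) * lam * H h q u := by
  have h1 := A.le_J_of_dFiber_eq_zero hu
  have h2 := mul_nonneg A.coeff_pos.1.le (pow_nonneg (gradNorm_nonneg u) n)
  linarith

/-- On the part of the Nehari manifold with negative energy the norm is bounded, as
`q + 1 < n`. -/
theorem exists_gradNorm_le (A : Admissible Ω h a b p q β lam) :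
    ∃ R : ℝ, 0 ≤ R ∧ ∀ u : W0 Ω, dFiber h a b p q β lam u = 0 → J h a b p q β lam u < 0 →
      gradNorm u ≤ R := by
  obtain ⟨C, hC0, hC⟩ := A.exists_H_le
  obtain ⟨hc1, hc2⟩ := A.coeff_pos
  have hq := A.q_lt
  set c₁ := (1 / n - 1 / (p + 2)) * b
  set c₂ := (1 / (q + 1) - 1 / (p + 2)) * lam
  refine ⟨(c₂ * C / c₁) ^ (1 / ((n : ℝ) - (q + 1))), by positivity, fun u hu hJ => ?_⟩
  rcases (gradNorm_nonneg u).eq_or_lt with h0 | hpos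
  · rw [← h0]; positivity
  · have h1 := A.le_J_of_dFiber_eq_zero hu
    have h2 := mul_le_mul_of_nonneg_left (hC u) hc2.le
    have h3 : c₁ * gradNorm u ^ n ≤ c₂ * (C * gradNorm u ^ (q + 1)) := by linarith
    have h4 : gradNorm u ^ n = gradNorm u ^ ((n : ℝ) - (q + 1)) * gradNorm u ^ (q + 1) := by
      rw [← Real.rpow_add hpos, ← Real.rpow_natCast]
      congr 1
      ring
    have h5 : 0 < gradNorm u ^ (q + 1) := by positivity
    have h6 : gradNorm u ^ ((n : ℝ) - (q + 1)) ≤ c₂ * C / c₁ := by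
      rw [le_div_iff₀ hc1]
      rw [h4] at h3
      nlinarith
    calc gradNorm u = (gradNorm u ^ ((n : ℝ) - (q + 1))) ^ (1 / ((n : ℝ) - (q + 1))) := by
          rw [← Real.rpow_mul hpos.le, mul_one_div_cancel (by linarith), Real.rpow_one]
      _ ≤ _ := by
          refine Real.rpow_le_rpow (by positivity) h6 ?_
          have : 0 < (n : ℝ) - (q + 1) := by linarith
          positivity

/-- Between its first critical point and a later one the fibering map does not decrease. -/
theorem fiber_le_of_critical (A : Admissible Ω h a b p q β lam)
    (hLam : 0 < LambdaInf Ω h a b p q β lam) {u : W0 Ω} (hu : 0 < H h q u) {s t : ℝ} (hs : 0 < s)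
    (hst : s ≤ t) (hs0 : dFiber h a b p q β lam (s • u) = 0)
    (ht0 : dFiber h a b p q β lam (t • u) = 0) :
    fiber h a b p q β lam u s ≤ fiber h a b p q β lam u t := by
  have hu0 := A.ne_zero_of_H_pos hu
  refine A.fiber_mono u hs hst fun r hr1 hr2 => ?_
  -- Otherwise `φ_u'(t) / t ^ q` would have a negative interior minimum.
  by_contra! hneg
  have hder := fun x (hx : x ∈ Set.Icc s t) =>
    A.hasDerivAt_dFiber_div_rpow u (lt_of_lt_of_le hs hx.1)
  obtain ⟨x, hx, hmin⟩ := isCompact_Icc.exists_isMinOn (Set.nonempty_Icc.2 hst)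
    fun x hx => (hder x hx).continuousAt.continuousWithinAt
  have hx0 : 0 < x := lt_of_lt_of_le hs hx.1
  have hr0 : 0 < r := hs.trans hr1
  have h1 : dFiber h a b p q β lam (x • u) / x / x ^ q < 0 := by
    refine lt_of_le_of_lt (hmin ⟨hr1.le, hr2.le⟩) ?_
    exact div_neg_of_neg_of_pos (div_neg_of_neg_of_pos hneg hr0) (by positivity)
  have hxs : s < x := lt_of_le_of_ne hx.1 fun he => by
    subst he
    rw [hs0, zero_div, zero_div] at h1
    exact lt_irrefl _ h1
  have hxt : x < t := lt_of_le_of_ne hx.2 fun he => by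
    subst he
    rw [ht0, zero_div, zero_div] at h1
    exact lt_irrefl _ h1
  have h2 := (hmin.isLocalMin (Icc_mem_nhds hxs hxt)).hasDerivAt_eq_zero (hder x hx)
  have h3 := (div_eq_zero_iff.1 h2).resolve_right (by positivity)
  have h4 := A.dFiber_pos_of_ddFiber_eq hLam (smul_ne_zero hx0.ne' hu0)
    (H_smul_pos hx0 hu).le (sub_eq_zero.1 h3)
  exact lt_asymm h1 (by positivity)

end Admissible

/-- The points of `𝒩 ∩ H⁺` that are the first critical points of their fibering maps. -/
def firstCritical (Ω : Set (Eucl n)) (h : Eucl n → ℝ) (a b p q β lam : ℝ) : Set (W0 Ω) :=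
  {u | 0 < H h q u ∧ dFiber h a b p q β lam u = 0 ∧
    ∀ t : ℝ, 0 < t → t < 1 → dFiber h a b p q β lam (t • u) < 0}

namespace Admissible

theorem smul_mem_firstCritical {u : W0 Ω} (hu : 0 < H h q u) {t₁ : ℝ}
    (ht₁ : 0 < t₁) (h0 : dFiber h a b p q β lam (t₁ • u) = 0)
    (hneg : ∀ t, 0 < t → t < t₁ → dFiber h a b p q β lam (t • u) < 0) :
    t₁ • u ∈ firstCritical Ω h a b p q β lam := by
  refine ⟨H_smul_pos ht₁ hu, h0, fun t ht ht1 => ?_⟩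
  have := hneg (t * t₁) (by positivity) (by nlinarith)
  rwa [mul_smul] at this

/-- A point of the Nehari manifold with negative energy lies in `H⁺`, and the first critical point
of its fibering map has at most the same energy. -/
theorem exists_firstCritical_le (A : Admissible Ω h a b p q β lam)
    (hLam : 0 < LambdaInf Ω h a b p q β lam) {u : W0 Ω} (hu : dFiber h a b p q β lam u = 0)
    (hJ : J h a b p q β lam u < 0) :
    ∃ w ∈ firstCritical Ω h a b p q β lam, J h a b p q β lam w ≤ J h a b p q β lam u := by
  have hH : 0 < H h q u := by
    have h1 := A.neg_J_le hu
    exact (pos_iff_pos_of_mul_pos (lt_of_lt_of_le (neg_pos.2 hJ) h1)).1 A.coeff_pos.2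
  obtain ⟨t₁, ht₁, h0, -, hneg⟩ := A.exists_first_critical hLam hH
  have hone : (1 : ℝ) • u = u := one_smul ℝ u
  have hle : t₁ ≤ 1 := by
    by_contra! hlt
    have := hneg 1 one_pos hlt
    rw [hone, hu] at this
    exact lt_irrefl _ this
  refine ⟨t₁ • u, smul_mem_firstCritical hH ht₁ h0 hneg, ?_⟩
  have := A.fiber_le_of_critical hLam hH ht₁ hle h0 (by rw [hone, hu])
  rwa [fiber, fiber, hone] at this

theorem J_neg_of_mem_firstCritical (A : Admissible Ω h a b p q β lam) {u : W0 Ω}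
    (hu : u ∈ firstCritical Ω h a b p q β lam) : J h a b p q β lam u < 0 := by
  obtain ⟨-, -, hneg⟩ := hu
  have hlt : fiber h a b p q β lam u 1 < fiber h a b p q β lam u (1 / 2) := by
    obtain ⟨x, hx, hx'⟩ := exists_hasDerivAt_eq_slope (fiber h a b p q β lam u) _
      (show (1 / 2 : ℝ) < 1 by norm_num) ((A.continuousOn_fiber u).mono
        fun r (hr : r ∈ Set.Icc (1 / 2 : ℝ) 1) => lt_of_lt_of_le (by norm_num) hr.1)
      fun x hx => A.hasDerivAt_fiber u (lt_trans (by norm_num) hx.1)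
    have hx0 : 0 < x := lt_trans (by norm_num) hx.1
    have h1 := div_neg_of_neg_of_pos (hneg x hx0 hx.2) hx0
    rw [hx', div_neg_iff] at h1
    rcases h1 with h1 | h1
    · linarith [h1.2]
    · linarith [h1.1]
  have hlim : Filter.Tendsto (fun k : ℕ => fiber h a b p q β lam u (1 / ((k : ℝ) + 1)))
      Filter.atTop (nhds (J h a b p q β lam (0 : W0 Ω))) := by
    refine A.tendsto_J (u := fun k : ℕ => (1 / ((k : ℝ) + 1)) • u) (w := 0) ?_
    have h2 := (tendsto_one_div_add_atTop_nhds_zero_nat (𝕜 := ℝ)).mul_const (gradNorm u)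
    rw [zero_mul] at h2
    refine h2.congr fun k => ?_
    rw [sub_zero, gradNorm_smul, abs_of_pos (by positivity)]
  have hle : fiber h a b p q β lam u (1 / 2) ≤ J h a b p q β lam (0 : W0 Ω) := by
    refine ge_of_tendsto hlim ?_
    filter_upwards [Filter.eventually_ge_atTop 1] with k hk
    have hk' : (1 : ℝ) ≤ k := by exact_mod_cast hk
    refine A.fiber_anti u (by positivity) (one_div_le_one_div_of_le (by norm_num) (by linarith))
      fun r hr1 hr2 => ?_
    exact (hneg r (lt_trans (by positivity) hr1) (by linarith)).le
  have hJ0 : J h a b p q β lam (0 : W0 Ω) = 0 := by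
    have h1 : H h q (0 : W0 Ω) = 0 := by
      have := H_smul (h := h) (q := q) 0 (0 : W0 Ω)
      rwa [zero_smul, abs_zero, Real.zero_rpow (by linarith [A.q_pos]), zero_mul] at this
    have h2 : ∫ x in Ω, G p β (fn (0 : W0 Ω) x) = 0 := by
      refine integral_eq_zero_of_ae ?_
      have h3 := fn_smul 0 (0 : W0 Ω)
      rw [zero_smul] at h3
      filter_upwards [h3] with x hx
      rw [hx, zero_mul]
      simp [G]
    rw [J_eq, h1, h2, gradNorm_zero, zero_pow (by have := hn.out; omega)]
    ring
  rw [fiber, one_smul] at hlt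
  linarith

end Admissible

end Functional

/-! ### Existence of a minimizer -/

/-- Smooth cut-off functions decreasing to the indicator function of a compact set. -/
theorem exists_test_tendsto_indicator {n : ℕ} {Ω K : Set (Eucl n)} (hΩ : IsOpen Ω)
    (hK : IsCompact K) (hKΩ : K ⊆ Ω) :
    ∃ φ : ℕ → Eucl n → ℝ, (∀ k, IsTest Ω (φ k)) ∧ (∀ k x, 0 ≤ φ k x ∧ φ k x ≤ 1) ∧
      ∀ x, Filter.Tendsto (fun k => φ k x) Filter.atTop (nhds (K.indicator 1 x)) := by
  obtain ⟨δ, hδ0, hδ⟩ := hK.exists_cthickening_subset_open hΩ hKΩ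
  obtain ⟨u, -, hu, hulim⟩ := exists_seq_strictAnti_tendsto' hδ0
  have hex : ∀ k, ∃ φ : Eucl n → ℝ, Function.support φ = Metric.thickening (u k) K ∧
      ContDiff ℝ ∞ φ ∧ Set.range φ ⊆ Set.Icc 0 1 ∧ ∀ x ∈ K, φ x = 1 := by
    intro k
    obtain ⟨φ, h1, h2, h3, h4⟩ := exists_contMDiff_support_eq_eq_one_iff
      (modelWithCornersSelf ℝ (Eucl n)) Metric.isOpen_thickening hK.isClosed
      (Metric.self_subset_thickening (hu k).1 K)
    exact ⟨φ, h3, h1.contDiff, h2, fun x hx => (h4 x).1 hx⟩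
  choose φ hsupp hdiff hrange hone using hex
  have hts : ∀ k, tsupport (φ k) ⊆ Metric.cthickening δ K := fun k => by
    rw [tsupport, hsupp k]
    exact (Metric.closure_thickening_subset_cthickening _ _).trans
      (Metric.cthickening_mono (hu k).2.le _)
  refine ⟨φ, fun k => ⟨hdiff k, ?_, (hts k).trans hδ⟩, fun k x => hrange k ⟨x, rfl⟩, fun x => ?_⟩
  · exact hK.cthickening.of_isClosed_subset (isClosed_tsupport _) (hts k)
  · by_cases hx : x ∈ K
    · simp [hone _ x hx, hx]
    · rw [Set.indicator_of_notMem hx]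
      obtain ⟨ε, hε, hxε⟩ : ∃ ε, 0 < ε ∧ x ∉ Metric.thickening ε K := by
        rw [← hK.isClosed.closure_eq, Metric.closure_eq_iInter_thickening K] at hx
        simpa using hx
      refine tendsto_const_nhds.congr' ?_
      filter_upwards [(tendsto_order.1 hulim).2 _ hε] with k hk
      by_contra hne
      have : x ∈ Function.support (φ k) := fun h0 => hne h0.symm
      rw [hsupp] at this
      exact hxε (Metric.thickening_mono hk.le K this)

/-- A function positive on a set of positive measure has positive integral over a compact set. -/
theorem exists_isCompact_setIntegral_pos {n : ℕ} {Ω : Set (Eucl n)} (hΩ : IsOpen Ω)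
    {h : Eucl n → ℝ} (hh : Integrable h (volume.restrict Ω))
    (hpos : ¬ ∀ᵐ x ∂(volume.restrict Ω), h x ≤ 0) :
    ∃ K ⊆ Ω, IsCompact K ∧ 0 < ∫ x in K, h x := by
  obtain ⟨f, hf, hhf⟩ := hh.aestronglyMeasurable
  have hfm : MeasurableSet {x | 0 < f x} := measurableSet_lt measurable_const hf.measurable
  have hS : 0 < volume ({x | 0 < f x} ∩ Ω) := by
    rw [pos_iff_ne_zero, ← Measure.restrict_apply hfm]
    intro h0
    apply hpos
    filter_upwards [hhf, measure_eq_zero_iff_ae_notMem.1 h0] with x hx1 hx2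
    rw [hx1]
    exact not_lt.1 hx2
  obtain ⟨K, hKS, hK, hK0⟩ := (hfm.inter hΩ.measurableSet).exists_lt_isCompact hS
  have hKΩ : K ⊆ Ω := hKS.trans Set.inter_subset_right
  refine ⟨K, hKΩ, hK, ?_⟩
  have hfK : IntegrableOn f K :=
    IntegrableOn.mono_set (t := Ω) (hh.congr hhf) hKΩ
  rw [integral_congr_ae (ae_restrict_of_ae_restrict_of_subset hKΩ hhf),
    setIntegral_pos_iff_support_of_nonneg_ae]
  · have hsub : K ⊆ Function.support f := fun x hx => (show 0 < f x from (hKS hx).1).ne'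
    rwa [Set.inter_eq_right.2 hsub]
  · exact (ae_restrict_mem hK.measurableSet).mono fun x hx => le_of_lt (hKS hx).1
  · exact hfK

theorem G_abs (p β t : ℝ) : G p β |t| = G p β t := by
  rcases abs_cases t with ⟨h, -⟩ | ⟨h, -⟩
  · rw [h]
  · have h1 := intervalIntegral.integral_comp_neg (f := g p β) (a := 0) (b := t)
    rw [neg_zero] at h1
    rw [h, G, G, intervalIntegral.integral_symm, ← h1, ← intervalIntegral.integral_neg]
    refine intervalIntegral.integral_congr fun s _ => ?_
    simp [g]

section Functional

variable {n : ℕ} [hn : Fact (2 ≤ n)] {Ω : Set (Eucl n)} {h : Eucl n → ℝ} {a b p q β lam : ℝ}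

namespace Admissible

theorem integrable_weight (A : Admissible Ω h a b p q β lam) :
    Integrable h (volume.restrict Ω) := by
  have := A.isFiniteMeasure
  refine A.memLp.integrable ?_
  rw [ENNReal.one_le_ofReal]
  exact A.holderConjugate.lt.le

theorem exists_H_pos (A : Admissible Ω h a b p q β lam) (hΩ : IsOpen Ω)
    (hpos : ¬ ∀ᵐ x ∂(volume.restrict Ω), h x ≤ 0) : ∃ u : W0 Ω, 0 < H h q u := by
  have hint := A.integrable_weight
  have hq := A.q_pos
  obtain ⟨K, hKΩ, hK, hKpos⟩ := exists_isCompact_setIntegral_pos hΩ hint hpos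
  obtain ⟨φ, hφ, hφ01, hφlim⟩ := exists_test_tendsto_indicator hΩ hK hKΩ
  have hcont := continuous_abs_rpow (show 0 ≤ q + 1 by linarith)
  have hlim : Filter.Tendsto (fun k => ∫ x in Ω, h x * |φ k x| ^ (q + 1)) Filter.atTop
      (nhds (∫ x in Ω, K.indicator h x)) := by
    refine tendsto_integral_of_dominated_convergence (fun x => ‖h x‖) (fun k => ?_) hint.norm
      (fun k => ?_) ?_
    · exact hint.aestronglyMeasurable.mul
        (hcont.comp (hφ k).contDiff.continuous).aestronglyMeasurable
    · refine Filter.Eventually.of_forall fun x => ?_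
      have h1 := hφ01 k x
      have h2 : |φ k x| ^ (q + 1) ≤ 1 := by
        rw [abs_of_nonneg h1.1]
        exact Real.rpow_le_one h1.1 h1.2 (by linarith)
      rw [norm_mul, Real.norm_of_nonneg (Real.rpow_nonneg (abs_nonneg _) _)]
      exact mul_le_of_le_one_right (norm_nonneg _) h2
    · refine Filter.Eventually.of_forall fun x => ?_
      have h1 := (((hcont.tendsto _).comp (hφlim x)).const_mul (h x))
      have h2 : h x * |K.indicator (1 : Eucl n → ℝ) x| ^ (q + 1) = K.indicator h x := by
        by_cases hx : x ∈ K
        · simp [hx]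
        · simp [hx, Real.zero_rpow (show q + 1 ≠ 0 by linarith)]
      rwa [h2] at h1
  rw [setIntegral_indicator hK.measurableSet, Set.inter_eq_right.2 hKΩ] at hlim
  obtain ⟨k, hk⟩ := (hlim.eventually_const_lt hKpos).exists
  refine ⟨ofTest (hφ k), ?_⟩
  rw [H]
  refine lt_of_lt_of_eq hk (integral_congr_ae ?_)
  filter_upwards [fn_ofTest (hφ k)] with x hx
  rw [hx]

theorem firstCritical_nonempty (A : Admissible Ω h a b p q β lam) (hΩ : IsOpen Ω)
    (hpos : ¬ ∀ᵐ x ∂(volume.restrict Ω), h x ≤ 0) (hLam : 0 < LambdaInf Ω h a b p q β lam) :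
    (firstCritical Ω h a b p q β lam).Nonempty := by
  obtain ⟨u, hu⟩ := A.exists_H_pos hΩ hpos
  obtain ⟨t₁, ht₁, h0, -, hneg⟩ := A.exists_first_critical hLam hu
  exact ⟨_, smul_mem_firstCritical hu ht₁ h0 hneg⟩

theorem bddBelow_J (A : Admissible Ω h a b p q β lam) :
    BddBelow (J h a b p q β lam '' firstCritical Ω h a b p q β lam) := by
  obtain ⟨R, hR0, hR⟩ := A.exists_gradNorm_le
  obtain ⟨C, hC0, hC⟩ := A.exists_H_le
  have hq := A.q_pos
  refine ⟨-((1 / (q + 1) - 1 / (p + 2)) * lam * (C * R ^ (q + 1))), ?_⟩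
  rintro _ ⟨u, hu, rfl⟩
  have h1 := A.neg_J_le hu.2.1
  have h2 : H h q u ≤ C * R ^ (q + 1) := (hC u).trans (mul_le_mul_of_nonneg_left
    (Real.rpow_le_rpow (gradNorm_nonneg u) (hR u hu.2.1 (A.J_neg_of_mem_firstCritical hu))
      (by linarith)) hC0)
  have h3 := mul_le_mul_of_nonneg_left h2 A.coeff_pos.2.le
  linarith

/-- If the fibering map of `w` decreases on `(0, 1]` and `H(w) > 0`, then the first critical point
`t₁` of the fibering map satisfies `1 ≤ t₁`, so `t₁ w` is a point of `𝒩⁺ ∩ H⁺` of at most the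
energy of `w`. -/
theorem exists_smul_mem_nehariPlus (A : Admissible Ω h a b p q β lam)
    (hLam : 0 < LambdaInf Ω h a b p q β lam) {w : W0 Ω} (hw : 0 < H h q w)
    (hanti : ∀ s t : ℝ, 0 < s → s ≤ t → t ≤ 1 →
      fiber h a b p q β lam w t ≤ fiber h a b p q β lam w s) :
    ∃ t : ℝ, 0 < t ∧ t • w ∈ nehariPlus Ω h a b p q β lam ∩ Hplus Ω h q ∧
      J h a b p q β lam (t • w) ≤ J h a b p q β lam w := by
  obtain ⟨t₁, ht₁, h0, hdd, hneg⟩ := A.exists_first_critical hLam hw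
  have hle : 1 ≤ t₁ := by
    by_contra! hlt
    have hnonpos : ∀ t, 0 < t → t < 1 → dFiber h a b p q β lam (t • w) / t ≤ 0 := by
      intro t ht ht1
      refine le_of_tendsto (hasDerivAt_iff_tendsto_slope_left_right.1
        (A.hasDerivAt_fiber w ht)).2 ?_
      filter_upwards [self_mem_nhdsWithin, (gt_mem_nhds ht1).filter_mono nhdsWithin_le_nhds]
        with s hs1 hs2
      have hs1 : t < s := hs1
      rw [slope_def_field]
      exact div_nonpos_of_nonpos_of_nonneg (sub_nonpos.2 (hanti t s ht hs1.le hs2.le))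
        (by linarith)
    have hc : ddFiber h a b p q β lam (t₁ • w) / t₁ ^ 2 ≤ 0 := by
      refine le_of_tendsto (hasDerivAt_iff_tendsto_slope_left_right.1
        (A.hasDerivAt_dFiber w ht₁)).2 ?_
      filter_upwards [self_mem_nhdsWithin, (gt_mem_nhds hlt).filter_mono nhdsWithin_le_nhds]
        with s hs1 hs2
      have hs1 : t₁ < s := hs1
      rw [slope_def_field, h0, zero_div, sub_zero]
      exact div_nonpos_of_nonpos_of_nonneg (hnonpos s (ht₁.trans hs1) hs2) (by linarith)
    have : 0 < ddFiber h a b p q β lam (t₁ • w) / t₁ ^ 2 := by positivity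
    linarith
  refine ⟨t₁, ht₁, ⟨(A.mem_nehariPlus_iff _).2 ⟨h0, hdd⟩, H_smul_pos ht₁ hw⟩, ?_⟩
  have h1 := A.fiber_anti w one_pos hle fun r hr1 hr2 => (hneg r (by linarith) hr2).le
  have hone : (1 : ℝ) • w = w := one_smul ℝ w
  rwa [fiber, fiber, hone] at h1

/-- The limit of a sequence of first critical points, with nonnegative representative. The norm can
only drop in the limit; as it enters `φ_u(t)` through nondecreasing functions of `t`, the limit
still has a decreasing fibering map. -/
theorem exists_limit (A : Admissible Ω h a b p q β lam) {u : ℕ → W0 Ω}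
    (hu : ∀ k, u k ∈ firstCritical Ω h a b p q β lam) {θ : ℝ} (hθ : θ < 0)
    (hlim : Filter.Tendsto (fun k => J h a b p q β lam (u k)) Filter.atTop (nhds θ)) :
    ∃ w : W0 Ω, (∀ᵐ x ∂(volume.restrict Ω), 0 ≤ fn w x) ∧ 0 < H h q w ∧
      J h a b p q β lam w ≤ θ ∧ ∀ s t : ℝ, 0 < s → s ≤ t → t ≤ 1 →
        fiber h a b p q β lam w t ≤ fiber h a b p q β lam w s := by
  have hp := A.two_lt_p
  have hβ := A.one_lt_β
  have ha := A.a_pos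
  have hb := A.b_pos
  have hn2 := A.two_le_dim
  obtain ⟨R, hR0, hR⟩ := A.exists_gradNorm_le
  have huR : ∀ k, gradNorm (u k) ≤ R := fun k =>
    hR _ (hu k).2.1 (A.J_neg_of_mem_firstCritical (hu k))
  obtain ⟨σ, v, ℓ, hσ, hv, hℓ, hvℓ⟩ := exists_subseq_weakLimit A.bounded huR
  obtain ⟨w, hw, hwv⟩ := exists_abs A.bounded v
  have hHw : H h q w = H h q v := by
    rw [H, H]
    refine integral_congr_ae ?_
    filter_upwards [hw] with x hx
    rw [hx, abs_abs]
  have hGw : ∀ t : ℝ, ∫ x in Ω, G p β (t * fn w x) * fn w x ^ 0 =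
      ∫ x in Ω, G p β (t * fn v x) := by
    intro t
    refine integral_congr_ae ?_
    filter_upwards [hw] with x hx
    rw [hx, pow_zero, mul_one, ← G_abs, abs_mul, abs_abs, ← abs_mul, G_abs]
  have hHlim := A.tendsto_H (fun k => huR (σ k)) hv
  have hGlim : ∀ t : ℝ, Filter.Tendsto (fun k => ∫ x in Ω, G p β (t * fn (u (σ k)) x) *
      fn (u (σ k)) x ^ 0) Filter.atTop (nhds (∫ x in Ω, G p β (t * fn v x))) := by
    intro t
    simp only [pow_zero, mul_one]
    exact A.tendsto_integral (fun k => huR (σ k)) hv (F := fun s => G p β (t * s))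
      ((expGrowth_G (by linarith) hβ).comp_mul t)
      ((continuous_G (by linarith) (by linarith)).comp (continuous_const_mul t))
  -- The limit of the fibering maps `φ_{u_k}`.
  set L : ℝ → ℝ := fun t => a * (ℓ ^ n) ^ 2 / (2 * n) * t ^ (2 * (n : ℝ)) +
    b * ℓ ^ n / n * t ^ (n : ℝ) - lam / (q + 1) * H h q v * t ^ (q + 1) -
    ∫ x in Ω, G p β (t * fn v x) with hL
  have hLlim : ∀ t, 0 < t → Filter.Tendsto (fun k => fiber h a b p q β lam (u (σ k)) t)
      Filter.atTop (nhds (L t)) := by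
    intro t ht
    simp only [fiber_eq ht]
    exact ((((((((hℓ.pow n).pow 2).const_mul a).div_const _).mul_const _).add
      ((((hℓ.pow n).const_mul b).div_const _).mul_const _)).sub
      ((hHlim.const_mul _).mul_const _)).sub (hGlim t))
  have hLanti : ∀ s t : ℝ, 0 < s → s ≤ t → t ≤ 1 → L t ≤ L s := fun s t hs hst ht =>
    le_of_tendsto_of_tendsto' (hLlim t (hs.trans_le hst)) (hLlim s hs) fun k =>
      A.fiber_anti (u (σ k)) hs hst fun r hr1 hr2 =>
        ((hu (σ k)).2.2 r (hs.trans hr1) (hr2.trans_le ht)).le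
  have hκ : gradNorm w ^ n ≤ ℓ ^ n := pow_le_pow_left₀ (gradNorm_nonneg w) (hwv.trans hvℓ) n
  have hκ0 : 0 ≤ gradNorm w ^ n := pow_nonneg (gradNorm_nonneg w) n
  have hD1 : 0 ≤ a * (ℓ ^ n) ^ 2 / (2 * n) - a * (gradNorm w ^ n) ^ 2 / (2 * n) := by
    rw [← sub_div, ← mul_sub]
    have := pow_le_pow_left₀ hκ0 hκ 2
    exact div_nonneg (mul_nonneg ha.le (by linarith)) (by linarith)
  have hD2 : 0 ≤ b * ℓ ^ n / n - b * gradNorm w ^ n / n := by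
    rw [← sub_div, ← mul_sub]
    exact div_nonneg (mul_nonneg hb.le (by linarith)) (by linarith)
  have hfw : ∀ t, 0 < t → fiber h a b p q β lam w t = L t -
      ((a * (ℓ ^ n) ^ 2 / (2 * n) - a * (gradNorm w ^ n) ^ 2 / (2 * n)) * t ^ (2 * (n : ℝ)) +
      (b * ℓ ^ n / n - b * gradNorm w ^ n / n) * t ^ (n : ℝ)) := by
    intro t ht
    rw [fiber_eq ht, hGw, hHw, hL]
    ring
  have hfiber1 : ∀ z : W0 Ω, fiber h a b p q β lam z 1 = J h a b p q β lam z := fun z => by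
    have hone : (1 : ℝ) • z = z := one_smul ℝ z
    rw [fiber, hone]
  refine ⟨w, ?_, ?_, ?_, fun s t hs hst ht => ?_⟩
  · filter_upwards [hw] with x hx
    rw [hx]
    exact abs_nonneg _
  · rw [hHw]
    have h1 := le_of_tendsto_of_tendsto' (hlim.comp hσ.tendsto_atTop).neg
      (hHlim.const_mul ((1 / (q + 1) - 1 / (p + 2)) * lam)) fun k => A.neg_J_le (hu (σ k)).2.1
    exact (pos_iff_pos_of_mul_pos (lt_of_lt_of_le (neg_pos.2 hθ) h1)).1 A.coeff_pos.2
  · have h1 : L 1 = θ := by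
      refine tendsto_nhds_unique (hLlim 1 one_pos) ?_
      simp only [hfiber1]
      exact hlim.comp hσ.tendsto_atTop
    have h2 := hfw 1 one_pos
    rw [hfiber1, h1, Real.one_rpow, Real.one_rpow, mul_one, mul_one] at h2
    linarith
  · rw [hfw s hs, hfw t (hs.trans_le hst)]
    have h1 := hLanti s t hs hst ht
    have h2 : s ^ (2 * (n : ℝ)) ≤ t ^ (2 * (n : ℝ)) :=
      Real.rpow_le_rpow hs.le hst (by linarith)
    have h3 : s ^ (n : ℝ) ≤ t ^ (n : ℝ) := Real.rpow_le_rpow hs.le hst (by linarith)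
    have h4 := mul_le_mul_of_nonneg_left h2 hD1
    have h5 := mul_le_mul_of_nonneg_left h3 hD2
    linarith

theorem exists_isNehariMinimizer (A : Admissible Ω h a b p q β lam) (hΩ : IsOpen Ω)
    (hpos : ¬ ∀ᵐ x ∂(volume.restrict Ω), h x ≤ 0) (hLam : 0 < LambdaInf Ω h a b p q β lam) :
    ∃ u : W0 Ω, IsNehariMinimizer h a b p q β lam u ∧
      ∀ᵐ x ∂(volume.restrict Ω), 0 ≤ fn u x := by
  have hne := A.firstCritical_nonempty hΩ hpos hLam
  have hbdd := A.bddBelow_J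
  set θ := sInf (J h a b p q β lam '' firstCritical Ω h a b p q β lam) with hθ
  have hle : ∀ u ∈ firstCritical Ω h a b p q β lam, θ ≤ J h a b p q β lam u := fun u hu =>
    csInf_le hbdd ⟨u, hu, rfl⟩
  obtain ⟨u₀, hu₀⟩ := hne
  have hθ0 : θ < 0 := (hle u₀ hu₀).trans_lt (A.J_neg_of_mem_firstCritical hu₀)
  obtain ⟨y, -, hy, hyS⟩ := exists_seq_tendsto_sInf (Set.Nonempty.image _ ⟨u₀, hu₀⟩) hbdd
  choose u hu huy using hyS
  obtain ⟨w, hw0, hwH, hwJ, hanti⟩ := A.exists_limit hu hθ0 (hy.congr fun k => (huy k).symm)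
  obtain ⟨t, ht, hmem, hJ⟩ := A.exists_smul_mem_nehariPlus hLam hwH hanti
  refine ⟨t • w, ⟨hmem, fun v hv => ?_⟩, ?_⟩
  · refine (hJ.trans hwJ).trans ?_
    by_cases hvJ : J h a b p q β lam v < 0
    · obtain ⟨z, hz, hzJ⟩ := A.exists_firstCritical_le hLam ((A.mem_nehari_iff v).1 hv.1) hvJ
      exact (hle z hz).trans hzJ
    · exact hθ0.le.trans (not_lt.1 hvJ)
  · filter_upwards [hw0, fn_smul t w] with x hx1 hx2
    rw [hx2]
    positivity

end Admissible

end Functional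

end Kirchhoff

theorem theorem3p12 (n : ℕ) [Fact (2 ≤ n)] (Ω : Set (Kirchhoff.Eucl n))
    (hΩo : IsOpen Ω) (hΩc : IsConnected Ω) (hΩb : Bornology.IsBounded Ω)
    (a b p q β lam : ℝ) (ha : 0 < a) (hb : 0 < b)
    (hq0 : 0 < q) (hq : q < n - 1) (hp : 2 * (n : ℝ) - 1 < p + 1)
    (hβ1 : 1 < β) (hβ : β < n / (n - 1)) (hlam : 0 < lam)
    (h : Kirchhoff.Eucl n → ℝ)
    (hh : MemLp h (ENNReal.ofReal (n / (n - q - 1))) (volume.restrict Ω))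
    (hpos : ¬ ∀ᵐ x ∂(volume.restrict Ω), h x ≤ 0)
    (hLam : 0 < Kirchhoff.LambdaInf Ω h a b p q β lam) :
    (∀ u : Kirchhoff.W0 Ω, Kirchhoff.IsNehariMinimizer h a b p q β lam u →
      Kirchhoff.IsLocalMinimum h a b p q β lam u) ∧
    (∃ u : Kirchhoff.W0 Ω, Kirchhoff.IsNehariMinimizer h a b p q β lam u ∧
      Kirchhoff.IsLocalMinimum h a b p q β lam u ∧
      ∀ᵐ x ∂(volume.restrict Ω), 0 ≤ Kirchhoff.fn u x) := by
  have A : Kirchhoff.Admissible Ω h a b p q β lam :=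
    ⟨hΩb, ha, hb, hq0, hq, hp, hβ1, hβ, hlam, hh⟩
  obtain ⟨u, hu, hu0⟩ := A.exists_isNehariMinimizer hΩo hpos hLam
  exact ⟨fun u hu => A.isLocalMinimum hu, u, hu, A.isLocalMinimum hu, hu0⟩
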